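/- Let $G$ be a finite group and let $\chi$ be an irreducible complex character of $G$ of even degree $\chi(1)=2m$ and Frobenius–Schur indicator $o$ (i.e. not real valued). Let $L=\mathbb{Q}(\chi)\subset\mathbb{C}$ be its character field, $K=L^+=L\cap\mathbb{R}$, and let $N=N_{L/K}(L^\times)\le K^\times$. Assume that there is an $L$-representation $\rho:G\to \mathrm{GL}(V)$ affording $\chi$, and let $H:V\times V\to L$ be a non-degenerate $\rho(G)$-invariant Hermitian form with respect to complex conjugation on $L$. Let $\iota_H$ be the adjoint involution of $H$ on $\mathrm{End}_L(V)$, given by $H(fv,w)=H(v,\iota_H(f)w)$, and let $\mathrm{disc}(H)=(-1)^{\binom{2m}{2}}\det\big(H(b_i,b_j)\big)N\in K^\times/N$ for any $L$-basis $(b_i)$ of $V$. Let $\alpha\in\mathrm{Aut}(G)$ satisfy $\alpha^2=1$ and $\chi\circ\alpha=\overline{\chi}$, let $\mathcal{G}=G\rtimes\langle\alpha\rangle$ and let $X=\mathrm{Ind}_G^{\mathcal{G}}(\chi)$, an irreducible character of $\mathcal{G}$. Let $$A=\langle \rho(g)+\rho(\alpha(g)) \mid g\in G\rangle_K\subseteq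 \mathrm{End}_L(V)$$ (a $K$-subalgebra), and let $\mathcal{Q}=\mathrm{End}_{K\mathcal{G}}(\mathcal{V})$ for a $K\mathcal{G}$-module $\mathcal{V}$ affording the character $2X$. Write $\mathrm{Br}_2(L,K)$ for the group of Brauer classes of central simple $K$-algebras that have exponent dividing $2$ and are split by $L$. For $b\in K^\times$ write $(L,b)_K$ for the quaternion algebra $(\delta,b)_K$ (generators $i,j$ with $i^2=\delta$, $j^2=b$, $ij=-ji$), where $L=K[\sqrt{\delta}]$, and put $\mathrm{disc}_L([D])=bN\in K^\times/N$ if $[D]=[(L,b)_K]$. Then: (a) $A$ and $\mathcal{Q}$ are central simple $K$-algebras and $[A]=[\mathcal{Q}]\in \mathrm{Br}_2(L,K)$. (b) $\iota_H(A)=A$. (c) If $X$ has Frobenius–Schur indicator $+$, then $A$ is an orthogonal subalgebra of $(\mathrm{End}_L(V),\iota_H)$, i.e. $A$ is a central simple $K$-algebra with $LA=\mathrm{End}_L(V)$ and $\iota_H(A)=A$ on which $\iota_H$ restricts to an orthogonal involution (an involution whose space of skew elements has dimension $n(n-1)/2$, where $\dim_K A=n^2$). Moreover $$\mathrm{disc}(H)=\mathrm{disc}_L([\mathcal{Q}])^m\cdot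 \mathrm{disc}(\iota_H|_A)\quad\text{in } K^\times/N,$$ where $\mathrm{disc}(\iota_H|_A)=(-1)^mN_{red}(a)(K^\times)^2$ for any invertible $a\in A$ with $\iota_H(a)=-a$, and $N_{red}$ is the reduced norm. (d) If $X$ has Frobenius–Schur indicator $-$, then $\mathrm{disc}(H)=\mathrm{disc}_L([\mathcal{Q}])^m$ in $K^\times/N$. -/

import Mathlib

open scoped TensorProduct ComplexConjugate

noncomputable section

universe u v w

/-! ### Central simple algebras and Brauer equivalence -/

/-- `A` is a (finite-dimensional) central simple `K`-algebra. -/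
structure IsCentralSimple (K : Type u) [Field K] (A : Type v) [Ring A] [Algebra K A] : Prop where
  central : Algebra.IsCentral K A
  simple : IsSimpleRing A
  finite : FiniteDimensional K A

/-- Brauer equivalence `[A] = [B]`: some matrix algebras over `A` and `B` are isomorphic. This is
Mathlib's `IsBrauerEquivalent` without bundling, so that `A` and `B` may live in different
universes. -/
def BrauerEquiv (K : Type u) [Field K] (A : Type v) [Ring A] [Algebra K A]
    (B : Type w) [Ring B] [Algebra K B] : Prop :=
  ∃ n m : ℕ, n ≠ 0 ∧ m ≠ 0 ∧
    Nonempty (Matrix (Fin n) (Fin n) A ≃ₐ[K] Matrix (Fin m) (Fin m) B)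

theorem brauerEquiv_iff_isBrauerEquivalent {K : Type u} [Field K] (A B : CSA.{u, v} K) :
    BrauerEquiv K A B ↔ IsBrauerEquivalent A B := Iff.rfl

/-- The class of the central simple `K`-algebra `A` lies in `Br₂(L, K)`: it has exponent dividing
`2` in the Brauer group of `K` and it is split by `L`. -/
structure IsInBrTwo (K : Type u) [Field K] (L : Type v) [Field L] [Algebra K L]
    (A : Type w) [Ring A] [Algebra K A] : Prop where
  centralSimple : IsCentralSimple K A
  exponent_two : BrauerEquiv K (A ⊗[K] A) K
  split : BrauerEquiv L (L ⊗[K] A) L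

/-! ### Norm classes and the `L`-discriminant of a Brauer class -/

/-- The norm subgroup `N_{L/K}(Lˣ)` of `Kˣ`. -/
def normSubgroup (K : Type u) [Field K] (L : Type v) [Field L] [Algebra K L] : Subgroup Kˣ :=
  (Units.map (Algebra.norm K : L →* K)).range

/-- The subgroup of squares of `Kˣ`. -/
def squareSubgroup (K : Type u) [Field K] : Subgroup Kˣ :=
  (powMonoidHom 2 : Kˣ →* Kˣ).range

/-- `L / K` is a quadratic extension and `L = K[√δ]`. -/
def IsQuadraticGenerator (K : Type u) [Field K] (L : Type v) [Field L] [Algebra K L]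
    (δ : K) : Prop :=
  Module.finrank K L = 2 ∧ ∃ s : L, s ^ 2 = algebraMap K L δ ∧ Algebra.adjoin K {s} = ⊤

/-- `[D] = [(L, b)_K]`, where `(L, b)_K = (δ, b)_K` for `L = K[√δ]`, and `(δ, b)_K` is the
quaternion algebra with `i² = δ`, `j² = b`, `ij = -ji`. -/
def IsClassOfQuaternion (K : Type u) [Field K] (L : Type v) [Field L] [Algebra K L]
    (D : Type w) [Ring D] [Algebra K D] (b : Kˣ) : Prop :=
  ∃ δ : Kˣ, IsQuadraticGenerator K L (δ : K) ∧
    BrauerEquiv K D (QuaternionAlgebra K (δ : K) 0 (b : K))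

/-- The `L`-discriminant of `[D]` is defined and equal to `c`: there is `b ∈ Kˣ` with
`[D] = [(L, b)_K]`, and every such `b` represents the class `c` of `Kˣ / N_{L/K}(Lˣ)`. -/
def HasLDisc (K : Type u) [Field K] (L : Type v) [Field L] [Algebra K L]
    (D : Type w) [Ring D] [Algebra K D] (c : Kˣ ⧸ normSubgroup K L) : Prop :=
  (∃ b : Kˣ, IsClassOfQuaternion K L D b) ∧
    ∀ b : Kˣ, IsClassOfQuaternion K L D b → (QuotientGroup.mk b : Kˣ ⧸ normSubgroup K L) = c

/-! ### Involutions -/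

/-- `τ` is a `K`-linear involution of the `K`-algebra `A`, i.e. a ring anti-automorphism with
`τ ∘ τ = id`. -/
structure IsInvolution (K : Type u) [Field K] {A : Type v} [Ring A] [Algebra K A]
    (τ : A →ₗ[K] A) : Prop where
  map_mul : ∀ a b, τ (a * b) = τ b * τ a
  involutive : ∀ a, τ (τ a) = a

/-- The space `A⁻` of skew elements of an involution. -/
def skewSpace (K : Type u) [Field K] {A : Type v} [Ring A] [Algebra K A]
    (τ : A →ₗ[K] A) : Submodule K A where
  carrier := {a | τ a = -a}
  add_mem' := by
    intro a b ha hb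
    simp only [Set.mem_ofPred_eq] at *
    rw [map_add, ha, hb, neg_add]
  zero_mem' := by simp
  smul_mem' := by
    intro c a ha
    simp only [Set.mem_ofPred_eq] at *
    rw [map_smul, ha, smul_neg]

/-- `τ` is an orthogonal involution on the `K`-algebra `A` of degree `n` (so `dim_K A = n²`):
a `K`-linear involution with `dim_K A⁻ = n(n-1)/2`. -/
structure IsOrthogonalInvolution (K : Type u) [Field K] {A : Type v} [Ring A] [Algebra K A]
    (τ : A →ₗ[K] A) : Prop where
  involution : IsInvolution K τ
  dim_skew : ∃ n : ℕ, Module.finrank K A = n ^ 2 ∧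
    Module.finrank K (skewSpace K τ) = n * (n - 1) / 2

/-- `r` is the reduced norm of the element `a` of the central simple `K`-algebra `A`: the
determinant of `1 ⊗ a` in `E ⊗ A ≅ Matₙ(E)` for a splitting field `E`. (The value depends neither
on `E` nor on the isomorphism.) -/
def IsReducedNorm (K : Type u) [Field K] {A : Type v} [Ring A] [Algebra K A]
    (a : A) (r : K) : Prop :=
  ∃ (E : Type u) (_ : Field E) (_ : Algebra K E) (n : ℕ)
    (φ : E ⊗[K] A ≃ₐ[E] Matrix (Fin n) (Fin n) E),
    algebraMap K E r = (φ ((1 : E) ⊗ₜ[K] a)).det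

/-- The discriminant of the orthogonal involution `τ` on the central simple `K`-algebra `A` of even
degree `2n` is the square class `x`: there are invertible skew elements, and for each of them,
`a` say, the class of `(-1)ⁿ N_red(a)` is `x`. -/
def HasInvolutionDisc (K : Type u) [Field K] {A : Type v} [Ring A] [Algebra K A]
    (τ : A →ₗ[K] A) (x : Kˣ ⧸ squareSubgroup K) : Prop :=
  ∃ n : ℕ, Module.finrank K A = (2 * n) ^ 2 ∧
    (∃ a : Aˣ, τ (a : A) = -(a : A)) ∧
    ∀ a : Aˣ, τ (a : A) = -(a : A) → ∃ r : Kˣ, IsReducedNorm K (a : A) (r : K) ∧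
      (QuotientGroup.mk ((-1) ^ n * r) : Kˣ ⧸ squareSubgroup K) = x

/-- The restriction of a `K`-linear map `τ` to a subalgebra `A` with `τ(A) = A`. -/
def restrictSubalgebra {K : Type u} [Field K] {B : Type v} [Ring B] [Algebra K B]
    (τ : B →ₗ[K] B) (A : Subalgebra K B)
    (h : (Subalgebra.toSubmodule A).map τ = Subalgebra.toSubmodule A) : A →ₗ[K] A :=
  τ.restrict (p := Subalgebra.toSubmodule A) (q := Subalgebra.toSubmodule A)
    (fun _ hx => h ▸ Submodule.mem_map_of_mem hx)

/-- `A` is an orthogonal subalgebra of the central simple `L`-algebra `B` with the involution `τ` of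
the second kind. -/
structure IsOrthogonalSubalgebra (K : Type u) [Field K] (L : Type w) [Field L] [Algebra K L]
    {B : Type v} [Ring B] [Algebra K B] [Algebra L B] (τ : B →ₗ[K] B)
    (A : Subalgebra K B) : Prop where
  centralSimple : IsCentralSimple K A
  span_eq_top : Submodule.span L (A : Set B) = ⊤
  stable : (Subalgebra.toSubmodule A).map τ = Subalgebra.toSubmodule A
  orthogonal : IsOrthogonalInvolution K (restrictSubalgebra τ A stable)

/-! ### Hermitian forms -/

/-- A non-degenerate Hermitian form on the `L`-vector space `V` with respect to the automorphism
`σ` of `L` over `K`. -/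
structure HermitianForm {K : Type u} [Field K] {L : Type v} [Field L] [Algebra K L]
    (σ : L ≃ₐ[K] L) (V : Type w) [AddCommGroup V] [Module L V] where
  form : V → V → L
  add_left : ∀ v v' w, form (v + v') w = form v w + form v' w
  smul_left : ∀ (a : L) v w, form (a • v) w = a * form v w
  symm : ∀ v w, form v w = σ (form w v)
  nondegenerate : ∀ v, (∀ w, form v w = 0) → v = 0

namespace HermitianForm

variable {K : Type u} [Field K] {L : Type v} [Field L] [Algebra K L] {σ : L ≃ₐ[K] L}
  {V : Type w} [AddCommGroup V] [Module L V]

theorem symm_symm (H : HermitianForm σ V) (v w : V) : σ (σ (H.form v w)) = H.form v w := by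
  rw [← H.symm w v, ← H.symm v w]

theorem add_right (H : HermitianForm σ V) (v w w' : V) :
    H.form v (w + w') = H.form v w + H.form v w' := by
  rw [H.symm, H.add_left, map_add, ← H.symm, ← H.symm]

theorem smul_right (H : HermitianForm σ V) (a : L) (v w : V) :
    H.form v (a • w) = σ a * H.form v w := by
  rw [H.symm, H.smul_left, map_mul, ← H.symm]

theorem ext_right (H : HermitianForm σ V) {w w' : V} (h : ∀ v, H.form v w = H.form v w') :
    w = w' := by
  have hz : ∀ w, H.form 0 w = 0 := fun w => by simpa using H.smul_left 0 0 w
  refine sub_eq_zero.1 (H.nondegenerate _ fun v => ?_)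
  have h1 := H.add_left (w - w') w' v
  rw [sub_add_cancel, H.symm w, H.symm w', h v] at h1
  simpa using h1

/-- The linear form `v ↦ H(v, w)`. -/
def toDual (H : HermitianForm σ V) (w : V) : Module.Dual L V where
  toFun v := H.form v w
  map_add' v v' := H.add_left v v' w
  map_smul' a v := H.smul_left a v w

theorem exists_toDual_eq [FiniteDimensional L V] (H : HermitianForm σ V) (φ : Module.Dual L V) :
    ∃ w, H.toDual w = φ := by
  let W : Submodule L (Module.Dual L V) :=
    { carrier := Set.range H.toDual
      add_mem' := by
        rintro _ _ ⟨a, rfl⟩ ⟨b, rfl⟩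
        exact ⟨a + b, LinearMap.ext fun v => H.add_right v a b⟩
      zero_mem' := ⟨0, LinearMap.ext fun v => by simpa [toDual] using H.smul_right 0 v 0⟩
      smul_mem' := by
        rintro c _ ⟨a, rfl⟩
        refine ⟨σ.symm c • a, LinearMap.ext fun v => ?_⟩
        simpa [toDual] using H.smul_right (σ.symm c) v a }
  have hW : W.dualCoannihilator = ⊥ := by
    rw [eq_bot_iff]
    intro v hv
    rw [Submodule.mem_dualCoannihilator] at hv
    exact H.nondegenerate v fun w => hv _ ⟨w, rfl⟩
  have hT : W = ⊤ := by
    rw [← Subspace.dualCoannihilator_dualAnnihilator_eq (W := W), hW]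
    simp
  have : φ ∈ W := hT ▸ Submodule.mem_top
  exact this

/-- The value at `w` of the `H`-adjoint of `f`. -/
def adjointApply [FiniteDimensional L V] (H : HermitianForm σ V) (f : Module.End L V) (w : V) : V :=
  (H.exists_toDual_eq (H.toDual w ∘ₗ f)).choose

theorem form_adjointApply [FiniteDimensional L V] (H : HermitianForm σ V) (f : Module.End L V)
    (v w : V) : H.form v (H.adjointApply f w) = H.form (f v) w :=
  LinearMap.congr_fun (H.exists_toDual_eq (H.toDual w ∘ₗ f)).choose_spec v

/-- The adjoint involution `ι_H` of `End_L(V)`, see `form_adjoint`. -/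
def adjoint [FiniteDimensional L V] [Module K V] [IsScalarTower K L V] (H : HermitianForm σ V) :
    Module.End L V →ₗ[K] Module.End L V where
  toFun f :=
    { toFun := H.adjointApply f
      map_add' := fun w w' => H.ext_right fun v => by
        simp only [form_adjointApply, add_right]
      map_smul' := fun a w => H.ext_right fun v => by
        simp only [form_adjointApply, smul_right, RingHom.id_apply] }
  map_add' f g := LinearMap.ext fun w => H.ext_right fun v => by
    simp [form_adjointApply, add_right, add_left]
  map_smul' c f := LinearMap.ext fun w => H.ext_right fun v => by
    have h1 : ∀ x : V, c • x = algebraMap K L c • x := fun x => (algebraMap_smul L c x).symm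
    change H.form v (H.adjointApply (c • f) w) = H.form v (c • H.adjointApply f w)
    rw [form_adjointApply, LinearMap.smul_apply, h1, h1, smul_left, smul_right, AlgEquiv.commutes,
      form_adjointApply]

theorem form_adjoint [FiniteDimensional L V] [Module K V] [IsScalarTower K L V]
    (H : HermitianForm σ V) (f : Module.End L V) (v w : V) :
    H.form (f v) w = H.form v (H.adjoint f w) :=
  (H.form_adjointApply f v w).symm

/-- The discriminant of `H` is the class `x` of `Kˣ / N_{L/K}(Lˣ)`: for every basis `b` of `V`, the
signed determinant `(-1)^(n choose 2) det (H(bᵢ, bⱼ))` lies in `Kˣ` and represents `x`. -/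
def HasDisc (H : HermitianForm σ V) (x : Kˣ ⧸ normSubgroup K L) : Prop :=
  ∀ b : Module.Basis (Fin (Module.finrank L V)) L V, ∃ d : Kˣ,
    algebraMap K L (d : K) = (-1) ^ (Module.finrank L V).choose 2 *
      (Matrix.of fun i j => H.form (b i) (b j)).det ∧
    (QuotientGroup.mk d : Kˣ ⧸ normSubgroup K L) = x

end HermitianForm

/-! ### Characters -/

/-- `χ` is the character of an irreducible complex representation of `G`. -/
def IsIrreducibleCharacter {G : Type u} [Group G] (χ : G → ℂ) : Prop :=
  ∃ (n : ℕ) (ρ : Representation ℂ G (Fin n → ℂ)), ρ.IsIrreducible ∧ ρ.character = χ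

/-- A representation affording `χ` has a non-degenerate invariant quadratic form (given by its
symmetric bilinear form). -/
def AffordsQuadraticForm {G : Type u} [Group G] (χ : G → ℂ) : Prop :=
  ∃ (n : ℕ) (ρ : Representation ℂ G (Fin n → ℂ)), ρ.character = χ ∧
    ∃ B : LinearMap.BilinForm ℂ (Fin n → ℂ), B.IsSymm ∧ B.Nondegenerate ∧
      ∀ g v w, B (ρ g v) (ρ g w) = B v w

/-- A representation affording `χ` has a non-degenerate invariant symplectic form. -/
def AffordsSymplecticForm {G : Type u} [Group G] (χ : G → ℂ) : Prop :=
  ∃ (n : ℕ) (ρ : Representation ℂ G (Fin n → ℂ)), ρ.character = χ ∧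
    ∃ B : LinearMap.BilinForm ℂ (Fin n → ℂ), B.IsAlt ∧ B.Nondegenerate ∧
      ∀ g v w, B (ρ g v) (ρ g w) = B v w

/-- The Frobenius-Schur indicator of the (irreducible) character `χ` is `+`. -/
def IndicatorPlus {G : Type u} [Group G] (χ : G → ℂ) : Prop :=
  (∀ g, conj (χ g) = χ g) ∧ AffordsQuadraticForm χ

/-- The Frobenius-Schur indicator of the (irreducible) character `χ` is `-`. -/
def IndicatorMinus {G : Type u} [Group G] (χ : G → ℂ) : Prop :=
  (∀ g, conj (χ g) = χ g) ∧ AffordsSymplecticForm χ ∧ ¬ AffordsQuadraticForm χ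

/-- The Frobenius-Schur indicator of the (irreducible) character `χ` is `o`. -/
def IndicatorO {G : Type u} [Group G] (χ : G → ℂ) : Prop :=
  ¬ IndicatorPlus χ ∧ ¬ IndicatorMinus χ

/-- The character induced along an injective homomorphism `i : G → G'` of finite groups. -/
def inducedCharacter {G : Type u} [Group G] {G' : Type v} [Group G'] (i : G →* G') (χ : G → ℂ) :
    G' → ℂ := fun h =>
  open Classical in
  (Nat.card G : ℂ)⁻¹ * ∑ᶠ t : G', ∑ᶠ g : G, if t⁻¹ * h * t = i g then χ g else 0

/-- The semidirect product `G : ⟨α⟩`. -/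
abbrev AutExtension {G : Type u} [Group G] (α : MulAut G) : Type u :=
  G ⋊[(Subgroup.zpowers α).subtype] (Subgroup.zpowers α)

/-- The character of `G : ⟨α⟩` induced from the character `χ` of `G`. -/
def extensionCharacter {G : Type u} [Group G] (α : MulAut G) (χ : G → ℂ) : AutExtension α → ℂ :=
  inducedCharacter (SemidirectProduct.inl : G →* AutExtension α) χ

/-- The character field `ℚ(χ)`, as a subfield of `ℂ`. -/
def charSubfield {G : Type u} (χ : G → ℂ) : IntermediateField ℚ ℂ :=
  IntermediateField.adjoin ℚ (Set.range χ)

/-- The real subfield `F⁺ = F ∩ ℝ` of a subfield `F` of `ℂ`. -/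
def realSubfield (F : IntermediateField ℚ ℂ) : IntermediateField ℚ F where
  carrier := {x | conj (x : ℂ) = x}
  mul_mem' := by
    intro a b ha hb
    simp only [Set.mem_ofPred_eq] at *
    push_cast
    rw [map_mul, ha, hb]
  add_mem' := by
    intro a b ha hb
    simp only [Set.mem_ofPred_eq] at *
    push_cast
    rw [map_add, ha, hb]
  algebraMap_mem' := by
    intro q
    simp
  inv_mem' := by
    intro a ha
    simp only [Set.mem_ofPred_eq] at *
    push_cast
    rw [map_inv₀, ha]

/-- The character field `L = ℚ(χ)`. (A separate type, in order to keep instance search short.) -/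
def CharField {G : Type u} (χ : G → ℂ) : Type := charSubfield χ

/-- The real subfield `K = L⁺` of the character field `L = ℚ(χ)`. -/
def RealCharField {G : Type u} (χ : G → ℂ) : Type := realSubfield (charSubfield χ)

instance {G : Type u} (χ : G → ℂ) : Field (CharField χ) :=
  inferInstanceAs (Field (charSubfield χ))

instance {G : Type u} (χ : G → ℂ) : Field (RealCharField χ) :=
  inferInstanceAs (Field (realSubfield (charSubfield χ)))

instance {G : Type u} (χ : G → ℂ) : CharZero (RealCharField χ) :=
  inferInstanceAs (CharZero (realSubfield (charSubfield χ)))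

instance {G : Type u} (χ : G → ℂ) : Algebra (RealCharField χ) (CharField χ) :=
  inferInstanceAs (Algebra (realSubfield (charSubfield χ)) (charSubfield χ))

/-- The inclusion `ℚ(χ) ⊆ ℂ`. -/
instance {G : Type u} (χ : G → ℂ) : Algebra (CharField χ) ℂ :=
  inferInstanceAs (Algebra (charSubfield χ) ℂ)

/-- The inclusion `ℚ(χ)⁺ ⊆ ℂ`. -/
instance {G : Type u} (χ : G → ℂ) : Algebra (RealCharField χ) ℂ :=
  ((algebraMap (CharField χ) ℂ).comp (algebraMap (RealCharField χ) (CharField χ))).toAlgebra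

theorem conj_mem_charSubfield {G : Type u} [Group G] {χ : G → ℂ} {α : MulAut G}
    (h : ∀ g, χ (α g) = conj (χ g)) {x : ℂ} (hx : x ∈ charSubfield χ) :
    conj x ∈ charSubfield χ := by
  let c : ℂ →ₐ[ℚ] ℂ := (Complex.conjAe : ℂ →ₐ[ℝ] ℂ).restrictScalars ℚ
  have hle : charSubfield χ ≤ (charSubfield χ).comap c := by
    unfold charSubfield
    rw [IntermediateField.adjoin_le_iff]
    rintro _ ⟨g, rfl⟩
    change conj (χ g) ∈ IntermediateField.adjoin ℚ (Set.range χ)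
    rw [← h g]
    exact IntermediateField.subset_adjoin ℚ _ ⟨α g, rfl⟩
  exact hle hx

/-- Complex conjugation as an automorphism of `ℚ(χ)` over `ℚ(χ)⁺`, for a character `χ` whose complex
conjugate is `χ ∘ α`. -/
def charFieldConj {G : Type u} [Group G] {χ : G → ℂ} {α : MulAut G}
    (h : ∀ g, χ (α g) = conj (χ g)) : CharField χ ≃ₐ[RealCharField χ] CharField χ :=
  show charSubfield χ ≃ₐ[realSubfield (charSubfield χ)] charSubfield χ from
  { toFun := fun x => ⟨conj (x : ℂ), conj_mem_charSubfield h x.2⟩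
    invFun := fun x => ⟨conj (x : ℂ), conj_mem_charSubfield h x.2⟩
    left_inv := fun x => Subtype.ext (by simp)
    right_inv := fun x => Subtype.ext (by simp)
    map_mul' := fun x y => Subtype.ext (by simp)
    map_add' := fun x y => Subtype.ext (by simp)
    commutes' := fun x => Subtype.ext x.2 }

theorem algebraMap_charFieldConj {G : Type u} [Group G] {χ : G → ℂ} {α : MulAut G}
    (h : ∀ g, χ (α g) = conj (χ g)) (x : CharField χ) :
    algebraMap (CharField χ) ℂ (charFieldConj h x) = conj (algebraMap (CharField χ) ℂ x) := rfl

/-! ### The fixed algebra -/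

/-- The `α`-fixed algebra `⟨ρ(g) + ρ(α(g)) | g ∈ G⟩_K` of a representation `ρ : G → GL_L(V)`: the
`K`-linear span of these endomorphisms, which is a `K`-subalgebra of `End_L(V)` as `α² = 1`. -/
def fixedAlgebra (K : Type u) [Field K] [CharZero K] {L : Type v} [Field L] [Algebra K L]
    {V : Type w} [AddCommGroup V] [Module L V] [Module K V] [IsScalarTower K L V]
    {G : Type*} [Group G] (ρ : Representation L G V) (α : MulAut G) (hα : α ^ 2 = 1) :
    Subalgebra K (Module.End L V) :=
  (Submodule.span K (Set.range fun g : G => ρ g + ρ (α g))).toSubalgebra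
    (by
      have h1 : (1 : Module.End L V) = (2 : K)⁻¹ • (ρ 1 + ρ (α 1)) := by
        rw [map_one α, map_one ρ, ← two_smul K, smul_smul, inv_mul_cancel₀ two_ne_zero, one_smul]
      rw [h1]
      exact Submodule.smul_mem _ _ (Submodule.subset_span ⟨1, rfl⟩))
    (by
      have hαα : ∀ g, α (α g) = g := fun g => by
        have := DFunLike.congr_fun hα g
        simpa [pow_two] using this
      intro x y hx hy
      induction hx using Submodule.span_induction with
      | mem x hx =>
        obtain ⟨g, rfl⟩ := hx
        induction hy using Submodule.span_induction with
        | mem y hy =>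
          obtain ⟨k, rfl⟩ := hy
          have : (ρ g + ρ (α g)) * (ρ k + ρ (α k)) =
              (ρ (g * k) + ρ (α (g * k))) + (ρ (g * α k) + ρ (α (g * α k))) := by
            simp only [map_mul, hαα, add_mul, mul_add]
            abel
          change (ρ g + ρ (α g)) * (ρ k + ρ (α k)) ∈ _
          rw [this]
          exact Submodule.add_mem _ (Submodule.subset_span ⟨_, rfl⟩)
            (Submodule.subset_span ⟨_, rfl⟩)
        | zero => simp
        | add a b _ _ ha hb => rw [mul_add]; exact Submodule.add_mem _ ha hb
        | smul c a _ ha => rw [mul_smul_comm]; exact Submodule.smul_mem _ _ ha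
      | zero => simp
      | add a b _ _ ha hb => rw [add_mul]; exact Submodule.add_mem _ ha hb
      | smul c a _ ha => rw [smul_mul_assoc]; exact Submodule.smul_mem _ _ ha)

/-- The algebra `End_{K G}(W)` of endomorphisms of a representation over `K`. -/
def endomorphismAlgebra (K : Type u) [Field K] {W : Type w} [AddCommGroup W] [Module K W]
    {G : Type*} [Group G] (τ : Representation K G W) : Subalgebra K (Module.End K W) :=
  Subalgebra.centralizer K (Set.range τ)

end

/-! One scalar `c ∈ Kˣ` governs everything. Let `σ` be complex conjugation on `L`; it is nontrivial,
since otherwise `H` would be symmetric bilinear and `χ` would have indicator `+`. Let `R` be the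
matrix form of `ρ` in a basis. As `χ ∘ α` is the conjugate of `χ`, some invertible `P` satisfies `P
σ(R g) = R(α g) P`, and Schur's lemma gives `P σ(P) = c` (`exists_isTwist`). Thus `S : v ↦ P σ(v)`
is semilinear with `S² = c`.

Conjugation by `S` is a semilinear involution of `M_n(L)` exchanging `R g` and `R(α g)`. Since
`R(G)` spans `M_n(L)` already over `K` (`span_range_eq_top_of_conj`), `A` is its fixed algebra
`twistedForm σ P`. Galois descent makes `A` central simple and split by `L`. Twists of equal size
and equal square are equivalent (`exists_intertwiner`, a form of Hilbert 90), so `[A]` depends only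
on `c`: comparison with a twist of size two gives `[A] = [(L, c)_K]`, and comparison of `P ⊗ P` with
the scalar matrix `c` splits `A ⊗ A`. By Skolem–Noether, `c` is unique up to norms
(`exists_norm_of_equiv`). On the other side, `V ⊕ V` over `K`, with `G` acting by `ρ ⊕ ρ ∘ α` and
`α` by the swap, affords `2X`; its endomorphisms are generated by `L` and `(x, y) ↦ (S y, S x)`,
which again gives `(L, c)_K`. Hence `disc_L([𝒬]) = cN`.

Part (b) holds because the adjoint of `ρ(g)` is `ρ(g⁻¹)`.

For the discriminants let `h` be the Gram matrix of `H` and `M = h σ(P)`. This is the matrix of an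
invariant pairing of `ρ` and `ρ ∘ α`, unique up to scalars, so `Mᵀ = ±M`, and the sign is the
indicator of `X`. The key identity is `σ(P)ᵀ σ(M) σ(P) = c Mᵀ` (`IsTwist.transpose_mul_mul`). If `M`
is alternating, taking Pfaffians gives `(-1)^m det h = c^m` up to norms. If `M` is symmetric, `ι_H`
restricts to `A` as the adjoint involution of `M`, hence is orthogonal; for an invertible skew `a ∈
A` the matrix `M a` is alternating, and its Pfaffian gives `det h = c^m det a` up to norms, where
`det a` is the reduced norm of `a`. -/

noncomputable section

universe u v w

/-! ### The Pfaffian -/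

section Pfaffian

variable {ι F : Type*} [Fintype ι] [DecidableEq ι] [CommRing F]

/-- The unnormalised Pfaffian `∑ π, sgn π ∏ i, N (π (0, i)) (π (1, i))`. -/
def pfaffianSum (N : Matrix (Bool × ι) (Bool × ι) F) : F :=
  ∑ π : Equiv.Perm (Bool × ι), (Equiv.Perm.sign π : ℤ) * ∏ i, N (π (false, i)) (π (true, i))

theorem pfaffianSum_smul (κ : F) (N : Matrix (Bool × ι) (Bool × ι) F) :
    pfaffianSum (κ • N) = κ ^ Fintype.card ι * pfaffianSum N := by
  simp only [pfaffianSum, Matrix.smul_apply, smul_eq_mul, Finset.prod_mul_distrib,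
    Finset.prod_const, Finset.card_univ, Finset.mul_sum]
  exact Finset.sum_congr rfl fun _ _ => by ring

theorem pfaffianSum_map {F' : Type*} [CommRing F'] (f : F →+* F')
    (N : Matrix (Bool × ι) (Bool × ι) F) : pfaffianSum (N.map f) = f (pfaffianSum N) := by
  simp [pfaffianSum]

theorem prod_bool_prod {M : Type*} [CommMonoid M] (f : Bool × ι → M) :
    ∏ k, f k = ∏ i, (f (false, i) * f (true, i)) := by
  rw [Fintype.prod_prod_type_right]
  simp [mul_comm]

/-- A Cauchy–Binet argument: expanding the entries of `Xᵀ N X` gives a sum over self-maps `f` of the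
index set. For fixed `f` the signed sum over `π` is the determinant of the rows of `X` selected by
`f`, which vanishes unless `f` is a permutation and is then `± det X`. -/
theorem pfaffianSum_congr (X N : Matrix (Bool × ι) (Bool × ι) F) :
    pfaffianSum (X.transpose * N * X) = X.det * pfaffianSum N := by
  have h1 : ∀ π : Equiv.Perm (Bool × ι),
      ∏ i, (X.transpose * N * X) (π (false, i)) (π (true, i)) =
        ∑ f : Bool × ι → Bool × ι, (∏ i, N (f (false, i)) (f (true, i))) *
          ∏ k, X (f k) (π k) := by
    intro π
    have h2 : ∀ a b, (X.transpose * N * X) a b =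
        ∑ p : (Bool × ι) × (Bool × ι), X p.1 a * N p.1 p.2 * X p.2 b := by
      intro a b
      rw [Fintype.sum_prod_type, Finset.sum_comm]
      simp only [Matrix.mul_apply, Matrix.transpose_apply, Finset.sum_mul]
    simp only [h2]
    rw [Finset.prod_univ_sum, Fintype.piFinset_univ]
    let e : (Bool × ι → Bool × ι) ≃ (ι → (Bool × ι) × (Bool × ι)) :=
      { toFun := fun f i => (f (false, i), f (true, i))
        invFun := fun g k => if k.1 then (g k.2).2 else (g k.2).1
        left_inv := fun f => by ext1 ⟨b, i⟩; cases b <;> rfl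
        right_inv := fun g => rfl }
    rw [← Fintype.sum_equiv e _ _ fun f => rfl]
    refine Finset.sum_congr rfl fun f _ => ?_
    rw [prod_bool_prod, ← Finset.prod_mul_distrib]
    exact Finset.prod_congr rfl fun i _ => by simp only [e, Equiv.coe_fn_mk]; ring
  have h3 : ∀ f : Bool × ι → Bool × ι, ∑ π : Equiv.Perm (Bool × ι),
      ((Equiv.Perm.sign π : ℤ) : F) * ∏ k, X (f k) (π k) = (X.submatrix f id).det := by
    intro f
    rw [← Matrix.det_transpose, Matrix.det_apply']
    rfl
  calc pfaffianSum (X.transpose * N * X)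
      = ∑ f : Bool × ι → Bool × ι, (∏ i, N (f (false, i)) (f (true, i))) *
          (X.submatrix f id).det := by
        simp only [pfaffianSum, h1, Finset.mul_sum, ← h3]
        rw [Finset.sum_comm]
        exact Finset.sum_congr rfl fun _ _ => Finset.sum_congr rfl fun _ _ => by ring
    _ = _ := by
        rw [pfaffianSum, Finset.mul_sum]
        symm
        refine Finset.sum_of_injOn (fun π : Equiv.Perm (Bool × ι) => (π : Bool × ι → Bool × ι))
          (fun π _ π' _ h => DFunLike.coe_injective h) (fun _ _ => by simp) ?_ ?_
        · intro f _ hf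
          have : ¬ Function.Injective f := fun h => hf
            ⟨Equiv.ofBijective f (Finite.injective_iff_bijective.1 h), by simp, rfl⟩
          simp only [Function.Injective, not_forall] at this
          obtain ⟨i, j, hij, hne⟩ := this
          rw [Matrix.det_zero_of_row_eq hne, mul_zero]
          ext k
          simp [hij]
        · intro π _
          rw [Matrix.det_permute]
          ring

/-- The standard alternating matrix. -/
def symplecticJ (ι F : Type*) [DecidableEq ι] [CommRing F] : Matrix (Bool × ι) (Bool × ι) F :=
  Matrix.blockDiagonal fun _ : ι => Matrix.of fun a b : Bool => if a = b then 0 else if a then -1 else 1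

theorem symplecticJ_apply (a b : Bool) (i j : ι) : symplecticJ ι F (a, i) (b, j) =
    if i = j then (if a = b then 0 else if a then -1 else 1) else 0 := by
  simp [symplecticJ, Matrix.blockDiagonal_apply]

theorem det_symplecticJ : (symplecticJ ι F).det = 1 := by
  rw [symplecticJ, Matrix.det_blockDiagonal]
  refine Finset.prod_eq_one fun _ _ => ?_
  rw [← Matrix.det_reindex_self finTwoEquiv.symm, Matrix.det_fin_two]
  simp [finTwoEquiv]

theorem transpose_symplecticJ : (symplecticJ ι F).transpose = -symplecticJ ι F := by
  ext ⟨a, i⟩ ⟨b, j⟩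
  rw [Matrix.transpose_apply, Matrix.neg_apply, symplecticJ_apply, symplecticJ_apply]
  cases a <;> cases b <;> by_cases h : i = j <;> simp [h, eq_comm (a := j)]

/-- Write `J = E - Eᵀ` with `E` supported on the entries from `(false, i)` to `(true, i)`. Each
factor offers two choices; choosing `-Eᵀ` amounts to exchanging `(false, i)` and `(true, i)` in `π`,
whose sign absorbs the minus. So every choice contributes `pfaffianSum E`, and there only the
permutations induced from `ι` survive, each with sign one. -/
theorem pfaffianSum_symplecticJ :
    pfaffianSum (symplecticJ ι F) = 2 ^ Fintype.card ι * (Fintype.card ι).factorial := by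
  let E : Matrix (Bool × ι) (Bool × ι) F :=
    fun x y => if x.1 = false ∧ y = (true, x.2) then 1 else 0
  have hE : pfaffianSum E = (Fintype.card ι).factorial := by
    have h1 : ∑ τ : Equiv.Perm ι, (1 : F) = (Fintype.card ι).factorial := by
      simp [Fintype.card_perm]
    rw [← h1, pfaffianSum]
    symm
    refine Finset.sum_of_injOn (fun τ : Equiv.Perm ι => Equiv.prodCongrRight fun _ : Bool => τ)
      ?_ (fun _ _ => by simp) ?_ ?_
    · intro τ _ τ' _ h
      ext i
      have := DFunLike.congr_fun h (true, i)
      simpa using this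
    · intro π _ hπ
      refine mul_eq_zero_of_right _ ?_
      by_contra hne
      have h2 : ∀ i, (π (false, i)).1 = false ∧ π (true, i) = (true, (π (false, i)).2) := by
        intro i
        by_contra hi
        exact hne (Finset.prod_eq_zero (Finset.mem_univ i) (if_neg hi))
      have h3 : ∀ i, π (false, i) = (false, (π (false, i)).2) := fun i =>
        Prod.ext (h2 i).1 rfl
      have h4 : Function.Injective fun i => (π (false, i)).2 := by
        intro i j hij
        have : π (false, i) = π (false, j) := by rw [h3 i, h3 j]; exact congrArg _ hij
        simpa using π.injective this
      refine hπ ⟨Equiv.ofBijective _ (Finite.injective_iff_bijective.1 h4), by simp, ?_⟩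
      ext1 ⟨b, i⟩
      cases b
      · exact (h3 i).symm
      · exact (h2 i).2.symm
    · intro τ _
      rw [Equiv.Perm.sign_prodCongrRight]
      simp [E]
  let fl : (ι → Bool) → Equiv.Perm (Bool × ι) := fun s =>
    Equiv.prodCongrLeft fun i => if s i then Equiv.swap true false else 1
  have hfl : ∀ s, ((Equiv.Perm.sign (fl s) : ℤ) : F) = ∏ i, if s i then -1 else 1 := by
    intro s
    rw [Equiv.Perm.sign_prodCongrLeft]
    simp only [Units.coe_prod, Int.cast_prod]
    refine Finset.prod_congr rfl fun i _ => ?_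
    by_cases h : s i <;> simp [h]
  have hJ : ∀ x y, symplecticJ ι F x y = E x y - E y x := by
    rintro ⟨a, i⟩ ⟨b, j⟩
    rw [symplecticJ_apply]
    cases a <;> cases b <;> by_cases h : i = j <;> simp [E, h, eq_comm (a := j)]
  have hexp : ∀ π : Equiv.Perm (Bool × ι), ∏ i, symplecticJ ι F (π (false, i)) (π (true, i)) =
      ∑ s : ι → Bool, ((Equiv.Perm.sign (fl s) : ℤ) : F) *
        ∏ i, E ((π * fl s) (false, i)) ((π * fl s) (true, i)) := by
    intro π
    have : ∀ i, symplecticJ ι F (π (false, i)) (π (true, i)) =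
        ∑ b : Bool, (if b then -1 else 1) *
          E (π ((if b then Equiv.swap true false else 1 : Equiv.Perm Bool) false, i))
            (π ((if b then Equiv.swap true false else 1 : Equiv.Perm Bool) true, i)) := by
      intro i
      rw [hJ]
      simp
      ring
    simp only [this]
    rw [Finset.prod_univ_sum, Fintype.piFinset_univ]
    refine Finset.sum_congr rfl fun s _ => ?_
    rw [hfl, ← Finset.prod_mul_distrib]
    rfl
  calc pfaffianSum (symplecticJ ι F)
      = ∑ s : ι → Bool, ∑ π : Equiv.Perm (Bool × ι), ((Equiv.Perm.sign (π * fl s) : ℤ) : F) *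
          ∏ i, E ((π * fl s) (false, i)) ((π * fl s) (true, i)) := by
        simp only [pfaffianSum, hexp, Finset.mul_sum]
        rw [Finset.sum_comm]
        refine Finset.sum_congr rfl fun s _ => Finset.sum_congr rfl fun π _ => ?_
        rw [Equiv.Perm.sign_mul]
        push_cast
        ring
    _ = ∑ s : ι → Bool, pfaffianSum E := by
        refine Finset.sum_congr rfl fun s _ => ?_
        exact Fintype.sum_equiv (Equiv.mulRight (fl s)) _ _ fun π => rfl
    _ = _ := by
        rw [hE]
        simp

end Pfaffian

/-! ### Hyperbolic pairs and the normalised Pfaffian -/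

section SymplecticBasis

open scoped Matrix

variable {F : Type*} [Field F] {n : Type*} [Fintype n] [DecidableEq n]

/-- An alternating nondegenerate form has orthogonal hyperbolic pairs. -/
theorem exists_hyperbolic_family [CharZero F] (N : Matrix n n F) (hN : N.transpose = -N)
    (hdet : N.det ≠ 0) {m : ℕ} (hn : Fintype.card n = 2 * m) (k : ℕ) (hk : k ≤ m) :
    ∃ e : Bool × Fin k → n → F, ∀ x y, e x ⬝ᵥ N.mulVec (e y) = symplecticJ (Fin k) F x y := by
  have hskew : ∀ x y, x ⬝ᵥ N.mulVec y = -(y ⬝ᵥ N.mulVec x) := by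
    intro x y
    rw [Matrix.dotProduct_mulVec, ← Matrix.mulVec_transpose, hN, dotProduct_comm,
      Matrix.neg_mulVec, dotProduct_neg]
  have halt : ∀ x, x ⬝ᵥ N.mulVec x = 0 := fun x => self_eq_neg.1 (hskew x x)
  induction k with
  | zero => exact ⟨fun x => x.2.elim0, fun x => x.2.elim0⟩
  | succ k ih =>
    obtain ⟨e, he⟩ := ih (by omega)
    let T := Matrix.mulVecLin (Matrix.of fun x => e x ᵥ* N)
    have hT : ∀ x z, T z x = e x ⬝ᵥ N *ᵥ z := fun x z =>
      (Matrix.dotProduct_mulVec (e x) N z).symm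
    -- Orthogonality to the `2k` vectors found so far has a nonzero solution because `2k < 2m`.
    obtain ⟨x, hx, hx0⟩ := (LinearMap.ker T).ne_bot_iff.1
      (LinearMap.ker_ne_bot_of_finrank_lt (by simp [hn]; omega))
    have hex : ∀ z, e z ⬝ᵥ N *ᵥ x = 0 := fun z => by
      rw [← hT]; exact congrFun hx z
    obtain ⟨y, hy⟩ : ∃ y, x ⬝ᵥ N *ᵥ y = 1 := by
      have h1 : x ᵥ* N ≠ 0 := fun h => hx0 <| by
        by_contra hne
        exact hdet (Matrix.exists_vecMul_eq_zero_iff.1 ⟨x, hne, h⟩)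
      obtain ⟨j, hj⟩ := Function.ne_iff.1 h1
      refine ⟨((x ᵥ* N) j)⁻¹ • Pi.single j 1, ?_⟩
      rw [Matrix.dotProduct_mulVec, dotProduct_smul, dotProduct_single_one, smul_eq_mul]
      exact inv_mul_cancel₀ hj
    -- Removing the components of `y` along the hyperbolic pairs makes it orthogonal to them; its
    -- product with `x` is unchanged because `x` is orthogonal to them as well.
    let y' : n → F := y - ∑ i, ((e (false, i) ⬝ᵥ N *ᵥ y) • e (true, i) -
      (e (true, i) ⬝ᵥ N *ᵥ y) • e (false, i))
    have hB : ∀ z, z ⬝ᵥ N *ᵥ y' = z ⬝ᵥ N *ᵥ y -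
        ∑ i, ((e (false, i) ⬝ᵥ N *ᵥ y) * (z ⬝ᵥ N *ᵥ e (true, i)) -
          (e (true, i) ⬝ᵥ N *ᵥ y) * (z ⬝ᵥ N *ᵥ e (false, i))) := by
      intro z
      simp only [y', Matrix.dotProduct_mulVec, dotProduct_sub, dotProduct_sum, dotProduct_smul,
        smul_eq_mul]
    have hxe : ∀ z, x ⬝ᵥ N *ᵥ e z = 0 := fun z => by rw [hskew, hex, neg_zero]
    have hxy : x ⬝ᵥ N *ᵥ y' = 1 := by
      rw [hB, hy]
      simp [hxe]
    have hey : ∀ z, e z ⬝ᵥ N *ᵥ y' = 0 := by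
      rintro ⟨b, j⟩
      rw [hB]
      simp only [he, symplecticJ_apply]
      cases b <;> simp
    refine ⟨fun z => Fin.lastCases (if z.1 then y' else x) (fun i => e (z.1, i)) z.2, ?_⟩
    rintro ⟨a, i⟩ ⟨b, j⟩
    rw [symplecticJ_apply]
    induction i using Fin.lastCases with
    | last =>
      induction j using Fin.lastCases with
      | last =>
        cases a <;> cases b <;> simp [halt, hxy, hskew y' x]
      | cast j =>
        cases a <;> simp [hxe, hskew y', hey, (Fin.castSucc_ne_last _).symm]
    | cast i =>
      induction j using Fin.lastCases with
      | last => cases b <;> simp [hex, hey, Fin.castSucc_ne_last]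
      | cast j => simp [he, symplecticJ_apply]

/-- These formal properties are all that is used of the Pfaffian; compatibility with field
endomorphisms will be applied to `σ`. The normalising constant is the value at the standard
alternating matrix, a nonzero integer and so fixed by every endomorphism. A symplectic basis reduces
`det N = pf N ^ 2` to that matrix. -/
theorem exists_pfaffian {F : Type*} [Field F] [CharZero F] {n : Type*} [Fintype n]
    [DecidableEq n] {m : ℕ} (hn : Fintype.card n = 2 * m) :
    ∃ pf : Matrix n n F → F, (∀ X N, pf (X.transpose * N * X) = X.det * pf N) ∧
      (∀ κ N, pf (κ • N) = κ ^ m * pf N) ∧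
      (∀ (f : F →+* F) N, pf (N.map f) = f (pf N)) ∧
      ∀ N : Matrix n n F, N.transpose = -N → N.det ≠ 0 → N.det = pf N ^ 2 := by
  have e : n ≃ Bool × Fin m := Fintype.equivOfCardEq (by simp [hn])
  have hr : ∀ A B : Matrix n n F, Matrix.reindex e e (A * B) =
      Matrix.reindex e e A * Matrix.reindex e e B := fun A B =>
    map_mul (Matrix.reindexAlgEquiv F F e) A B
  let k : F := pfaffianSum (symplecticJ (Fin m) F)
  have hk : k ≠ 0 := by
    simp only [k, pfaffianSum_symplecticJ]
    exact mul_ne_zero (pow_ne_zero _ two_ne_zero) (by exact_mod_cast Nat.factorial_ne_zero _)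
  have hkf : ∀ f : F →+* F, f k = k := fun f => by
    simp [k, pfaffianSum_symplecticJ, map_ofNat f 2]
  refine ⟨fun N => k⁻¹ * pfaffianSum (Matrix.reindex e e N), fun X N => ?_, fun κ N => ?_,
    fun f N => ?_, fun N hN hdet => ?_⟩
  · beta_reduce
    rw [hr, hr, ← Matrix.transpose_reindex, pfaffianSum_congr, Matrix.det_reindex_self]
    ring
  · have : Matrix.reindex e e (κ • N) = κ • Matrix.reindex e e N := rfl
    beta_reduce
    rw [this, pfaffianSum_smul, Fintype.card_fin]
    ring
  · have : Matrix.reindex e e (N.map f) = (Matrix.reindex e e N).map f := rfl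
    beta_reduce
    rw [this, pfaffianSum_map, map_mul, map_inv₀, hkf]
  · obtain ⟨v, hv⟩ := exists_hyperbolic_family N hN hdet hn m le_rfl
    let T : Matrix n n F := Matrix.of fun i j => v (e j) i
    have hT : Matrix.reindex e e (T.transpose * N * T) = symplecticJ (Fin m) F := by
      ext x y
      rw [← hv, Matrix.mul_assoc]
      simp [T, Matrix.mul_apply, dotProduct, Matrix.mulVec]
    have h1 := congrArg Matrix.det hT
    have h2 := congrArg pfaffianSum hT
    rw [Matrix.det_reindex_self, Matrix.det_mul, Matrix.det_mul, Matrix.det_transpose,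
      det_symplecticJ] at h1
    rw [hr, hr, ← Matrix.transpose_reindex, pfaffianSum_congr, Matrix.det_reindex_self] at h2
    have hT0 : T.det ≠ 0 := fun h => by simp [h] at h1
    change _ = (k⁻¹ * _) ^ 2
    have h3 : k = T.det * pfaffianSum (Matrix.reindex e e N) := h2.symm
    have h4 : pfaffianSum (Matrix.reindex e e N) = k * T.det⁻¹ := by
      rw [h3]; field_simp
    rw [h4]
    field_simp
    linear_combination h1

theorem exists_alternating_invertible (F : Type*) [Field F] {n : Type*} [Fintype n]
    [DecidableEq n] {m : ℕ} (hn : Fintype.card n = 2 * m) :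
    ∃ J : Matrix n n F, J.transpose = -J ∧ J.det ≠ 0 := by
  have e : n ≃ Bool × Fin m := Fintype.equivOfCardEq (by simp [hn])
  refine ⟨Matrix.reindex e.symm e.symm (symplecticJ (Fin m) F), ?_, ?_⟩
  · rw [Matrix.transpose_reindex, transpose_symplecticJ]
    rfl
  · rw [Matrix.det_reindex_self, det_symplecticJ]
    exact one_ne_zero

end SymplecticBasis

/-! ### Quadratic extensions and Galois descent -/

/-- `σ` generates the Galois group of the quadratic extension `L / K`. -/
structure IsConjugation {K L : Type*} [Field K] [Field L] [Algebra K L] (σ : L ≃ₐ[K] L) :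
    Prop where
  involutive : ∀ x, σ (σ x) = x
  fixed : ∀ x, σ x = x → ∃ k, algebraMap K L k = x
  nontrivial : ∃ x, σ x ≠ x

namespace IsConjugation

variable {K L : Type*} [Field K] [Field L] [Algebra K L] {σ : L ≃ₐ[K] L}

theorem exists_skew (hσ : IsConjugation σ) : ∃ s : L, s ≠ 0 ∧ σ s = -s := by
  obtain ⟨x, hx⟩ := hσ.nontrivial
  exact ⟨x - σ x, sub_ne_zero.2 (Ne.symm hx), by simp [hσ.involutive]⟩

variable [CharZero K]

theorem charZero (K L : Type*) [Field K] [Field L] [Algebra K L] [CharZero K] : CharZero L :=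
  charZero_of_injective_algebraMap (algebraMap K L).injective

theorem two_ne_zero' (K : Type*) {L : Type*} [Field K] [Field L] [Algebra K L] [CharZero K] :
    (2 : L) ≠ 0 := by
  have := charZero K L
  exact two_ne_zero

theorem exists_eq_add (hσ : IsConjugation σ) {s : L} (hs0 : s ≠ 0) (hs : σ s = -s) (x : L) :
    ∃ a b : K, x = algebraMap K L a + algebraMap K L b * s := by
  have h2 := two_ne_zero' K (L := L)
  obtain ⟨a, ha⟩ := hσ.fixed ((x + σ x) / 2) (by
    rw [map_div₀, map_add, hσ.involutive, map_ofNat, add_comm])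
  obtain ⟨b, hb⟩ := hσ.fixed ((x - σ x) / (2 * s)) (by
    simp only [map_div₀, map_sub, map_mul, hσ.involutive, hs, map_ofNat]
    field_simp
    ring)
  refine ⟨a, b, ?_⟩
  rw [ha, hb]
  field_simp
  ring

theorem add_mul_inj {s : L} (hs0 : s ≠ 0) (hs : σ s = -s) {a b a' b' : K}
    (h : algebraMap K L a + algebraMap K L b * s = algebraMap K L a' + algebraMap K L b' * s) :
    a = a' ∧ b = b' := by
  have h2 := two_ne_zero' K (L := L)
  have h' := congrArg σ h
  simp only [map_add, map_mul, AlgEquiv.commutes, hs] at h'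
  constructor
  · apply (algebraMap K L).injective
    apply mul_left_cancel₀ h2
    linear_combination h + h'
  · apply (algebraMap K L).injective
    apply mul_left_cancel₀ (mul_ne_zero h2 hs0)
    linear_combination h - h'

/-- The coordinates of `L` with respect to the `K`-basis `1, s`. -/
def coordEquiv (hσ : IsConjugation σ) {s : L} (hs0 : s ≠ 0) (hs : σ s = -s) :
    (K × K) ≃ₗ[K] L :=
  LinearEquiv.ofBijective
    ((Algebra.linearMap K L).coprod ((LinearMap.mulRight K s).comp (Algebra.linearMap K L)))
    ⟨fun x y h => by
      obtain ⟨h1, h2⟩ := add_mul_inj hs0 hs (a := x.1) (b := x.2) (a' := y.1) (b' := y.2) h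
      exact Prod.ext h1 h2,
    fun x => by
      obtain ⟨a, b, h⟩ := hσ.exists_eq_add hs0 hs x
      exact ⟨(a, b), h.symm⟩⟩

theorem finrank_eq_two (hσ : IsConjugation σ) : Module.finrank K L = 2 := by
  obtain ⟨s, hs0, hs⟩ := hσ.exists_skew
  rw [← (hσ.coordEquiv hs0 hs).finrank_eq]
  simp

theorem finiteDimensional (hσ : IsConjugation σ) : FiniteDimensional K L :=
  Module.finite_of_finrank_pos (by rw [hσ.finrank_eq_two]; norm_num)

open Classical in
theorem algebraMap_norm (hσ : IsConjugation σ) (x : L) :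
    algebraMap K L (Algebra.norm K x) = x * σ x := by
  have := hσ.finiteDimensional
  have := charZero K L
  obtain ⟨s, hs0, hs⟩ := hσ.exists_skew
  have h1 : ∀ τ : L ≃ₐ[K] L, τ = 1 ∨ τ = σ := by
    intro τ
    have h2 : τ s = s ∨ τ s = -s := by
      obtain ⟨d, hd⟩ := hσ.fixed (s * s) (by simp [hs])
      rw [← mul_self_eq_mul_self_iff, ← map_mul, ← hd, AlgEquiv.commutes]
    rcases h2 with h2 | h2
    · left
      ext y
      obtain ⟨a, b, rfl⟩ := hσ.exists_eq_add hs0 hs y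
      simp [h2]
    · right
      ext y
      obtain ⟨a, b, rfl⟩ := hσ.exists_eq_add hs0 hs y
      simp [h2, hs]
  have hne : (1 : L ≃ₐ[K] L) ≠ σ := by
    rintro rfl
    obtain ⟨x, hx⟩ := hσ.nontrivial
    exact hx rfl
  have huniv : (Finset.univ : Finset (L ≃ₐ[K] L)) = {1, σ} := by
    ext τ
    simpa using h1 τ
  have hcard : Nat.card (L ≃ₐ[K] L) = Module.finrank K L := by
    rw [Nat.card_eq_fintype_card, ← Finset.card_univ, huniv, hσ.finrank_eq_two,
      Finset.card_pair hne]
  have : IsGalois K L := IsGalois.of_card_aut_eq_finrank K L hcard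
  rw [Algebra.norm_eq_prod_automorphisms, huniv, Finset.prod_pair hne]
  rfl

/-- Translates equalities of norm classes into equations in `L`, where the determinants and
Pfaffians live. -/
theorem mk_eq_mk_iff (hσ : IsConjugation σ) (a b : Kˣ) :
    (QuotientGroup.mk a : Kˣ ⧸ normSubgroup K L) = QuotientGroup.mk b ↔
      ∃ x : L, algebraMap K L b = algebraMap K L a * (x * σ x) := by
  rw [QuotientGroup.eq]
  constructor
  · rintro ⟨x, hx⟩
    refine ⟨x, ?_⟩
    rw [← hσ.algebraMap_norm, ← map_mul]
    have := congrArg (Units.val) hx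
    simp only [Units.coe_map, Units.val_mul] at this
    rw [this]
    simp
  · rintro ⟨x, hx⟩
    rw [← hσ.algebraMap_norm, ← map_mul] at hx
    have h := (algebraMap K L).injective hx
    have hx0 : x ≠ 0 := by
      rintro rfl
      have := hσ.finiteDimensional
      simp [Algebra.norm_zero] at h
    refine ⟨Units.mk0 x hx0, Units.ext ?_⟩
    simp [h]

/-- A generator with square in `K` goes to plus or minus itself under `σ`, and the plus sign would
place all of `L` in the fixed field. Thus every `δ` admitted by `IsClassOfQuaternion` is the square
of a skew element. -/
theorem exists_of_isQuadraticGenerator {δ : K} (hδ : IsQuadraticGenerator K L δ)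
    (hσ : IsConjugation σ) :
    ∃ s : L, s ≠ 0 ∧ σ s = -s ∧ s ^ 2 = algebraMap K L δ := by
  obtain ⟨-, s, hs, htop⟩ := hδ
  have h1 : σ s = s ∨ σ s = -s := by
    rw [← sq_eq_sq_iff_eq_or_eq_neg, ← map_pow, hs, AlgEquiv.commutes]
  have h2 : σ s ≠ s := by
    intro h
    obtain ⟨k, hk⟩ := hσ.fixed s h
    obtain ⟨x, hx⟩ := hσ.nontrivial
    have hx' : x ∈ Algebra.adjoin K {s} := htop ▸ Algebra.mem_top
    have hle : Algebra.adjoin K {s} ≤ (⊥ : Subalgebra K L) :=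
      Algebra.adjoin_le (by rintro _ rfl; exact ⟨k, hk⟩)
    obtain ⟨k', rfl⟩ := hle hx'
    exact hx (σ.commutes k')
  have h3 := h1.resolve_left h2
  exact ⟨s, by rintro rfl; simp at h2, h3, hs⟩

theorem isQuadraticGenerator (hσ : IsConjugation σ) {s : L} (hs0 : s ≠ 0) (hs : σ s = -s) {δ : K}
    (h : s ^ 2 = algebraMap K L δ) : IsQuadraticGenerator K L δ := by
  refine ⟨hσ.finrank_eq_two, s, h, eq_top_iff.2 fun x _ => ?_⟩
  obtain ⟨a, b, rfl⟩ := hσ.exists_eq_add hs0 hs x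
  exact add_mem (Subalgebra.algebraMap_mem _ _)
    (mul_mem (Subalgebra.algebraMap_mem _ _) (Algebra.self_mem_adjoin_singleton K s))

theorem exists_sq (hσ : IsConjugation σ) {s : L} (hs0 : s ≠ 0) (hs : σ s = -s) :
    ∃ δ : Kˣ, s ^ 2 = algebraMap K L δ := by
  obtain ⟨d, hd⟩ := hσ.fixed (s ^ 2) (by simp [hs])
  refine ⟨Units.mk0 d ?_, hd.symm⟩
  rintro rfl
  rw [map_zero] at hd
  exact hs0 (pow_eq_zero_iff two_ne_zero |>.1 hd.symm)

/-! ### Fixed spaces of semilinear involutions -/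

section Descent

variable {E : Type*} [AddCommGroup E] [Module L E]

/-- A semilinear involution decomposes a vector space into two copies of its fixed space. -/
theorem exists_fixed_add {s : L} (hs0 : s ≠ 0) (hs : σ s = -s)
    (Θ : E →+ E) (hΘ : ∀ (a : L) x, Θ (a • x) = σ a • Θ x) (hΘΘ : ∀ x, Θ (Θ x) = x)
    (S : Submodule L E) (hS : ∀ x ∈ S, Θ x ∈ S) {x : E} (hx : x ∈ S) :
    ∃ y ∈ S, ∃ z ∈ S, Θ y = y ∧ Θ z = z ∧ x = y + s • z := by
  have h2 := two_ne_zero' K (L := L)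
  refine ⟨(2 : L)⁻¹ • (x + Θ x), S.smul_mem _ (S.add_mem hx (hS x hx)),
    (2 * s)⁻¹ • (x - Θ x), S.smul_mem _ (S.sub_mem hx (hS x hx)), ?_, ?_, ?_⟩
  · rw [hΘ, map_add, hΘΘ, map_inv₀, map_ofNat, add_comm]
  · rw [hΘ, map_sub, hΘΘ, map_inv₀, map_mul, map_ofNat, hs, mul_neg, inv_neg, neg_smul,
      ← smul_neg, neg_sub]
  · rw [smul_smul]
    have : s * (2 * s)⁻¹ = 2⁻¹ := by field_simp
    rw [this, ← smul_add]
    have h3 : x + Θ x + (x - Θ x) = (2 : L) • x := by rw [two_smul]; abel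
    rw [h3, smul_smul, inv_mul_cancel₀ h2, one_smul]

theorem eq_zero_of_fixed_add {s : L} (hs0 : s ≠ 0) (hs : σ s = -s)
    (Θ : E →+ E) (hΘ : ∀ (a : L) x, Θ (a • x) = σ a • Θ x) {y z : E} (hy : Θ y = y) (hz : Θ z = z)
    (h : y + s • z = 0) : y = 0 ∧ z = 0 := by
  have h2 := two_ne_zero' K (L := L)
  have h' := congrArg Θ h
  rw [map_add, hΘ, hs, hy, hz, map_zero, neg_smul] at h'
  have h1 : (2 : L) • y = 0 := by
    rw [two_smul]
    calc y + y = (y + s • z) + (y + -(s • z)) := by abel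
      _ = 0 := by rw [h, h', add_zero]
  have hy0 := (smul_eq_zero.1 h1).resolve_left h2
  rw [hy0, zero_add] at h
  exact ⟨hy0, (smul_eq_zero.1 h).resolve_left hs0⟩

/-- Since `S = F ⊕ sF`, the `K`-dimension of `S` is twice that of `F`; it is also twice the
`L`-dimension of `S`. -/
theorem finrank_fixed [Module K E] [IsScalarTower K L E] [FiniteDimensional L E] {s : L}
    (hσ : IsConjugation σ) (hs0 : s ≠ 0) (hs : σ s = -s)
    (Θ : E →+ E) (hΘ : ∀ (a : L) x, Θ (a • x) = σ a • Θ x) (hΘΘ : ∀ x, Θ (Θ x) = x)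
    (S : Submodule L E) (hS : ∀ x ∈ S, Θ x ∈ S) (F : Submodule K E)
    (hF : ∀ x, x ∈ F ↔ x ∈ S ∧ Θ x = x) : Module.finrank K F = Module.finrank L S := by
  have := hσ.finiteDimensional
  have : FiniteDimensional K E := FiniteDimensional.trans K L E
  have : FiniteDimensional K S := FiniteDimensional.trans K L S
  have h1 : Module.finrank K S = 2 * Module.finrank L S := by
    rw [← hσ.finrank_eq_two, Module.finrank_mul_finrank]
  let f : (F × F) →ₗ[K] S :=
    { toFun := fun p => ⟨p.1 + s • (p.2 : E), S.add_mem ((hF _).1 p.1.2).1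
        (S.smul_mem _ ((hF _).1 p.2.2).1)⟩
      map_add' := fun p q => Subtype.ext (by simp; abel)
      map_smul' := fun c p => Subtype.ext (by
        change c • (p.1 : E) + s • c • (p.2 : E) = c • ((p.1 : E) + s • (p.2 : E))
        rw [smul_add, smul_comm]) }
  have hf : Function.Bijective f := by
    constructor
    · rw [← LinearMap.ker_eq_bot, LinearMap.ker_eq_bot']
      intro p hp
      obtain ⟨h3, h4⟩ := eq_zero_of_fixed_add hs0 hs Θ hΘ ((hF _).1 p.1.2).2 ((hF _).1 p.2.2).2
        (congrArg Subtype.val hp)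
      exact Prod.ext (Subtype.ext h3) (Subtype.ext h4)
    · rintro ⟨x, hx⟩
      obtain ⟨y, hy, z, hz, hy', hz', rfl⟩ := exists_fixed_add hs0 hs Θ hΘ hΘΘ S hS hx
      exact ⟨(⟨y, (hF y).2 ⟨hy, hy'⟩⟩, ⟨z, (hF z).2 ⟨hz, hz'⟩⟩), rfl⟩
  have h2 := (LinearEquiv.ofBijective f hf).finrank_eq
  rw [Module.finrank_prod, h1] at h2
  omega

end Descent

end IsConjugation

open Classical in
/-- A matrix pencil that is invertible at one point is invertible at a point of any infinite
subfield. -/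
theorem exists_det_add_smul_ne_zero (K : Type*) {L : Type*} [Field K] [Field L] [Algebra K L]
    [CharZero K] {n : Type*} [Fintype n] [DecidableEq n] (y z : Matrix n n L) (s : L)
    (h : (y + s • z).det ≠ 0) : ∃ t : K, (y + algebraMap K L t • z).det ≠ 0 := by
  -- The determinant of the pencil as a polynomial in the parameter: its value at `s` shows that it
  -- is nonzero, so its finitely many roots miss some element of the infinite field `K`.
  let p : Polynomial L := (y.map Polynomial.C + (Polynomial.X : Polynomial L) • z.map Polynomial.C).det
  have hp : ∀ t : L, p.eval t = (y + t • z).det := by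
    intro t
    rw [← Polynomial.coe_evalRingHom, RingHom.map_det]
    congr 1
    ext i j
    simp
    ring
  have hp0 : p ≠ 0 := fun h0 => h (by rw [← hp, h0, Polynomial.eval_zero])
  obtain ⟨t, ht⟩ := Infinite.exists_notMem_finset
    (p.roots.toFinset.preimage (algebraMap K L) (algebraMap K L).injective.injOn)
  refine ⟨t, fun h1 => ht ?_⟩
  rw [Finset.mem_preimage, Multiset.mem_toFinset, Polynomial.mem_roots hp0, Polynomial.IsRoot, hp]
  exact h1

/-! ### Brauer equivalence -/

namespace BrauerEquiv

variable {K : Type*} [Field K] {A B C : Type*} [Ring A] [Algebra K A] [Ring B] [Algebra K B]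
  [Ring C] [Algebra K C]

theorem of_algEquiv (e : A ≃ₐ[K] B) : BrauerEquiv K A B :=
  ⟨1, 1, one_ne_zero, one_ne_zero, ⟨e.mapMatrix⟩⟩

theorem symm : BrauerEquiv K A B → BrauerEquiv K B A := by
  rintro ⟨n, m, hn, hm, ⟨e⟩⟩
  exact ⟨m, n, hm, hn, ⟨e.symm⟩⟩

-- The isomorphism runs through `M_p(M_n(A)) ≅ M_p(M_m(B)) ≅ M_m(M_p(B)) ≅ M_m(M_q(C))`.
open Matrix in
theorem trans : BrauerEquiv K A B → BrauerEquiv K B C → BrauerEquiv K A C := by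
  rintro ⟨n, m, hn, hm, ⟨e⟩⟩ ⟨p, q, hp, hq, ⟨e'⟩⟩
  exact ⟨p * n, m * q, by simp_all, by simp_all,
    ⟨(reindexAlgEquiv _ _ finProdFinEquiv).symm.trans <| (compAlgEquiv _ _ _ _).symm.trans <|
      (e.mapMatrix (m := Fin p)).trans <| (compAlgEquiv _ _ _ _).trans <|
      (reindexAlgEquiv K B (.prodComm (Fin p) (Fin m))).trans <|
      (compAlgEquiv _ _ _ _).symm.trans <|
      e'.mapMatrix.trans <| (compAlgEquiv _ _ _ _).trans <| reindexAlgEquiv _ _ finProdFinEquiv⟩⟩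

theorem of_matrix {ι κ : Type*} [Fintype ι] [DecidableEq ι] [Nonempty ι] [Fintype κ]
    [DecidableEq κ] [Nonempty κ] (e : Matrix ι ι A ≃ₐ[K] Matrix κ κ B) : BrauerEquiv K A B :=
  ⟨Fintype.card ι, Fintype.card κ, Fintype.card_ne_zero, Fintype.card_ne_zero,
    ⟨(Matrix.reindexAlgEquiv K A (Fintype.equivFin ι)).symm.trans
      (e.trans (Matrix.reindexAlgEquiv K B (Fintype.equivFin κ)))⟩⟩

theorem of_algEquiv_matrix {κ : Type*} [Fintype κ] [DecidableEq κ] [Nonempty κ]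
    (e : A ≃ₐ[K] Matrix κ κ B) : BrauerEquiv K A B :=
  of_matrix ((Matrix.uniqueAlgEquiv (m := Unit)).trans e)

end BrauerEquiv

/-! ### Transport along isomorphisms of algebras -/

section Transport

variable {K : Type*} [Field K] {A B : Type*} [Ring A] [Algebra K A] [Ring B] [Algebra K B]

theorem IsCentralSimple.of_algEquiv (e : A ≃ₐ[K] B) (h : IsCentralSimple K A) :
    IsCentralSimple K B := by
  obtain ⟨h1, h2, h3⟩ := h
  refine ⟨⟨fun x hx => ?_⟩, ?_, ?_⟩
  · have h4 : e.symm x ∈ Subalgebra.center K A := by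
      rw [Subalgebra.mem_center_iff] at hx ⊢
      intro b
      apply e.injective
      rw [map_mul, map_mul, e.apply_symm_apply, hx]
    obtain ⟨k, hk⟩ := h1.out h4
    exact ⟨k, by rw [← e.apply_symm_apply x, ← hk]; exact (e.commutes k).symm⟩
  · exact IsSimpleRing.of_ringEquiv e.toRingEquiv h2
  · exact Module.Finite.equiv e.toLinearEquiv

theorem IsInBrTwo.of_algEquiv {L : Type*} [Field L] [Algebra K L] (e : A ≃ₐ[K] B)
    (h : IsInBrTwo K L A) : IsInBrTwo K L B :=
  ⟨h.centralSimple.of_algEquiv e,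
    (BrauerEquiv.of_algEquiv (Algebra.TensorProduct.congr e e)).symm.trans h.exponent_two,
    (BrauerEquiv.of_algEquiv (Algebra.TensorProduct.congr AlgEquiv.refl e)).symm.trans h.split⟩

/-- An isomorphism of algebras restricts to corresponding subalgebras. -/
def AlgEquiv.subalgebraCongr (e : A ≃ₐ[K] B) (S : Subalgebra K A) (T : Subalgebra K B)
    (h : ∀ x, e x ∈ T ↔ x ∈ S) : S ≃ₐ[K] T :=
  (e.subalgebraMap S).trans (Subalgebra.equivOfEq _ _ (by
    ext y
    constructor
    · rintro ⟨x, hx, rfl⟩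
      exact (h x).2 hx
    · intro hy
      exact ⟨e.symm y, (h _).1 (by simpa using hy), by simp⟩))

end Transport

/-! ### Twisted forms of matrix algebras -/

section TwistedForm

variable {K L : Type*} [Field K] [Field L] [Algebra K L] (σ : L ≃ₐ[K] L)
  {n : Type*} [Fintype n] [DecidableEq n]

/-- The `K`-form `{f | f P = P σ(f)}` of the matrix algebra over `L`. -/
def twistedForm (P : Matrix n n L) : Subalgebra K (Matrix n n L) where
  carrier := {f | f * P = P * σ.mapMatrix f}
  mul_mem' := by
    intro a b ha hb
    simp only [Set.mem_ofPred_eq] at *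
    rw [mul_assoc, hb, ← mul_assoc, ha, map_mul, mul_assoc]
  add_mem' := by
    intro a b ha hb
    simp only [Set.mem_ofPred_eq] at *
    rw [add_mul, ha, hb, map_add, mul_add]
  algebraMap_mem' := by
    intro r
    simp only [Set.mem_ofPred_eq]
    rw [AlgEquiv.commutes, Algebra.commutes]

variable {σ}

theorem mem_twistedForm {P f : Matrix n n L} : f ∈ twistedForm σ P ↔ f * P = P * σ.mapMatrix f :=
  Iff.rfl

theorem mapMatrix_smul (a : L) (f : Matrix n n L) :
    σ.mapMatrix (a • f) = σ a • σ.mapMatrix f := by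
  ext i j
  simp

/-- `v ↦ P σ(v)` is a semilinear map with square `c`. -/
def IsTwist (σ : L ≃ₐ[K] L) (P : Matrix n n L) (c : Kˣ) : Prop :=
  P * σ.mapMatrix P = algebraMap K (Matrix n n L) c

namespace IsTwist

variable {P : Matrix n n L} {c : Kˣ}

theorem eq (hP : IsTwist σ P c) : P * σ.mapMatrix P = algebraMap K (Matrix n n L) c := hP

theorem smul_one (hP : IsTwist σ P c) : P * σ.mapMatrix P = algebraMap K L c • 1 := by
  rw [hP, Algebra.algebraMap_eq_smul_one, algebraMap_smul]

theorem mapMatrix_mul (hσ : IsConjugation σ) (hP : IsTwist σ P c) :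
    σ.mapMatrix P * P = algebraMap K (Matrix n n L) c := by
  have h := congrArg σ.mapMatrix hP
  have h2 : σ.mapMatrix (σ.mapMatrix P) = P := by ext i j; simp [hσ.involutive]
  rwa [map_mul, h2, AlgEquiv.commutes] at h

/-- The semilinear involution `f ↦ c⁻¹ P σ(f) σ(Q)`. -/
def theta (σ : L ≃ₐ[K] L) (P Q : Matrix n n L) (c : Kˣ) : Matrix n n L →+ Matrix n n L where
  toFun f := algebraMap K (Matrix n n L) ((c⁻¹ : Kˣ) : K) * (P * σ.mapMatrix f * σ.mapMatrix Q)
  map_zero' := by simp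
  map_add' f g := by rw [map_add, mul_add, add_mul, mul_add]

variable {Q : Matrix n n L}

theorem theta_apply (f : Matrix n n L) : theta σ P Q c f =
    algebraMap K (Matrix n n L) ((c⁻¹ : Kˣ) : K) * (P * σ.mapMatrix f * σ.mapMatrix Q) := rfl

theorem theta_smul (a : L) (f : Matrix n n L) :
    theta σ P Q c (a • f) = σ a • theta σ P Q c f := by
  rw [theta_apply, theta_apply, mapMatrix_smul, mul_smul_comm, smul_mul_assoc, mul_smul_comm]

theorem inv_mul_self : algebraMap K (Matrix n n L) ((c⁻¹ : Kˣ) : K) *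
    algebraMap K (Matrix n n L) c = 1 := by
  rw [← map_mul, Units.inv_mul, map_one]

/-- As `c⁻¹ σ(Q)` is the inverse of `Q`, `theta` is `f ↦ P σ(f) Q⁻¹`. Its fixed points intertwine
the semilinear maps of `Q` and `P`, and for `Q = P` they form the twisted form. -/
theorem theta_eq_iff (hσ : IsConjugation σ) (hQ : IsTwist σ Q c) (f : Matrix n n L) :
    theta σ P Q c f = f ↔ f * Q = P * σ.mapMatrix f := by
  rw [theta_apply]
  constructor
  · intro h
    rw [← h]
    rw [mul_assoc, mul_assoc (P * _), hQ.mapMatrix_mul hσ, ← mul_assoc, h, mul_assoc,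
      ← Algebra.commutes (c : K), ← mul_assoc, ← mul_assoc, inv_mul_self, one_mul]
  · intro h
    rw [← h, mul_assoc, hQ.eq, ← Algebra.commutes, ← mul_assoc, inv_mul_self, one_mul]

/-- Two applications give `c⁻² (P σ(P)) f (Q σ(Q))`; this is where both twists need the same square
`c`. -/
theorem theta_theta (hσ : IsConjugation σ) (hP : IsTwist σ P c) (hQ : IsTwist σ Q c)
    (f : Matrix n n L) : theta σ P Q c (theta σ P Q c f) = f := by
  have h2 : ∀ g : Matrix n n L, σ.mapMatrix (σ.mapMatrix g) = g := fun g => by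
    ext i j; simp [hσ.involutive]
  have h3 := hQ.mapMatrix_mul hσ
  rw [theta_apply, theta_apply, map_mul, map_mul, map_mul, h2, h2, AlgEquiv.commutes]
  calc _ = (algebraMap K (Matrix n n L) ((c⁻¹ : Kˣ) : K) *
        algebraMap K (Matrix n n L) ((c⁻¹ : Kˣ) : K)) *
        ((P * σ.mapMatrix P) * f * (Q * σ.mapMatrix Q)) := by
        simp only [← mul_assoc]
        rw [mul_assoc _ P, ← Algebra.commutes _ P]
        simp only [← mul_assoc]
    _ = f := by
        rw [hP.eq, hQ.eq, ← Algebra.commutes, ← mul_assoc, ← mul_assoc,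
          mul_assoc (algebraMap K (Matrix n n L) ((c⁻¹ : Kˣ) : K)), inv_mul_self, mul_one,
          mul_assoc, ← Algebra.commutes (c : K) f, ← mul_assoc, inv_mul_self, one_mul]

variable [CharZero K]

/-- With `eq_zero_of_add` this is Galois descent: `M_n(L)` is the direct sum of the twisted form and
`s` times it. -/
theorem exists_add (hσ : IsConjugation σ) (hP : IsTwist σ P c) {s : L} (hs0 : s ≠ 0)
    (hs : σ s = -s) (f : Matrix n n L) :
    ∃ y ∈ twistedForm σ P, ∃ z ∈ twistedForm σ P, f = y + s • z := by
  obtain ⟨y, -, z, -, hy, hz, h⟩ := IsConjugation.exists_fixed_add hs0 hs (theta σ P P c)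
    theta_smul (theta_theta hσ hP hP) ⊤ (fun _ _ => trivial) (x := f) trivial
  exact ⟨y, (theta_eq_iff hσ hP y).1 hy, z, (theta_eq_iff hσ hP z).1 hz, h⟩

theorem eq_zero_of_add (hσ : IsConjugation σ) (hP : IsTwist σ P c) {s : L} (hs0 : s ≠ 0)
    (hs : σ s = -s) {y z : Matrix n n L} (hy : y ∈ twistedForm σ P) (hz : z ∈ twistedForm σ P)
    (h : y + s • z = 0) : y = 0 ∧ z = 0 :=
  IsConjugation.eq_zero_of_fixed_add hs0 hs (theta σ P P c) theta_smul
    ((theta_eq_iff hσ hP y).2 hy) ((theta_eq_iff hσ hP z).2 hz) h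

theorem finrank_twistedForm (hσ : IsConjugation σ) (hP : IsTwist σ P c) :
    Module.finrank K (twistedForm σ P) = Fintype.card n ^ 2 := by
  obtain ⟨s, hs0, hs⟩ := hσ.exists_skew
  have h := hσ.finrank_fixed hs0 hs (theta σ P P c) theta_smul (theta_theta hσ hP hP) ⊤
    (fun _ _ => trivial) (Subalgebra.toSubmodule (twistedForm σ P))
    fun x => ⟨fun hx => ⟨trivial, (theta_eq_iff hσ hP x).2 hx⟩,
      fun hx => (theta_eq_iff hσ hP x).1 hx.2⟩
  rw [finrank_top, Module.finrank_matrix, Module.finrank_self, mul_one, ← sq] at h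
  exact h

theorem finite_twistedForm (hσ : IsConjugation σ) :
    FiniteDimensional K (twistedForm σ P) := by
  have := hσ.finiteDimensional
  have : FiniteDimensional K (Matrix n n L) := FiniteDimensional.trans K L _
  infer_instance

theorem commute_all (hσ : IsConjugation σ) (hP : IsTwist σ P c) {x : Matrix n n L}
    (hx : ∀ y ∈ twistedForm σ P, x * y = y * x) : ∃ l : L, x = l • 1 := by
  obtain ⟨s, hs0, hs⟩ := hσ.exists_skew
  have h : x ∈ Subalgebra.center L (Matrix n n L) := by
    rw [Subalgebra.mem_center_iff]
    intro b
    obtain ⟨y, hy, z, hz, rfl⟩ := hP.exists_add hσ hs0 hs b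
    rw [mul_add, add_mul, mul_smul_comm, smul_mul_assoc, hx y hy, hx z hz]
  rw [Algebra.IsCentral.center_eq_bot] at h
  obtain ⟨l, hl⟩ := h
  exact ⟨l, hl.symm.trans (Algebra.algebraMap_eq_smul_one l)⟩

/-- A central element commutes with all of `M_n(L)`, hence is a scalar, and the twist equation makes
this scalar `σ`-invariant. A nonzero two-sided ideal `I` yields the two-sided ideal `I + sI` of the
simple ring `M_n(L)`, which therefore contains `1`; by uniqueness of components, `1 ∈ I`. -/
theorem isCentralSimple [Nonempty n] (hσ : IsConjugation σ) (hP : IsTwist σ P c) :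
    IsCentralSimple K (twistedForm σ P) := by
  obtain ⟨s, hs0, hs⟩ := hσ.exists_skew
  obtain ⟨δ, hδ⟩ := hσ.exists_sq hs0 hs
  refine ⟨⟨fun x hx => ?_⟩, ⟨⟨fun I => ?_⟩⟩, finite_twistedForm hσ⟩
  · rw [Subalgebra.mem_center_iff] at hx
    obtain ⟨l, hl⟩ := hP.commute_all hσ (x := x)
      fun y hy => (congrArg Subtype.val (hx ⟨y, hy⟩)).symm
    have h1 := mem_twistedForm.1 x.2
    rw [hl, mapMatrix_smul, map_one, smul_mul_assoc, one_mul, mul_smul_comm, mul_one] at h1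
    have hP0 : P ≠ 0 := by
      rintro rfl
      have h2 := hP.smul_one
      rw [zero_mul, eq_comm, smul_eq_zero] at h2
      rcases h2 with h2 | h2
      · exact c.ne_zero ((algebraMap K L).injective (h2.trans (map_zero _).symm))
      · exact one_ne_zero h2
    have h2 : (l - σ l) • P = 0 := by rw [sub_smul, h1, sub_self]
    obtain ⟨k, rfl⟩ := hσ.fixed l (sub_eq_zero.1 ((smul_eq_zero.1 h2).resolve_right hP0)).symm
    exact ⟨k, Subtype.ext (by
      rw [hl, algebraMap_smul]
      exact Algebra.algebraMap_eq_smul_one k)⟩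
  · by_cases hI : I = ⊥
    · exact Or.inl hI
    right
    obtain ⟨x, hxI, hx0⟩ : ∃ x ∈ I, x ≠ 0 := by
      by_contra! h
      exact hI (eq_bot_iff.2 fun x hx => (TwoSidedIdeal.mem_bot _).2 (h x hx))
    let J : TwoSidedIdeal (Matrix n n L) := TwoSidedIdeal.mk'
      {f | ∃ y ∈ I, ∃ z ∈ I, f = (y : Matrix n n L) + s • (z : Matrix n n L)}
      ⟨0, I.zero_mem, 0, I.zero_mem, by simp⟩
      (by
        rintro _ _ ⟨y, hy, z, hz, rfl⟩ ⟨y', hy', z', hz', rfl⟩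
        refine ⟨_, I.add_mem hy hy', _, I.add_mem hz hz', ?_⟩
        push_cast
        rw [smul_add]
        abel)
      (by
        rintro _ ⟨y, hy, z, hz, rfl⟩
        refine ⟨_, I.neg_mem hy, _, I.neg_mem hz, ?_⟩
        push_cast
        rw [smul_neg]
        abel)
      (by
        rintro g _ ⟨y, hy, z, hz, rfl⟩
        obtain ⟨a, ha, b, hb, rfl⟩ := hP.exists_add hσ hs0 hs g
        -- With `s² = δ`: `(a + sb)(y + sz) = (ay + δbz) + s(az + by)`.
        refine ⟨_, I.add_mem (I.mul_mem_left ⟨a, ha⟩ _ hy)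
          (I.mul_mem_left (algebraMap K _ δ * ⟨b, hb⟩) _ hz), _,
          I.add_mem (I.mul_mem_left ⟨a, ha⟩ _ hz) (I.mul_mem_left ⟨b, hb⟩ _ hy), ?_⟩
        push_cast
        have h1 : algebraMap K (Matrix n n L) δ = (s * s) • 1 := by
          rw [← sq, hδ, Algebra.algebraMap_eq_smul_one, algebraMap_smul]
        rw [h1]
        simp only [add_mul, mul_add, smul_mul_assoc, mul_smul_comm, smul_smul, one_mul, smul_add]
        abel)
      (by
        rintro _ g ⟨y, hy, z, hz, rfl⟩
        obtain ⟨a, ha, b, hb, rfl⟩ := hP.exists_add hσ hs0 hs g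
        refine ⟨_, I.add_mem (I.mul_mem_right _ ⟨a, ha⟩ hy)
          (I.mul_mem_right _ (algebraMap K _ δ * ⟨b, hb⟩) hz), _,
          I.add_mem (I.mul_mem_right _ ⟨a, ha⟩ hz) (I.mul_mem_right _ ⟨b, hb⟩ hy), ?_⟩
        push_cast
        have h1 : algebraMap K (Matrix n n L) δ = (s * s) • 1 := by
          rw [← sq, hδ, Algebra.algebraMap_eq_smul_one, algebraMap_smul]
        rw [h1]
        simp only [add_mul, mul_add, smul_mul_assoc, mul_smul_comm, smul_smul, one_mul, smul_add]
        abel)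
    have hJ : ∀ f, f ∈ J ↔ ∃ y ∈ I, ∃ z ∈ I, f = (y : Matrix n n L) + s • (z : Matrix n n L) :=
      fun f => TwoSidedIdeal.mem_mk' _ _ _ _ _ _ _
    have hxJ : (x : Matrix n n L) ∈ J := (hJ _).2 ⟨x, hxI, 0, I.zero_mem, by simp⟩
    have hJtop : J = ⊤ := (eq_bot_or_eq_top J).resolve_left fun h => by
      rw [h, TwoSidedIdeal.mem_bot] at hxJ
      exact hx0 (Subtype.ext hxJ)
    obtain ⟨y, hy, z, hz, h⟩ := (hJ 1).1 (hJtop ▸ trivial)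
    have h1 : ((y - 1 : twistedForm σ P) : Matrix n n L) + s • (z : Matrix n n L) = 0 := by
      push_cast
      rw [h]
      push_cast
      abel
    have h2 := (hP.eq_zero_of_add hσ hs0 hs (y - 1).2 z.2 h1).1
    have h3 : y = 1 := sub_eq_zero.1 (Subtype.ext h2)
    exact I.one_mem_iff.1 (h3 ▸ hy)

/-- The `L`-linear extension of the inclusion of a twisted form. -/
def baseChangeHom (σ : L ≃ₐ[K] L) (P : Matrix n n L) :
    L ⊗[K] twistedForm σ P →ₐ[L] Matrix n n L :=
  Algebra.TensorProduct.lift (Algebra.ofId L (Matrix n n L)) (twistedForm σ P).val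
    fun a _ => (show Commute (Algebra.ofId L (Matrix n n L) a) _ from Algebra.commutes a _)

theorem baseChangeHom_tmul (a : L) (x : twistedForm σ P) :
    baseChangeHom σ P (a ⊗ₜ x) = a • (x : Matrix n n L) := by
  rw [baseChangeHom, Algebra.TensorProduct.lift_tmul, Algebra.ofId_apply,
    Algebra.algebraMap_eq_smul_one, smul_mul_assoc, one_mul]
  rfl

/-- A twisted form of the matrix algebra is split by `L`. -/
def baseChangeEquiv (hσ : IsConjugation σ) (hP : IsTwist σ P c) :
    L ⊗[K] twistedForm σ P ≃ₐ[L] Matrix n n L :=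
  AlgEquiv.ofBijective (baseChangeHom σ P) (by
    have := finite_twistedForm (P := P) hσ
    have hsurj : Function.Surjective (baseChangeHom σ P).toLinearMap := by
      intro x
      obtain ⟨s, hs0, hs⟩ := hσ.exists_skew
      obtain ⟨y, hy, z, hz, rfl⟩ := hP.exists_add hσ hs0 hs x
      refine ⟨1 ⊗ₜ ⟨y, hy⟩ + s ⊗ₜ ⟨z, hz⟩, ?_⟩
      rw [AlgHom.toLinearMap_apply, map_add, baseChangeHom_tmul, baseChangeHom_tmul, one_smul]
    refine ⟨(LinearMap.injective_iff_surjective_of_finrank_eq_finrank ?_).2 hsurj, hsurj⟩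
    rw [Module.finrank_baseChange, hP.finrank_twistedForm hσ, Module.finrank_matrix,
      Module.finrank_self, mul_one, sq])

theorem baseChangeEquiv_tmul (hσ : IsConjugation σ) (hP : IsTwist σ P c) (a : L)
    (x : twistedForm σ P) : hP.baseChangeEquiv hσ (a ⊗ₜ x) = a • (x : Matrix n n L) :=
  baseChangeHom_tmul a x

end IsTwist

end TwistedForm

/-! ### Classification of twists by size and square -/

section TwistedFormBrauer

variable {K L : Type*} [Field K] [Field L] [Algebra K L] {σ : L ≃ₐ[K] L}
  {n : Type*} [Fintype n] [DecidableEq n]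

namespace IsTwist

variable {P Q : Matrix n n L} {c : Kˣ}

theorem reindex {n' : Type*} [Fintype n'] [DecidableEq n'] (e : n ≃ n') (hP : IsTwist σ P c) :
    IsTwist σ (Matrix.reindexAlgEquiv K L e P) c := by
  have h := congrArg (Matrix.reindexAlgEquiv K L e) hP
  rw [map_mul, AlgEquiv.commutes] at h
  exact h

/-- Twisted forms with reindexed twist. -/
def reindexEquiv {n' : Type*} [Fintype n'] [DecidableEq n'] (e : n ≃ n') :
    twistedForm σ P ≃ₐ[K] twistedForm σ (Matrix.reindexAlgEquiv K L e P) :=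
  AlgEquiv.subalgebraCongr (Matrix.reindexAlgEquiv K L e) _ _ fun x => by
    rw [mem_twistedForm, mem_twistedForm]
    have : σ.mapMatrix (Matrix.reindexAlgEquiv K L e x) =
      Matrix.reindexAlgEquiv K L e (σ.mapMatrix x) := rfl
    rw [this, ← map_mul, ← map_mul]
    exact (Matrix.reindexAlgEquiv K L e).injective.eq_iff

/-- The direct sum of copies of a twist. -/
theorem comp (ι : Type*) [Fintype ι] [DecidableEq ι] (hP : IsTwist σ P c) :
    IsTwist σ (Matrix.compAlgEquiv ι n L K (Matrix.diagonal fun _ => P)) c := by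
  have : σ.mapMatrix (Matrix.compAlgEquiv ι n L K (Matrix.diagonal fun _ => P)) =
      Matrix.compAlgEquiv ι n L K (Matrix.diagonal fun _ => σ.mapMatrix P) := by
    ext ⟨i, a⟩ ⟨j, b⟩
    by_cases h : i = j <;> simp [Matrix.diagonal, h]
  rw [IsTwist, this, ← map_mul, Matrix.diagonal_mul_diagonal, hP.eq,
    ← AlgEquiv.commutes (Matrix.compAlgEquiv ι n L K)]
  rfl

/-- Matrix algebras over twisted forms are twisted forms. -/
def compEquiv (σ : L ≃ₐ[K] L) (P : Matrix n n L) (ι : Type*) [Fintype ι] [DecidableEq ι] :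
    Matrix ι ι (twistedForm σ P) ≃ₐ[K]
      twistedForm σ (Matrix.compAlgEquiv ι n L K (Matrix.diagonal fun _ => P)) :=
  let f : Matrix ι ι (twistedForm σ P) →ₐ[K] Matrix (ι × n) (ι × n) L :=
    (Matrix.compAlgEquiv ι n L K).toAlgHom.comp (twistedForm σ P).val.mapMatrix
  (AlgEquiv.ofInjective f (by
    intro A B h
    have h' : A.map Subtype.val = B.map Subtype.val := (Matrix.compAlgEquiv ι n L K).injective h
    ext i j : 2
    exact congrFun (congrFun h' i) j)).trans (Subalgebra.equivOfEq _ _ (by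
    have h1 : ∀ M : Matrix ι ι (Matrix n n L), Matrix.compAlgEquiv ι n L K M ∈
        twistedForm σ (Matrix.compAlgEquiv ι n L K (Matrix.diagonal fun _ => P)) ↔
        ∀ i j, M i j ∈ twistedForm σ P := by
      intro M
      have h2 : σ.mapMatrix (Matrix.compAlgEquiv ι n L K M) =
        Matrix.compAlgEquiv ι n L K (M.map σ.mapMatrix) := rfl
      rw [mem_twistedForm, h2, ← map_mul, ← map_mul,
        (Matrix.compAlgEquiv ι n L K).injective.eq_iff, ← Matrix.ext_iff]
      simp only [Matrix.mul_diagonal, Matrix.diagonal_mul, mem_twistedForm, Matrix.map_apply]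
    ext x
    obtain ⟨M, rfl⟩ := (Matrix.compAlgEquiv ι n L K).surjective x
    rw [h1]
    constructor
    · rintro ⟨A, hA⟩ i j
      have : A.map Subtype.val = M := (Matrix.compAlgEquiv ι n L K).injective hA
      rw [← this]
      exact (A i j).2
    · intro h
      exact ⟨Matrix.of fun i j => ⟨M i j, h i j⟩, rfl⟩))

variable [CharZero K]

/-- Two twists with the same square are equivalent. -/
theorem exists_intertwiner (hσ : IsConjugation σ) (hP : IsTwist σ P c) (hQ : IsTwist σ Q c) :
    ∃ X : Matrix n n L, X.det ≠ 0 ∧ X * Q = P * σ.mapMatrix X := by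
  obtain ⟨s, hs0, hs⟩ := hσ.exists_skew
  -- As in Hilbert 90, the identity is split as `y + sz` with `y`, `z` fixed by `theta`. The pencil
  -- is invertible at `s`, hence at some `t ∈ K`, and `y + tz` is still fixed.
  obtain ⟨y, -, z, -, hy, hz, h⟩ := IsConjugation.exists_fixed_add hs0 hs (theta σ P Q c)
    theta_smul (theta_theta hσ hP hQ) ⊤ (fun _ _ => trivial) (x := 1) trivial
  obtain ⟨t, ht⟩ := exists_det_add_smul_ne_zero K y z s (by rw [← h]; simp)
  refine ⟨_, ht, (theta_eq_iff hσ hQ _).1 ?_⟩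
  rw [map_add, theta_smul, AlgEquiv.commutes, hy, hz]

/-- Conjugation by an intertwiner of twists. -/
theorem nonempty_equiv_of_same_index (hσ : IsConjugation σ) (hP : IsTwist σ P c)
    (hQ : IsTwist σ Q c) : Nonempty (twistedForm σ Q ≃ₐ[K] twistedForm σ P) := by
  obtain ⟨X, hX, hXQ⟩ := exists_intertwiner hσ hP hQ
  let X' : (Matrix n n L)ˣ := Matrix.nonsingInvUnit X (isUnit_iff_ne_zero.2 hX)
  have hX' : (X' : Matrix n n L) = X := rfl
  let e : Matrix n n L ≃ₐ[K] Matrix n n L :=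
    (MulSemiringAction.toAlgEquiv K (Matrix n n L) (ConjAct.toConjAct X'))
  have he : ∀ x, e x = X * x * (X'⁻¹ : (Matrix n n L)ˣ) := fun x => by
    simp only [e, MulSemiringAction.toAlgEquiv_apply, ConjAct.units_smul_def]
    rfl
  refine ⟨AlgEquiv.subalgebraCongr e _ _ fun x => ?_⟩
  rw [mem_twistedForm, mem_twistedForm, he, map_mul, map_mul]
  have h1 : σ.mapMatrix (X'⁻¹ : (Matrix n n L)ˣ) * σ.mapMatrix X = 1 := by
    rw [← map_mul, ← hX', Units.inv_mul, map_one]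
  have h2 : ((X'⁻¹ : (Matrix n n L)ˣ) : Matrix n n L) * P * σ.mapMatrix X = Q := by
    rw [mul_assoc, ← hXQ, ← hX', Units.inv_mul_cancel_left]
  constructor
  · intro h
    have h3 := congrArg (fun A => ((X'⁻¹ : (Matrix n n L)ˣ) : Matrix n n L) * A * σ.mapMatrix X) h
    calc x * Q = _ := by rw [← h2]
      _ = ((X'⁻¹ : (Matrix n n L)ˣ) : Matrix n n L) *
        (X * x * ((X'⁻¹ : (Matrix n n L)ˣ) : Matrix n n L) * P) * σ.mapMatrix X := by
        rw [← hX']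
        simp only [mul_assoc, Units.inv_mul_cancel_left]
      _ = _ := h3
      _ = (((X'⁻¹ : (Matrix n n L)ˣ) : Matrix n n L) * P * σ.mapMatrix X) * σ.mapMatrix x *
          (σ.mapMatrix (X'⁻¹ : (Matrix n n L)ˣ) * σ.mapMatrix X) := by
        simp only [mul_assoc]
      _ = _ := by rw [h1, h2, mul_one]
  · intro h
    have h4 : ((X'⁻¹ : (Matrix n n L)ˣ) : Matrix n n L) * P =
        Q * σ.mapMatrix (X'⁻¹ : (Matrix n n L)ˣ) := by
      have h5 : σ.mapMatrix X * σ.mapMatrix (X'⁻¹ : (Matrix n n L)ˣ) = 1 := by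
        rw [← map_mul, ← hX', Units.mul_inv, map_one]
      rw [← h2, mul_assoc _ (σ.mapMatrix X), h5, mul_one]
    rw [mul_assoc, h4, ← mul_assoc, mul_assoc X, h, ← mul_assoc, hXQ]
    simp only [mul_assoc]

theorem nonempty_equiv {n' : Type*} [Fintype n'] [DecidableEq n'] {P' : Matrix n' n' L}
    (hσ : IsConjugation σ) (hP : IsTwist σ P c) (hP' : IsTwist σ P' c)
    (hcard : Fintype.card n = Fintype.card n') :
    Nonempty (twistedForm σ P ≃ₐ[K] twistedForm σ P') := by
  obtain ⟨e⟩ := nonempty_equiv_of_same_index hσ hP' (hP.reindex (Fintype.equivOfCardEq hcard))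
  exact ⟨(reindexEquiv _).trans e⟩

/-- Taking `card n'` copies of `P` and `card n` copies of `P'` equalises the sizes without changing
the square. -/
theorem brauerEquiv {n' : Type*} [Fintype n'] [DecidableEq n'] [Nonempty n] [Nonempty n']
    {P' : Matrix n' n' L} (hσ : IsConjugation σ) (hP : IsTwist σ P c) (hP' : IsTwist σ P' c) :
    BrauerEquiv K (twistedForm σ P) (twistedForm σ P') := by
  obtain ⟨e⟩ := nonempty_equiv hσ (hP.comp n') (hP'.comp n) (by simp [mul_comm])
  exact BrauerEquiv.of_matrix ((compEquiv σ P n').trans (e.trans (compEquiv σ P' n).symm))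

/-- The twisted form of a scalar twist is the matrix algebra over the ground field. -/
theorem nonempty_equiv_matrix (hσ : IsConjugation σ) (c : Kˣ) :
    Nonempty (Matrix n n K ≃ₐ[K] twistedForm σ (algebraMap K (Matrix n n L) c)) := by
  let f : Matrix n n K →ₐ[K] Matrix n n L := (Algebra.ofId K L).mapMatrix
  have hf : Function.Injective f := fun A B h => by
    ext i j
    exact (algebraMap K L).injective (congrFun (congrFun h i) j)
  refine ⟨(AlgEquiv.ofInjective f hf).trans (Subalgebra.equivOfEq _ _ ?_)⟩
  ext x
  rw [mem_twistedForm, ← Algebra.commutes]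
  have h1 : IsUnit (algebraMap K (Matrix n n L) c) := c.isUnit.map _
  rw [h1.mul_right_inj]
  constructor
  · rintro ⟨A, rfl⟩
    ext i j
    exact (σ.commutes (A i j)).symm
  · intro h
    choose A hA using fun i j => hσ.fixed (x i j) (congrFun (congrFun h i) j).symm
    exact ⟨Matrix.of A, by ext i j; exact hA i j⟩

end IsTwist

end TwistedFormBrauer

/-! ### Tensor squares and the norm class of a twist -/

section Tensor

open scoped Kronecker

variable {K L : Type*} [Field K] [Field L] [Algebra K L] {σ : L ≃ₐ[K] L}
  {n : Type*} [Fintype n] [DecidableEq n] 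

theorem mapMatrix_kronecker (A B : Matrix n n L) :
    σ.mapMatrix (A ⊗ₖ B) = σ.mapMatrix A ⊗ₖ σ.mapMatrix B := by
  ext ⟨i, j⟩ ⟨k, l⟩
  simp

variable (K L n) in
/-- The Kronecker product as a homomorphism from the tensor product over a subfield. -/
def kroneckerHom : Matrix n n L ⊗[K] Matrix n n L →ₐ[K] Matrix (n × n) (n × n) L :=
  Algebra.TensorProduct.lift
    (AlgHom.ofLinearMap
      { toFun := fun A => A ⊗ₖ (1 : Matrix n n L)
        map_add' := fun A B => Matrix.add_kronecker A B 1
        map_smul' := fun c A => Matrix.smul_kronecker c A 1 }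
      (Matrix.one_kronecker_one) (fun A B => by
        change (A * B) ⊗ₖ (1 : Matrix n n L) = (A ⊗ₖ 1) * (B ⊗ₖ 1)
        rw [← Matrix.mul_kronecker_mul, mul_one]))
    (AlgHom.ofLinearMap
      { toFun := fun A => (1 : Matrix n n L) ⊗ₖ A
        map_add' := fun A B => Matrix.kronecker_add 1 A B
        map_smul' := fun c A => Matrix.kronecker_smul c 1 A }
      (Matrix.one_kronecker_one) (fun A B => by
        change (1 : Matrix n n L) ⊗ₖ (A * B) = (1 ⊗ₖ A) * (1 ⊗ₖ B)
        rw [← Matrix.mul_kronecker_mul, mul_one]))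
    fun A B => by
      change (A ⊗ₖ (1 : Matrix n n L)) * (1 ⊗ₖ B) = (1 ⊗ₖ B) * (A ⊗ₖ 1)
      rw [← Matrix.mul_kronecker_mul, ← Matrix.mul_kronecker_mul]
      simp

theorem kroneckerHom_tmul (A B : Matrix n n L) : kroneckerHom K L n (A ⊗ₜ B) = A ⊗ₖ B := by
  rw [kroneckerHom, Algebra.TensorProduct.lift_tmul]
  change (A ⊗ₖ (1 : Matrix n n L)) * (1 ⊗ₖ B) = _
  rw [← Matrix.mul_kronecker_mul, mul_one, one_mul]

variable [CharZero K] {P : Matrix n n L} {c : Kˣ}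

namespace IsTwist

theorem kronecker (hP : IsTwist σ P c) : IsTwist σ (P ⊗ₖ P) (c * c) := by
  rw [IsTwist, mapMatrix_kronecker, ← Matrix.mul_kronecker_mul, hP.eq,
    Algebra.algebraMap_eq_smul_one, Algebra.algebraMap_eq_smul_one, Matrix.smul_kronecker,
    Matrix.kronecker_smul, Matrix.one_kronecker_one, smul_smul, Units.val_mul]

/-- The tensor square of a twisted form is the twisted form of the Kronecker square. -/
theorem nonempty_tensor_equiv (hσ : IsConjugation σ) (hP : IsTwist σ P c) :
    Nonempty (twistedForm σ P ⊗[K] twistedForm σ P ≃ₐ[K] twistedForm σ (P ⊗ₖ P)) := by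
  obtain ⟨s, hs0, hs⟩ := hσ.exists_skew
  obtain ⟨δ, hδ⟩ := hσ.exists_sq hs0 hs
  have := finite_twistedForm (P := P) hσ
  have := finite_twistedForm (P := P ⊗ₖ P) hσ
  let f : twistedForm σ P ⊗[K] twistedForm σ P →ₐ[K] Matrix (n × n) (n × n) L :=
    (kroneckerHom K L n).comp
      (Algebra.TensorProduct.map (twistedForm σ P).val (twistedForm σ P).val)
  have hf : ∀ x y : twistedForm σ P, f (x ⊗ₜ y) = (x : Matrix n n L) ⊗ₖ (y : Matrix n n L) :=
    fun x y => by
      change kroneckerHom K L n (Algebra.TensorProduct.map _ _ (x ⊗ₜ y)) = _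
      rw [Algebra.TensorProduct.map_tmul, kroneckerHom_tmul]
      rfl
  have hmem : ∀ x, f x ∈ twistedForm σ (P ⊗ₖ P) := by
    intro x
    induction x using TensorProduct.induction_on with
    | zero => simp
    | add x y hx hy => rw [map_add]; exact add_mem hx hy
    | tmul x y =>
      rw [hf, mem_twistedForm, mapMatrix_kronecker, ← Matrix.mul_kronecker_mul,
        ← Matrix.mul_kronecker_mul, x.2, y.2]
  -- Kronecker products span the large matrix algebra over `L`. Splitting both factors by descent
  -- and replacing `s²` by `δ ∈ K` leaves only coefficients `1` and `s`; uniqueness of components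
  -- then gives surjectivity onto the twisted form.
  have hall : ∀ z : Matrix (n × n) (n × n) L, ∃ a b, z = f a + s • f b := by
    intro z
    obtain ⟨z, rfl⟩ := (Matrix.kroneckerAlgEquiv n n L).surjective z
    induction z using TensorProduct.induction_on with
    | zero => exact ⟨0, 0, by simp⟩
    | add x y hx hy =>
      obtain ⟨a, b, h⟩ := hx
      obtain ⟨a', b', h'⟩ := hy
      refine ⟨a + a', b + b', ?_⟩
      rw [map_add, h, h', map_add, map_add, smul_add]
      abel
    | tmul A B =>
      obtain ⟨y, hy, z, hz, rfl⟩ := hP.exists_add hσ hs0 hs A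
      obtain ⟨y', hy', z', hz', rfl⟩ := hP.exists_add hσ hs0 hs B
      refine ⟨⟨y, hy⟩ ⊗ₜ ⟨y', hy'⟩ + (δ : K) • (⟨z, hz⟩ ⊗ₜ ⟨z', hz'⟩),
        ⟨y, hy⟩ ⊗ₜ ⟨z', hz'⟩ + ⟨z, hz⟩ ⊗ₜ ⟨y', hy'⟩, ?_⟩
      have h1 : Matrix.kroneckerAlgEquiv n n L ((y + s • z) ⊗ₜ (y' + s • z')) =
          (y + s • z) ⊗ₖ (y' + s • z') := by
        simp
      rw [h1, map_add, map_add, map_smul, hf, hf, hf, hf, ← algebraMap_smul L (δ : K), ← hδ]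
      simp only [Matrix.add_kronecker, Matrix.kronecker_add, Matrix.smul_kronecker,
        Matrix.kronecker_smul, smul_smul, smul_add, sq]
      abel
  let g : twistedForm σ P ⊗[K] twistedForm σ P →ₐ[K] twistedForm σ (P ⊗ₖ P) :=
    f.codRestrict _ hmem
  have hsurj : Function.Surjective g := by
    rintro ⟨z, hz⟩
    obtain ⟨a, b, h⟩ := hall z
    refine ⟨a, Subtype.ext ?_⟩
    have h1 : (f a - z) + s • f b = 0 := by rw [h]; abel
    exact sub_eq_zero.1
      (hP.kronecker.eq_zero_of_add hσ hs0 hs (sub_mem (hmem a) hz) (hmem b) h1).1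
  have hdim : Module.finrank K (twistedForm σ P ⊗[K] twistedForm σ P) =
      Module.finrank K (twistedForm σ (P ⊗ₖ P)) := by
    rw [Module.finrank_tensorProduct, hP.finrank_twistedForm hσ,
      hP.kronecker.finrank_twistedForm hσ, Fintype.card_prod]
    ring
  have hinj : Function.Injective g :=
    (LinearMap.injective_iff_surjective_of_finrank_eq_finrank (K := K)
      (V := twistedForm σ P ⊗[K] twistedForm σ P) (V₂ := twistedForm σ (P ⊗ₖ P)) hdim
      (f := g)).2 hsurj
  exact ⟨AlgEquiv.ofBijective g ⟨hinj, hsurj⟩⟩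

/-- `P ⊗ P` has square `c²`, as does the scalar matrix `c`, whose twisted form is a matrix algebra
over `K`; equal squares give isomorphic forms. -/
theorem isInBrTwo [Nonempty n] (hσ : IsConjugation σ) (hP : IsTwist σ P c) :
    IsInBrTwo K L (twistedForm σ P) := by
  refine ⟨hP.isCentralSimple hσ, ?_, BrauerEquiv.of_algEquiv_matrix (hP.baseChangeEquiv hσ)⟩
  obtain ⟨e⟩ := hP.nonempty_tensor_equiv hσ
  have hc : IsTwist σ (algebraMap K (Matrix (n × n) (n × n) L) c) (c * c) := by
    rw [IsTwist, AlgEquiv.commutes, ← map_mul, Units.val_mul]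
  obtain ⟨e'⟩ := nonempty_equiv hσ hP.kronecker hc rfl
  obtain ⟨e''⟩ := nonempty_equiv_matrix (n := n × n) hσ c
  exact BrauerEquiv.of_algEquiv_matrix (e.trans (e'.trans e''.symm))

/-- Extended to `M_n(L)`, `φ` becomes conjugation by some `X` (Skolem–Noether). Then `Z = X⁻¹ P'
σ(X)` has square `c'` and acts on the first twisted form as `P` does, so it is a scalar multiple of
`P`; comparing squares gives the norm. -/
theorem exists_norm_of_equiv [Nonempty n] {P' : Matrix n n L} {c' : Kˣ} (hσ : IsConjugation σ)
    (hP : IsTwist σ P c) (hP' : IsTwist σ P' c') (φ : twistedForm σ P ≃ₐ[K] twistedForm σ P') :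
    ∃ x : L, algebraMap K L c' = algebraMap K L c * (x * σ x) := by
  let Φ : Matrix n n L ≃ₐ[L] Matrix n n L := (hP.baseChangeEquiv hσ).symm.trans
    ((Algebra.TensorProduct.congr AlgEquiv.refl φ).trans (hP'.baseChangeEquiv hσ))
  have hΦ : ∀ x : twistedForm σ P, Φ x = φ x := by
    intro x
    have h1 : (hP.baseChangeEquiv hσ).symm (x : Matrix n n L) = 1 ⊗ₜ x := by
      rw [AlgEquiv.symm_apply_eq, baseChangeEquiv_tmul, one_smul]
    change hP'.baseChangeEquiv hσ (Algebra.TensorProduct.congr AlgEquiv.refl φ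
      ((hP.baseChangeEquiv hσ).symm x)) = _
    rw [h1, Algebra.TensorProduct.congr_apply, Algebra.TensorProduct.map_tmul]
    change hP'.baseChangeEquiv hσ (1 ⊗ₜ φ x) = _
    rw [baseChangeEquiv_tmul, one_smul]
  obtain ⟨T, hT⟩ := ((Matrix.toLinAlgEquiv' (R := L) (n := n)).symm.trans
    (Φ.trans Matrix.toLinAlgEquiv')).eq_linearEquivConjAlgEquiv
  obtain ⟨X, Y, hXY, hYX, hX⟩ : ∃ X Y : Matrix n n L, X * Y = 1 ∧ Y * X = 1 ∧
      ∀ A, Φ A = X * A * Y := by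
    refine ⟨LinearMap.toMatrixAlgEquiv' T.toLinearMap, LinearMap.toMatrixAlgEquiv' T.symm.toLinearMap,
      ?_, ?_, fun A => ?_⟩
    · rw [← map_mul]
      convert map_one (LinearMap.toMatrixAlgEquiv' (R := L) (n := n))
      exact LinearMap.ext T.apply_symm_apply
    · rw [← map_mul]
      convert map_one (LinearMap.toMatrixAlgEquiv' (R := L) (n := n))
      exact LinearMap.ext T.symm_apply_apply
    · have h1 := DFunLike.congr_fun hT (Matrix.toLinAlgEquiv' A)
      have h2 : Matrix.toLinAlgEquiv' (Φ A) = T.conjAlgEquiv L (Matrix.toLinAlgEquiv' A) := by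
        rw [← h1]
        simp
      apply (Matrix.toLinAlgEquiv' (R := L) (n := n)).injective
      rw [h2, map_mul, map_mul]
      simp only [Matrix.toLinAlgEquiv'_toMatrixAlgEquiv']
      rfl
  obtain ⟨Z, hZdef⟩ : ∃ Z, Z = Y * P' * σ.mapMatrix X := ⟨_, rfl⟩
  have hZ : ∃ a : L, Z * σ.mapMatrix P = a • 1 := by
    refine hP.commute_all hσ fun y hy => ?_
    have h1 := (φ ⟨y, hy⟩).2
    rw [mem_twistedForm, ← hΦ, hX, map_mul, map_mul] at h1
    have h2 := congrArg (fun A => Y * A * σ.mapMatrix X) h1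
    have h3 : σ.mapMatrix Y * σ.mapMatrix X = 1 := by rw [← map_mul, hYX, map_one]
    have h4 : y * Z = Z * σ.mapMatrix y := by
      calc y * Z = Y * X * y * (Y * P' * σ.mapMatrix X) := by rw [hYX, one_mul, hZdef]
        _ = Y * (X * y * Y * P') * σ.mapMatrix X := by simp only [mul_assoc]
        _ = _ := h2
        _ = Z * σ.mapMatrix y * (σ.mapMatrix Y * σ.mapMatrix X) := by
          simp only [hZdef, mul_assoc]
        _ = _ := by rw [h3, mul_one]
    have h5 : σ.mapMatrix y * σ.mapMatrix P = σ.mapMatrix P * y := by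
      have := congrArg σ.mapMatrix (mem_twistedForm.1 hy)
      rw [map_mul, map_mul] at this
      rw [this]
      congr 1
      ext i j
      simp [hσ.involutive]
    rw [← mul_assoc, h4, mul_assoc, ← h5, mul_assoc]
  obtain ⟨a, ha⟩ := hZ
  -- Since `σ(P) P = c`, this says `Z = (a / c) P`, and the norm of `a / c` will be `c' / c`.
  have hZ' : Z * algebraMap K (Matrix n n L) c = a • P := by
    rw [← hP.mapMatrix_mul hσ, ← mul_assoc, ha, smul_mul_assoc, one_mul]
  have hZZ : Z * σ.mapMatrix Z = algebraMap K (Matrix n n L) c' := by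
    have h2 : σ.mapMatrix (σ.mapMatrix X) = X := by ext i j; simp [hσ.involutive]
    have h3 : σ.mapMatrix X * σ.mapMatrix Y = 1 := by rw [← map_mul, hXY, map_one]
    calc Z * σ.mapMatrix Z
        = Y * P' * (σ.mapMatrix X * σ.mapMatrix Y) * σ.mapMatrix P' * X := by
          simp only [hZdef, map_mul, h2, mul_assoc]
      _ = Y * (P' * σ.mapMatrix P') * X := by rw [h3, mul_one, mul_assoc Y]
      _ = _ := by rw [hP'.eq, ← Algebra.commutes, mul_assoc, hYX, mul_one]
  have h1 : (algebraMap K L (c' * (c * c))) • (1 : Matrix n n L) =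
      (a * σ a * algebraMap K L c) • 1 := by
    have h2 : (Z * algebraMap K (Matrix n n L) c) *
        σ.mapMatrix (Z * algebraMap K (Matrix n n L) c) =
        algebraMap K (Matrix n n L) (c' * (c * c)) := by
      rw [map_mul σ.mapMatrix, AlgEquiv.commutes, mul_assoc, ← mul_assoc (algebraMap K _ _),
        Algebra.commutes, mul_assoc, ← mul_assoc Z, hZZ, ← map_mul, ← map_mul]
    rw [hZ', mapMatrix_smul, smul_mul_smul_comm, hP.smul_one, smul_smul,
      Algebra.algebraMap_eq_smul_one (A := Matrix n n L) (c' * (c * c) : K),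
      ← algebraMap_smul L (c' * (c * c) : K) (1 : Matrix n n L)] at h2
    exact h2.symm
  have h2 : algebraMap K L (c' * (c * c)) = a * σ a * algebraMap K L c := by
    obtain ⟨i⟩ := ‹Nonempty n›
    simpa using congrFun (congrFun h1 i) i
  have hc : algebraMap K L c ≠ 0 := by simp
  refine ⟨a / algebraMap K L c, ?_⟩
  rw [map_div₀, AlgEquiv.commutes]
  rw [map_mul, map_mul] at h2
  field_simp
  apply mul_right_cancel₀ hc
  linear_combination h2

end IsTwist

end Tensor

/-! ### Quaternion algebras as twisted forms -/

section Quaternion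

variable {K L : Type*} [Field K] [Field L] [Algebra K L] {σ : L ≃ₐ[K] L}

variable (L) in
/-- The matrix of the twist `(x, y) ↦ (b σ(y), σ(x))`. -/
def quaternionTwist (b : Kˣ) : Matrix (Fin 2) (Fin 2) L := !![0, algebraMap K L b; 1, 0]

theorem isTwist_quaternionTwist (σ : L ≃ₐ[K] L) (b : Kˣ) : IsTwist σ (quaternionTwist L b) b := by
  rw [IsTwist]
  ext i j
  fin_cases i <;> fin_cases j <;>
    simp [quaternionTwist, Matrix.mul_apply, Fin.sum_univ_two, Matrix.algebraMap_matrix_apply]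

theorem mem_twistedForm_quaternionTwist (b : Kˣ) (hσ : IsConjugation σ)
    (f : Matrix (Fin 2) (Fin 2) L) :
    f ∈ twistedForm σ (quaternionTwist L b) ↔
      ∃ x y : L, f = !![x, algebraMap K L b * y; σ y, σ x] := by
  rw [mem_twistedForm]
  have hb : algebraMap K L b ≠ 0 := by simp
  constructor
  · intro h
    have h00 := congrFun (congrFun h 0) 0
    have h10 := congrFun (congrFun h 1) 0
    simp [quaternionTwist, Matrix.mul_apply, Fin.sum_univ_two] at h00 h10
    refine ⟨f 0 0, σ (f 1 0), ?_⟩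
    ext i j
    fin_cases i <;> fin_cases j <;> simp [h00, h10, hσ.involutive]
  · rintro ⟨x, y, rfl⟩
    ext i j
    fin_cases i <;> fin_cases j <;>
      simp [quaternionTwist, Matrix.mul_apply, Fin.sum_univ_two, hσ.involutive, mul_comm]

/-- The regular representation of a quaternion algebra over a splitting field. -/
def quaternionBasis (s : L) (δ b : Kˣ) (h : s ^ 2 = algebraMap K L δ) :
    QuaternionAlgebra.Basis (Matrix (Fin 2) (Fin 2) L) (δ : K) 0 (b : K) where
  i := !![s, 0; 0, -s]
  j := quaternionTwist L b
  k := !![0, algebraMap K L b * s; -s, 0]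
  i_mul_i := by
    ext i j
    fin_cases i <;> fin_cases j <;>
      simp [Matrix.mul_apply, Fin.sum_univ_two, ← sq, h, Algebra.smul_def,
        Matrix.algebraMap_matrix_apply]
  j_mul_j := by
    ext i j
    fin_cases i <;> fin_cases j <;>
      simp [quaternionTwist, Matrix.mul_apply, Fin.sum_univ_two, Algebra.smul_def,
        Matrix.algebraMap_matrix_apply]
  i_mul_j := by
    ext i j
    fin_cases i <;> fin_cases j <;>
      simp [quaternionTwist, Matrix.mul_apply, Fin.sum_univ_two, mul_comm]
  j_mul_i := by
    ext i j
    fin_cases i <;> fin_cases j <;>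
      simp [quaternionTwist, Matrix.mul_apply, Fin.sum_univ_two]

variable [CharZero K]

/-- The elements of the twisted form are the matrices with rows `(x, b y)` and `(σ y, σ x)`; the
coordinates of `x` and `y` in the `K`-basis `1, s` are the four coefficients of a quaternion. -/
theorem nonempty_quaternion_equiv (hσ : IsConjugation σ) {s : L} (hs0 : s ≠ 0) (hs : σ s = -s)
    {δ : Kˣ} (h : s ^ 2 = algebraMap K L δ) (b : Kˣ) :
    Nonempty (QuaternionAlgebra K (δ : K) 0 (b : K) ≃ₐ[K] twistedForm σ (quaternionTwist L b)) := by
  have hb : algebraMap K L b ≠ 0 := by simp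
  have hf : ∀ q : QuaternionAlgebra K (δ : K) 0 (b : K), (quaternionBasis s δ b h).liftHom q =
      !![algebraMap K L q.re + algebraMap K L q.imI * s,
        algebraMap K L b * (algebraMap K L q.imJ + algebraMap K L q.imK * s);
        σ (algebraMap K L q.imJ + algebraMap K L q.imK * s),
        σ (algebraMap K L q.re + algebraMap K L q.imI * s)] := by
    intro q
    have hsmul : ∀ (k : K) (x : L), k • x = algebraMap K L k * x := Algebra.smul_def
    change (quaternionBasis s δ b h).lift q = _
    ext i j
    fin_cases i <;> fin_cases j <;>
      simp [QuaternionAlgebra.Basis.lift, quaternionBasis, quaternionTwist, hs, hsmul,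
        Matrix.algebraMap_matrix_apply] <;> ring
  have hinj : Function.Injective (quaternionBasis s δ b h).liftHom := by
    intro p q hpq
    rw [hf, hf] at hpq
    have h00 := congrFun (congrFun hpq 0) 0
    have h01 := congrFun (congrFun hpq 0) 1
    simp only [Matrix.of_apply, Matrix.cons_val', Matrix.cons_val_zero, Matrix.cons_val_one,
      Matrix.cons_val_fin_one, mul_right_inj' hb] at h00 h01
    obtain ⟨h1, h2⟩ := IsConjugation.add_mul_inj hs0 hs h00
    obtain ⟨h3, h4⟩ := IsConjugation.add_mul_inj hs0 hs h01
    exact QuaternionAlgebra.ext h1 h2 h3 h4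
  refine ⟨(AlgEquiv.ofInjective _ hinj).trans (Subalgebra.equivOfEq _ _ ?_)⟩
  ext f
  rw [mem_twistedForm_quaternionTwist b hσ]
  constructor
  · rintro ⟨q, rfl⟩
    exact ⟨_, _, hf q⟩
  · rintro ⟨x, y, rfl⟩
    obtain ⟨a, a', rfl⟩ := hσ.exists_eq_add hs0 hs x
    obtain ⟨d, d', rfl⟩ := hσ.exists_eq_add hs0 hs y
    exact ⟨⟨a, a', d, d'⟩, hf _⟩

/-- Matrix algebras over twisted forms are twisted forms with the same square, and comparing
dimensions makes their sizes agree, so the case of an isomorphism applies. -/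
theorem exists_norm_of_brauerEquiv (hσ : IsConjugation σ) {n n' : Type*} [Fintype n]
    [DecidableEq n] [Nonempty n] [Fintype n'] [DecidableEq n'] [Nonempty n'] {P : Matrix n n L}
    {P' : Matrix n' n' L} {c c' : Kˣ}
    (hP : IsTwist σ P c) (hP' : IsTwist σ P' c')
    (h : BrauerEquiv K (twistedForm σ P) (twistedForm σ P')) :
    ∃ x : L, algebraMap K L c' = algebraMap K L c * (x * σ x) := by
  obtain ⟨k, l, hk, hl, ⟨e⟩⟩ := h
  have : NeZero k := ⟨hk⟩
  have : NeZero l := ⟨hl⟩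
  let e' := (IsTwist.compEquiv σ P (Fin k)).symm.trans (e.trans (IsTwist.compEquiv σ P' (Fin l)))
  have hcard : Fintype.card (Fin k × n) = Fintype.card (Fin l × n') := by
    have := e'.toLinearEquiv.finrank_eq
    rw [(hP.comp (Fin k)).finrank_twistedForm hσ, (hP'.comp (Fin l)).finrank_twistedForm hσ] at this
    exact Nat.pow_left_injective two_ne_zero this
  exact IsTwist.exists_norm_of_equiv hσ (hP.comp (Fin k))
    ((hP'.comp (Fin l)).reindex (Fintype.equivOfCardEq hcard.symm))
    (e'.trans (IsTwist.reindexEquiv _))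

/-- The `L`-discriminant of an algebra Brauer equivalent to a twisted form. -/
theorem hasLDisc_of_brauerEquiv {D : Type*} [Ring D] [Algebra K D] (hσ : IsConjugation σ)
    {n : Type*} [Fintype n] [DecidableEq n] [Nonempty n] {P : Matrix n n L} {c : Kˣ}
    (hP : IsTwist σ P c) (h : BrauerEquiv K D (twistedForm σ P)) :
    HasLDisc K L D (QuotientGroup.mk c) := by
  have key : ∀ {s : L}, s ≠ 0 → σ s = -s → ∀ {δ : Kˣ}, s ^ 2 = algebraMap K L δ → ∀ b : Kˣ,
      BrauerEquiv K (QuaternionAlgebra K (δ : K) 0 (b : K))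
        (twistedForm σ (quaternionTwist L b)) := by
    intro s hs0 hs δ hδ b
    obtain ⟨e⟩ := nonempty_quaternion_equiv hσ hs0 hs hδ b
    exact BrauerEquiv.of_algEquiv e
  refine ⟨⟨c, ?_⟩, ?_⟩
  · obtain ⟨s, hs0, hs⟩ := hσ.exists_skew
    obtain ⟨δ, hδ⟩ := hσ.exists_sq hs0 hs
    exact ⟨δ, hσ.isQuadraticGenerator hs0 hs hδ, h.trans
      ((hP.brauerEquiv hσ (isTwist_quaternionTwist σ c)).trans (key hs0 hs hδ c).symm)⟩
  · rintro b ⟨δ, hδ, hb⟩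
    obtain ⟨s, hs0, hs, hs2⟩ := IsConjugation.exists_of_isQuadraticGenerator hδ hσ
    rw [hσ.mk_eq_mk_iff]
    exact exists_norm_of_brauerEquiv hσ (isTwist_quaternionTwist σ b) hP
      (((key hs0 hs hs2 b).symm.trans hb.symm).trans h)

end Quaternion

/-! ### Representations with the same character -/

namespace Representation

variable {F G V W : Type*} [Field F] [Group G] [AddCommGroup V] [Module F V] [AddCommGroup W]
  [Module F W]

theorem isCompl_toSubmodule {ρ : Representation F G V} {p q : Subrepresentation ρ}
    (h : IsCompl p q) : IsCompl p.toSubmodule q.toSubmodule := by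
  constructor
  · rw [disjoint_iff, ← Subrepresentation.toSubmodule_inf, h.inf_eq_bot]
    rfl
  · rw [codisjoint_iff, ← Subrepresentation.toSubmodule_sup, h.sup_eq_top]
    rfl

/-- A representation is the sum of complementary subrepresentations. -/
def prodEquivOfIsCompl {ρ : Representation F G V} {p q : Subrepresentation ρ} (h : IsCompl p q) :
    (p.toRepresentation.prod q.toRepresentation).Equiv ρ :=
  Equiv.mk (Submodule.prodEquivOfIsCompl _ _ (isCompl_toSubmodule h)) fun g => by
    exact LinearMap.ext fun x => (map_add (ρ g) (x.1 : V) (x.2 : V)).symm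

variable [FiniteDimensional F V] [FiniteDimensional F W]

theorem char_prod (ρ : Representation F G V) (τ : Representation F G W) (g : G) :
    (ρ.prod τ).character g = ρ.character g + τ.character g :=
  LinearMap.trace_prodMap' (ρ g) (τ g)

variable [CharZero F] [Finite G]

/-- By the orthogonality relations this dimension is an inner product of characters. -/
theorem finrank_intertwiningMap_congr {U : Type*} [AddCommGroup U] [Module F U]
    [FiniteDimensional F U] (θ : Representation F G U) (ρ : Representation F G V)
    (τ : Representation F G W) (h : ρ.character = τ.character) :
    Module.finrank F (IntertwiningMap θ ρ) = Module.finrank F (IntertwiningMap θ τ) := by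
  have := Fintype.ofFinite G
  have : Invertible (Nat.card G : F) :=
    invertibleOfNonzero (by exact_mod_cast Nat.card_pos.ne')
  have h1 := card_inv_mul_sum_char_mul_char_eq_finrank θ ρ
  rw [h, card_inv_mul_sum_char_mul_char_eq_finrank θ τ] at h1
  exact_mod_cast h1.symm

/-- Finite-dimensional representations of a finite group over a field of characteristic zero with
the same character are isomorphic. -/
theorem nonempty_equiv_of_character_eq (ρ : Representation F G V) (τ : Representation F G W)
    (h : ρ.character = τ.character) : Nonempty (ρ.Equiv τ) := by
  have hcard : NeZero (Nat.card G : F) := ⟨by exact_mod_cast Nat.card_pos.ne'⟩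
  induction hn : Module.finrank F V using Nat.strong_induction_on generalizing V W with
  | _ n ih =>
  have hfr : Module.finrank F V = Module.finrank F W := by
    have := congrFun h 1
    rw [char_one, char_one] at this
    exact_mod_cast this
  by_cases hn0 : n = 0
  · have := Module.finrank_zero_iff.1 (hn.trans hn0)
    have := Module.finrank_zero_iff.1 (hfr.symm.trans (hn.trans hn0))
    exact ⟨Equiv.mk (LinearEquiv.ofBijective 0
      ⟨fun _ _ _ => Subsingleton.elim _ _, fun _ => ⟨0, Subsingleton.elim _ _⟩⟩)
      fun _ => LinearMap.ext fun _ => Subsingleton.elim _ _⟩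
  have hV : Nontrivial V := Module.nontrivial_of_finrank_pos (R := F) (by omega)
  -- `Hom(ρ, τ)` has the same dimension as `End(ρ)`, which contains the nonzero identity.
  obtain ⟨f, hf⟩ : ∃ f : IntertwiningMap ρ τ, f ≠ 0 := by
    by_contra! h0
    have h1 : Module.finrank F (IntertwiningMap ρ τ) = 0 := by
      have : Subsingleton (IntertwiningMap ρ τ) := ⟨fun a b => by rw [h0 a, h0 b]⟩
      exact Module.finrank_zero_of_subsingleton
    rw [← finrank_intertwiningMap_congr ρ ρ τ h] at h1
    have : FiniteDimensional F (IntertwiningMap ρ ρ) :=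
      Module.Finite.of_injective (IntertwiningMap.toLinearMapl ρ ρ)
        (IntertwiningMap.toLinearMap_injective ρ ρ)
    have h2 := Module.finrank_zero_iff.1 h1
    obtain ⟨v, hv⟩ := exists_ne (0 : V)
    have h3 : IntertwiningMap.id ρ = 0 := Subsingleton.elim _ _
    exact hv (congrArg (fun f : IntertwiningMap ρ ρ => f v) h3)
  -- By Maschke, `V = ker f ⊕ V2` and `W = range f ⊕ W1`, where `V2 ≅ range f`. So `ker f` and `W1`
  -- have equal characters, and `ker f` is smaller than `V` because `f ≠ 0`.
  obtain ⟨V2, hV2⟩ := exists_isCompl f.ker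
  obtain ⟨W1, hW1⟩ := exists_isCompl f.range
  let eV := prodEquivOfIsCompl hV2
  let eW := prodEquivOfIsCompl hW1
  let g : V2.toSubmodule →ₗ[F] f.range.toSubmodule :=
    (f.toLinearMap.rangeRestrict).comp V2.toSubmodule.subtype
  have hg : Function.Bijective g := by
    have hc := isCompl_toSubmodule hV2
    constructor
    · rw [← LinearMap.ker_eq_bot, LinearMap.ker_eq_bot']
      intro x hx
      have h1 : f.toLinearMap x = 0 := congrArg Subtype.val hx
      have h2 := Submodule.disjoint_def.1 hc.disjoint x (LinearMap.mem_ker.2 h1) x.2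
      exact Subtype.ext h2
    · rintro ⟨_, x, rfl⟩
      obtain ⟨y, hy, z, hz, rfl⟩ := Submodule.mem_sup.1
        (hc.sup_eq_top ▸ (Submodule.mem_top : x ∈ (⊤ : Submodule F V)))
      refine ⟨⟨z, hz⟩, Subtype.ext ?_⟩
      have h1 : f.toLinearMap y = 0 := hy
      change f.toLinearMap z = f.toLinearMap (y + z)
      rw [map_add, h1, zero_add]
  let e2 : V2.toRepresentation.Equiv f.range.toRepresentation :=
    Equiv.mk (LinearEquiv.ofBijective g hg) fun k => LinearMap.ext fun x =>
      Subtype.ext (f.isIntertwining _ _ k x)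
  have hchar : f.ker.toRepresentation.character = W1.toRepresentation.character := by
    funext k
    have h1 := congrFun h k
    rw [← char_iso eV, ← char_iso eW, char_prod, char_prod, char_iso e2, add_comm] at h1
    exact add_left_cancel h1
  have hlt : Module.finrank F f.ker.toSubmodule < n := by
    rw [← hn]
    refine Submodule.finrank_lt fun htop => hf ?_
    refine IntertwiningMap.ext ?_
    exact LinearMap.ker_eq_top.1 htop
  obtain ⟨e1⟩ := ih _ hlt f.ker.toRepresentation W1.toRepresentation hchar rfl
  let e : (f.ker.toRepresentation.prod V2.toRepresentation).Equiv
      (f.range.toRepresentation.prod W1.toRepresentation) :=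
    Equiv.mk ((LinearEquiv.prodCongr e1.toLinearEquiv e2.toLinearEquiv).trans
      (LinearEquiv.prodComm F _ _)) fun k => by
      refine LinearMap.ext fun x => Prod.ext ?_ ?_
      · exact e2.toIntertwiningMap.isIntertwining _ _ k x.2
      · exact e1.toIntertwiningMap.isIntertwining _ _ k x.1
  exact ⟨(eV.symm.trans e).trans eW⟩

end Representation

/-! ### The span of an absolutely irreducible matrix representation -/

section Span

variable {F G n : Type*} [Field F] [CharZero F] [Group G] [Fintype G] [Fintype n] [DecidableEq n]
  (R : G →* Matrix n n F)

/-- The commutant of a matrix representation consists of the scalar matrices. -/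
def HasScalarCommutant : Prop :=
  ∀ T : Matrix n n F, (∀ g, T * R g = R g * T) → ∃ l : F, T = l • 1

variable {R}

theorem map_inv_mul_map (g : G) : R g⁻¹ * R g = 1 := by
  rw [← map_mul, inv_mul_cancel, map_one]

theorem map_mul_map_inv (g : G) : R g * R g⁻¹ = 1 := by
  rw [← map_mul, mul_inv_cancel, map_one]

/-- The average of the conjugates of a matrix is a scalar matrix. -/
theorem sum_conj_eq [Nonempty n] (hR : HasScalarCommutant R) (A : Matrix n n F) :
    ∑ g, R g * A * R g⁻¹ = ((Fintype.card G : F) / Fintype.card n * A.trace) • 1 := by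
  obtain ⟨l, hl⟩ := hR (∑ g, R g * A * R g⁻¹) (by
    intro h
    rw [Finset.sum_mul, Finset.mul_sum]
    refine Fintype.sum_equiv (Equiv.mulLeft h⁻¹) _ _ fun g => ?_
    simp only [Equiv.coe_mulLeft, map_mul, mul_inv_rev, inv_inv, ← mul_assoc, map_mul_map_inv,
      one_mul])
  have h1 := congrArg Matrix.trace hl
  rw [Matrix.trace_sum, Matrix.trace_smul, Matrix.trace_one, smul_eq_mul] at h1
  have h2 : ∀ g, (R g * A * R g⁻¹).trace = A.trace := fun g => by
    rw [Matrix.trace_mul_cycle, map_inv_mul_map, one_mul]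
  simp only [h2, Finset.sum_const, Finset.card_univ, nsmul_eq_mul] at h1
  have hn : (Fintype.card n : F) ≠ 0 := by exact_mod_cast Fintype.card_ne_zero
  rw [hl]
  congr 1
  field_simp
  linear_combination -h1

/-- Fourier inversion for an absolutely irreducible matrix representation. -/
theorem sum_trace_smul [Nonempty n] (hR : HasScalarCommutant R) (T : Matrix n n F) :
    ∑ g, (T * R g).trace • R g⁻¹ = ((Fintype.card G : F) / Fintype.card n) • T := by
  have h1 : ∀ i j k l, ∑ g, R g i j * R g⁻¹ k l =
      if j = k ∧ i = l then (Fintype.card G : F) / Fintype.card n else 0 := by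
    intro i j k l
    have h := congrFun (congrFun (sum_conj_eq hR (Matrix.single j k (1 : F))) i) l
    have h2 : ∀ g, (R g * Matrix.single j k (1 : F) * R g⁻¹ : Matrix n n F) i l = R g i j * R g⁻¹ k l := by
      intro g
      rw [Matrix.mul_apply, Finset.sum_eq_single k]
      · simp
      · intro b _ hb
        simp [hb]
      · simp
    rw [Matrix.sum_apply] at h
    simp only [h2] at h
    rw [h]
    by_cases hjk : j = k <;> by_cases hil : i = l <;> simp [hjk, hil]
  ext k l
  rw [Matrix.sum_apply]
  simp only [Matrix.smul_apply, smul_eq_mul, Matrix.trace, Matrix.diag_apply, Matrix.mul_apply,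
    Finset.sum_mul]
  rw [Finset.sum_comm]
  have h3 : ∀ j i, ∑ g, T j i * R g i j * R g⁻¹ k l =
      if j = k ∧ i = l then T j i * ((Fintype.card G : F) / Fintype.card n) else 0 := by
    intro j i
    simp only [mul_assoc, ← Finset.mul_sum, h1]
    split_ifs <;> simp
  have h4 : ∀ j, ∑ g, ∑ i, T j i * R g i j * R g⁻¹ k l =
      if j = k then T j l * ((Fintype.card G : F) / Fintype.card n) else 0 := by
    intro j
    rw [Finset.sum_comm]
    simp only [h3]
    by_cases hjk : j = k <;> simp [hjk]
  simp only [h4]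
  simp [mul_comm]

theorem span_range_eq_top [Nonempty n] (hR : HasScalarCommutant R) :
    Submodule.span F (Set.range R) = ⊤ := by
  rw [eq_top_iff]
  intro T _
  have hn : (Fintype.card n : F) ≠ 0 := by exact_mod_cast Fintype.card_ne_zero
  have hG : (Fintype.card G : F) ≠ 0 := by exact_mod_cast Fintype.card_ne_zero
  have h1 : T = ((Fintype.card n : F) / Fintype.card G) • ∑ g, (T * R g).trace • R g⁻¹ := by
    rw [sum_trace_smul hR, smul_smul]
    field_simp
    rw [one_smul]
  rw [h1]
  exact Submodule.smul_mem _ _ (Submodule.sum_mem _ fun g _ =>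
    Submodule.smul_mem _ _ (Submodule.subset_span ⟨_, rfl⟩))

variable {K : Type*} [Field K] [Algebra K F] [CharZero K] {σ : F ≃ₐ[K] F}

/-- The span over the smaller field, if the character is not invariant under conjugation. -/
theorem span_range_eq_top_of_conj [Nonempty n] (hR : HasScalarCommutant R) (hσ : IsConjugation σ)
    {g₀ : G} (hg₀ : σ (R g₀).trace ≠ (R g₀).trace) :
    Submodule.span K (Set.range R) = ⊤ := by
  set x₀ := (R g₀).trace
  have hn : (Fintype.card n : K) ≠ 0 := by exact_mod_cast Fintype.card_ne_zero
  have hG : (Fintype.card G : K) ≠ 0 := by exact_mod_cast Fintype.card_ne_zero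
  let S : Submodule K (Matrix n n F) := Submodule.span K (Set.range R)
  -- The sum of the conjugates of `R g₀` lies in the `K`-span and is a rational multiple of the
  -- scalar `x₀`. As the larger field is `K + K x₀`, the `K`-span is stable under all its scalars.
  have h1 : x₀ • (1 : Matrix n n F) ∈ S := by
    have h2 : x₀ • (1 : Matrix n n F) =
        ((Fintype.card n : K) / Fintype.card G) • ∑ g, R g * R g₀ * R g⁻¹ := by
      rw [sum_conj_eq hR, ← algebraMap_smul F ((Fintype.card n : K) / Fintype.card G), smul_smul]
      congr 1
      have hn' : (Fintype.card n : F) ≠ 0 := by exact_mod_cast Fintype.card_ne_zero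
      have hG' : (Fintype.card G : F) ≠ 0 := by exact_mod_cast Fintype.card_ne_zero
      rw [map_div₀, map_natCast, map_natCast]
      field_simp
      rfl
    rw [h2]
    refine Submodule.smul_mem _ _ (Submodule.sum_mem _ fun g _ => Submodule.subset_span ?_)
    exact ⟨g * g₀ * g⁻¹, by rw [map_mul, map_mul]⟩
  have h2 : ∀ x : F, ∃ a b : K, x = algebraMap K F a + algebraMap K F b * x₀ := by
    intro x
    have hs0 : x₀ - σ x₀ ≠ 0 := sub_ne_zero.2 (Ne.symm hg₀)
    have hs : σ (x₀ - σ x₀) = -(x₀ - σ x₀) := by simp [hσ.involutive]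
    obtain ⟨a, b, hx⟩ := hσ.exists_eq_add hs0 hs x
    obtain ⟨t, ht⟩ := hσ.fixed (x₀ + σ x₀) (by rw [map_add, hσ.involutive, add_comm])
    refine ⟨a - b * t, 2 * b, ?_⟩
    rw [hx]
    simp only [map_sub, map_mul, ht, map_ofNat]
    ring
  have h3 : ∀ A ∈ S, ∀ g, A * R g ∈ S := by
    intro A hA g
    induction hA using Submodule.span_induction with
    | mem A hA =>
      obtain ⟨k, rfl⟩ := hA
      rw [← map_mul]
      exact Submodule.subset_span ⟨_, rfl⟩
    | zero => rw [zero_mul]; exact S.zero_mem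
    | add A B _ _ hA hB => rw [add_mul]; exact S.add_mem hA hB
    | smul c A _ hA => rw [smul_mul_assoc]; exact S.smul_mem _ hA
  have h4 : ∀ A ∈ S, x₀ • A ∈ S := by
    intro A hA
    induction hA using Submodule.span_induction with
    | mem A hA =>
      obtain ⟨g, rfl⟩ := hA
      have := h3 _ h1 g
      rwa [smul_mul_assoc, one_mul] at this
    | zero => rw [smul_zero]; exact S.zero_mem
    | add A B _ _ hA hB => rw [smul_add]; exact S.add_mem hA hB
    | smul c A _ hA => rw [smul_comm]; exact S.smul_mem _ hA
  rw [eq_top_iff]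
  intro T _
  have hT : T ∈ Submodule.span F (Set.range R) := span_range_eq_top hR ▸ Submodule.mem_top
  induction hT using Submodule.span_induction with
  | mem A hA => exact Submodule.subset_span hA
  | zero => exact S.zero_mem
  | add A B _ _ hA hB => exact S.add_mem (hA trivial) (hB trivial)
  | smul c A _ hA =>
    obtain ⟨a, b, rfl⟩ := h2 c
    have hA' : A ∈ S := hA trivial
    rw [add_smul, mul_smul, algebraMap_smul, algebraMap_smul]
    exact S.add_mem (S.smul_mem _ hA') (S.smul_mem _ (h4 A hA'))

end Span

/-! ### Hermitian matrices and twisted forms -/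

section Alternating

variable {F : Type*} [Field F]

/-- The space of the `a` such that `M a` is skew-symmetric. -/
def skewSubmodule {n : Type*} [Fintype n] (M : Matrix n n F) : Submodule F (Matrix n n F) where
  carrier := {a | (M * a).transpose = -(M * a)}
  add_mem' := by
    intro a b ha hb
    simp only [Set.mem_ofPred_eq] at *
    rw [mul_add, Matrix.transpose_add, ha, hb, neg_add]
  zero_mem' := by simp
  smul_mem' := by
    intro c a ha
    simp only [Set.mem_ofPred_eq] at *
    rw [mul_smul_comm, Matrix.transpose_smul, ha, smul_neg]

theorem mem_skewSubmodule {n : Type*} [Fintype n] {M a : Matrix n n F} :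
    a ∈ skewSubmodule M ↔ (M * a).transpose = -(M * a) := Iff.rfl

/-- A skew-symmetric matrix is determined by its entries below the diagonal. -/
def skewEntries [CharZero F] (n : ℕ) :
    skewSubmodule (1 : Matrix (Fin n) (Fin n) F) ≃ₗ[F] ((Σ i : Fin n, Fin i) → F) :=
  LinearEquiv.ofBijective
    { toFun := fun (a : skewSubmodule (1 : Matrix (Fin n) (Fin n) F)) (p : Σ i : Fin n, Fin i) =>
        (a : Matrix (Fin n) (Fin n) F) p.1 (p.2.castLE p.1.2.le)
      map_add' := fun _ _ => rfl
      map_smul' := fun _ _ => rfl }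
    (by
      have hskew : ∀ a : skewSubmodule (1 : Matrix (Fin n) (Fin n) F), ∀ i j,
          (a : Matrix (Fin n) (Fin n) F) j i = -(a : Matrix (Fin n) (Fin n) F) i j := by
        intro a i j
        have h := mem_skewSubmodule.1 a.2
        rw [one_mul] at h
        exact congrFun (congrFun h i) j
      constructor
      · rw [← LinearMap.ker_eq_bot, LinearMap.ker_eq_bot']
        intro a ha
        have h1 : ∀ i j : Fin n, j < i → (a : Matrix (Fin n) (Fin n) F) i j = 0 :=
          fun i j hij => congrFun ha ⟨i, ⟨j, hij⟩⟩
        refine Subtype.ext (Matrix.ext fun i j => ?_)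
        rcases lt_trichotomy i j with h | rfl | h
        · rw [hskew, h1 _ _ h]
          simp
        · have := hskew a i i
          exact self_eq_neg.1 this
        · exact h1 _ _ h
      · intro f
        refine ⟨⟨Matrix.of fun i j => if h : j < i then f ⟨i, ⟨j, h⟩⟩ else
          if h : i < j then -f ⟨j, ⟨i, h⟩⟩ else 0, ?_⟩, ?_⟩
        · rw [mem_skewSubmodule, one_mul]
          ext i j
          rcases lt_trichotomy i j with h | rfl | h
          · simp [h, h.not_gt]
          · simp
          · simp [h, h.not_gt]
        · funext ⟨i, j⟩
          have : j.castLE i.2.le < i := j.2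
          change (if h : j.castLE i.2.le < i then _ else _) = _
          rw [dif_pos this]
          rfl)

/-- Multiplication by the invertible `M` reduces the count to the skew-symmetric matrices
themselves. -/
theorem finrank_skewSubmodule [CharZero F] {n : ℕ} {M : Matrix (Fin n) (Fin n) F}
    (hM : IsUnit M.det) : Module.finrank F (skewSubmodule M) = n * (n - 1) / 2 := by
  have hMu : M * M⁻¹ = 1 := Matrix.mul_nonsing_inv _ hM
  have hMu' : M⁻¹ * M = 1 := Matrix.nonsing_inv_mul _ hM
  let e : skewSubmodule M ≃ₗ[F] skewSubmodule (1 : Matrix (Fin n) (Fin n) F) :=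
    { toFun := fun a => ⟨M * a, by rw [mem_skewSubmodule, one_mul]; exact mem_skewSubmodule.1 a.2⟩
      invFun := fun a => ⟨M⁻¹ * a, by
        have := mem_skewSubmodule.1 a.2
        rwa [mem_skewSubmodule, ← mul_assoc, hMu]⟩
      left_inv := fun a => Subtype.ext (by
        change M⁻¹ * (M * (a : Matrix (Fin n) (Fin n) F)) = a
        rw [← mul_assoc, hMu', one_mul])
      right_inv := fun a => Subtype.ext (by
        change M * (M⁻¹ * (a : Matrix (Fin n) (Fin n) F)) = a
        rw [← mul_assoc, hMu, one_mul])
      map_add' := fun a b => Subtype.ext (mul_add _ _ _)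
      map_smul' := fun c a => Subtype.ext (mul_smul_comm _ _ _) }
  rw [(e.trans (skewEntries n)).finrank_eq, Module.finrank_fintype_fun_eq_card, Fintype.card_sigma]
  simp only [Fintype.card_fin]
  rw [Fin.sum_univ_eq_sum_range (fun i => i), Finset.sum_range_id]

end Alternating

/-! ### Determinants of Hermitian matrices via Pfaffians -/

namespace IsTwist

variable {K L : Type*} [Field K] [Field L] [Algebra K L] [CharZero K] {σ : L ≃ₐ[K] L}
  {n : Type*} [Fintype n] [DecidableEq n] {P h : Matrix n n L} {c : Kˣ} {m : ℕ}

theorem mapMatrix_mapMatrix (hσ : IsConjugation σ) (f : Matrix n n L) :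
    σ.mapMatrix (σ.mapMatrix f) = f := by
  ext i j
  simp [hσ.involutive]

theorem transpose_mapMatrix (f : Matrix n n L) :
    (σ.mapMatrix f).transpose = σ.mapMatrix f.transpose := rfl

theorem det_mapMatrix (f : Matrix n n L) : (σ.mapMatrix f).det = σ f.det :=
  (AlgHom.map_det (σ : L →ₐ[K] L) f).symm

theorem det_mul_det (hP : IsTwist σ P c) :
    P.det * σ P.det = algebraMap K L c ^ Fintype.card n := by
  have := congrArg Matrix.det hP.smul_one
  rwa [Matrix.det_mul, det_mapMatrix, Matrix.det_smul, Matrix.det_one, mul_one] at this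

theorem algebraMap_ne_zero (L : Type*) [Field L] [Algebra K L] (c : Kˣ) : algebraMap K L c ≠ 0 :=
  (map_ne_zero _).2 c.ne_zero

theorem det_ne_zero (hP : IsTwist σ P c) : P.det ≠ 0 := by
  have h1 := hP.det_mul_det
  have h2 := pow_ne_zero (Fintype.card n) (algebraMap_ne_zero L c)
  intro h0
  rw [h0, zero_mul] at h1
  exact h2 h1.symm

/-- With `M = h σ(P)` this reads `σ(P)ᵀ σ(M) σ(P) = c Mᵀ`; it follows from `σ(M) = σ(h) P`, `P σ(P)
= c` and `σ(h) = hᵀ`. Its Pfaffian yields both discriminant formulas. -/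
theorem transpose_mul_mul (hσ : IsConjugation σ) (hP : IsTwist σ P c)
    (hh : h.transpose = σ.mapMatrix h) :
    (σ.mapMatrix P).transpose * σ.mapMatrix (h * σ.mapMatrix P) * σ.mapMatrix P =
      algebraMap K L c • (h * σ.mapMatrix P).transpose := by
  rw [map_mul, mapMatrix_mapMatrix hσ, mul_assoc, mul_assoc, hP.smul_one, Matrix.transpose_mul, hh,
    mul_smul_comm, mul_one, mul_smul_comm]

/-- `a` and `σ(a)` are conjugate under `P`, so the determinant is `σ`-invariant. -/
theorem exists_algebraMap_eq_det (hσ : IsConjugation σ) (hP : IsTwist σ P c) {a : Matrix n n L}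
    (ha : a ∈ twistedForm σ P) : ∃ r : K, algebraMap K L r = a.det := by
  refine hσ.fixed _ ?_
  have h1 := congrArg Matrix.det (mem_twistedForm.1 ha)
  rw [Matrix.det_mul, Matrix.det_mul, mul_comm, det_mapMatrix] at h1
  exact (mul_left_cancel₀ hP.det_ne_zero h1).symm

theorem mapMatrix_mul_mapMatrix (hσ : IsConjugation σ) {a : Matrix n n L}
    (ha : a ∈ twistedForm σ P) : σ.mapMatrix a * σ.mapMatrix P = σ.mapMatrix P * a := by
  rw [← map_mul, mem_twistedForm.1 ha, map_mul, mapMatrix_mapMatrix hσ]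

/-- The discriminant of a Hermitian matrix, in the symplectic case. -/
theorem exists_det_eq_of_transpose_eq_neg (hσ : IsConjugation σ) (hP : IsTwist σ P c)
    (hn : Fintype.card n = 2 * m) (hh : h.transpose = σ.mapMatrix h) (h0 : h.det ≠ 0)
    (hM : (h * σ.mapMatrix P).transpose = -(h * σ.mapMatrix P)) :
    ∃ x : L, (-1) ^ m * h.det = algebraMap K L c ^ m * (x * σ x) := by
  have := IsConjugation.charZero K L
  obtain ⟨pf, hpf1, hpf2, hpf3, hpf4⟩ := exists_pfaffian (F := L) hn
  have hd0 := hP.det_ne_zero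
  have hc0 := algebraMap_ne_zero L c
  set M := h * σ.mapMatrix P with hMdef
  have hMdet : M.det = h.det * σ P.det := by rw [hMdef, Matrix.det_mul, det_mapMatrix]
  have hσd : σ P.det ≠ 0 := (map_ne_zero σ).2 hd0
  have h1 := congrArg pf (hP.transpose_mul_mul hσ hh)
  rw [hpf1, hM, smul_neg, ← neg_smul, hpf2] at h1
  have h2 : pf (σ.mapMatrix M) = σ (pf M) := hpf3 (σ : L →+* L) M
  rw [h2, det_mapMatrix] at h1
  have h3 := hpf4 M hM (by rw [hMdet]; exact mul_ne_zero h0 hσd)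
  -- Eliminating `σ(det P)` between `det h · σ(det P) = pf(M)²` and `σ(det P) σ(pf M) = (-c)^m pf M`
  -- gives `(-1)^m det h = c⁻ᵐ pf(M) σ(pf M)`.
  refine ⟨pf M / algebraMap K L c ^ m, ?_⟩
  have h4 : (-1 : L) ^ m * (-1) ^ m = 1 := by rw [← mul_pow]; simp
  rw [neg_pow] at h1
  rw [map_div₀, map_pow, AlgEquiv.commutes]
  field_simp
  apply mul_left_cancel₀ hσd
  rw [hMdet] at h3
  linear_combination (-1) ^ m * algebraMap K L c ^ m * h3 - pf M * h1

/-- Here `p` is the Pfaffian of the alternating matrix `M a`, with `M = h σ(P)` symmetric. As `a` is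
compatible with the twist, `σ(P)ᵀ σ(M a) σ(P) = c M a`, and the Pfaffian of this is the second
equation. -/
theorem exists_pfaffian_eq (hσ : IsConjugation σ) (hP : IsTwist σ P c)
    (hn : Fintype.card n = 2 * m) (hh : h.transpose = σ.mapMatrix h) (h0 : h.det ≠ 0)
    (hM : (h * σ.mapMatrix P).transpose = h * σ.mapMatrix P) {a : Matrix n n L}
    (ha : a ∈ twistedForm σ P) (ha0 : a.det ≠ 0)
    (hMa : a ∈ skewSubmodule (h * σ.mapMatrix P)) :
    ∃ p : L, p ^ 2 = h.det * σ P.det * a.det ∧ σ P.det * σ p = algebraMap K L c ^ m * p := by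
  have := IsConjugation.charZero K L
  obtain ⟨pf, hpf1, hpf2, hpf3, hpf4⟩ := exists_pfaffian (F := L) hn
  set M := h * σ.mapMatrix P with hMdef
  have hMdet : M.det = h.det * σ P.det := by rw [hMdef, Matrix.det_mul, det_mapMatrix]
  have hσd : σ P.det ≠ 0 := (map_ne_zero σ).2 hP.det_ne_zero
  have h5 : (σ.mapMatrix P).transpose * σ.mapMatrix (M * a) * σ.mapMatrix P =
      algebraMap K L c • (M * a) := by
    rw [map_mul, mul_assoc, mul_assoc, mapMatrix_mul_mapMatrix hσ ha, ← mul_assoc, ← mul_assoc,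
      hP.transpose_mul_mul hσ hh, ← hMdef, hM, smul_mul_assoc]
  have h1 := congrArg pf h5
  have h2 : pf (σ.mapMatrix (M * a)) = σ (pf (M * a)) := hpf3 (σ : L →+* L) _
  rw [hpf1, hpf2, h2, det_mapMatrix] at h1
  refine ⟨pf (M * a), ?_, h1⟩
  rw [← hMdet, ← Matrix.det_mul]
  refine (hpf4 _ hMa ?_).symm
  rw [Matrix.det_mul, hMdet]
  exact mul_ne_zero (mul_ne_zero h0 hσd) ha0

/-- The discriminant of a Hermitian matrix, in the orthogonal case. -/
theorem exists_det_eq_of_transpose_eq (hσ : IsConjugation σ) (hP : IsTwist σ P c)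
    (hn : Fintype.card n = 2 * m) (hh : h.transpose = σ.mapMatrix h) (h0 : h.det ≠ 0)
    (hM : (h * σ.mapMatrix P).transpose = h * σ.mapMatrix P) {a : Matrix n n L}
    (ha : a ∈ twistedForm σ P) (ha0 : a.det ≠ 0)
    (hMa : a ∈ skewSubmodule (h * σ.mapMatrix P)) :
    ∃ x : L, h.det = algebraMap K L c ^ m * a.det * (x * σ x) := by
  obtain ⟨p, hp1, hp2⟩ := hP.exists_pfaffian_eq hσ hn hh h0 hM ha ha0 hMa
  obtain ⟨r, hr⟩ := hP.exists_algebraMap_eq_det hσ ha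
  have hc0 := algebraMap_ne_zero L c
  have hσd : σ P.det ≠ 0 := (map_ne_zero σ).2 hP.det_ne_zero
  -- Eliminating `σ(det P)` gives `det h = p σ(p) / (c^m det a)`, with denominator in `K`.
  refine ⟨p / (algebraMap K L c ^ m * a.det), ?_⟩
  rw [← hr] at hp1 ha0 ⊢
  rw [map_div₀, map_mul, map_pow, AlgEquiv.commutes, AlgEquiv.commutes]
  field_simp
  apply mul_left_cancel₀ hσd
  linear_combination -(algebraMap K L c ^ m) * hp1 - p * hp2

/-- Two skew units have the same determinant up to squares. -/
theorem exists_sq_mul_det_eq (hσ : IsConjugation σ) (hP : IsTwist σ P c)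
    (hn : Fintype.card n = 2 * m) (hh : h.transpose = σ.mapMatrix h) (h0 : h.det ≠ 0)
    (hM : (h * σ.mapMatrix P).transpose = h * σ.mapMatrix P) {a b : Matrix n n L}
    (ha : a ∈ twistedForm σ P) (ha0 : a.det ≠ 0)
    (hMa : a ∈ skewSubmodule (h * σ.mapMatrix P))
    (hb : b ∈ twistedForm σ P) (hb0 : b.det ≠ 0)
    (hMb : b ∈ skewSubmodule (h * σ.mapMatrix P)) :
    ∃ t : K, algebraMap K L t ^ 2 * a.det = b.det := by
  obtain ⟨p, hp1, hp2⟩ := hP.exists_pfaffian_eq hσ hn hh h0 hM ha ha0 hMa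
  obtain ⟨q, hq1, hq2⟩ := hP.exists_pfaffian_eq hσ hn hh h0 hM hb hb0 hMb
  have hσd : σ P.det ≠ 0 := (map_ne_zero σ).2 hP.det_ne_zero
  have hd : h.det * σ P.det ≠ 0 := mul_ne_zero h0 hσd
  have hc0 := algebraMap_ne_zero L c
  have hp0 : p ≠ 0 := by
    rintro rfl
    rw [zero_pow two_ne_zero] at hp1
    exact mul_ne_zero hd ha0 hp1.symm
  have hσp : σ p ≠ 0 := (map_ne_zero σ).2 hp0
  -- Both Pfaffians satisfy the same equation under `σ`, so their quotient lies in `K`; its square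
  -- is the quotient of the determinants.
  obtain ⟨t, ht⟩ := hσ.fixed (q / p) (by
    rw [map_div₀, div_eq_div_iff hσp hp0]
    apply mul_left_cancel₀ (mul_ne_zero hσd (pow_ne_zero m hc0))
    linear_combination algebraMap K L c ^ m * p * hq2 - algebraMap K L c ^ m * q * hp2)
  refine ⟨t, ?_⟩
  rw [ht]
  field_simp
  apply mul_left_cancel₀ hd
  linear_combination p ^ 2 * hq1 - q ^ 2 * hp1

/-- With `M = h σ(P)` one has `M · theta(a) = c⁻¹ σ(P)ᵀ σ(M a) σ(P)`, and conjugation and congruence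
preserve skew-symmetry. Descent thus applies to the skew elements. -/
theorem theta_mem_skewSubmodule (hσ : IsConjugation σ) (hP : IsTwist σ P c)
    (hh : h.transpose = σ.mapMatrix h)
    (hM : (h * σ.mapMatrix P).transpose = h * σ.mapMatrix P) {a : Matrix n n L}
    (ha : a ∈ skewSubmodule (h * σ.mapMatrix P)) :
    theta σ P P c a ∈ skewSubmodule (h * σ.mapMatrix P) := by
  have hc0 := algebraMap_ne_zero L c
  have h1 : h * σ.mapMatrix P * theta σ P P c a = (algebraMap K L c)⁻¹ •
      ((σ.mapMatrix P).transpose * σ.mapMatrix (h * σ.mapMatrix P * a) * σ.mapMatrix P) := by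
    have h2 := hP.transpose_mul_mul hσ hh
    rw [hM] at h2
    have h3 : (σ.mapMatrix P).transpose * σ.mapMatrix (h * σ.mapMatrix P) =
        h * σ.mapMatrix P * P := by
      have h4 := congrArg (· * P) h2
      simp only [mul_assoc, hP.mapMatrix_mul hσ] at h4
      rw [Algebra.algebraMap_eq_smul_one, ← algebraMap_smul L (c : K), mul_smul_comm, mul_one,
        mul_smul_comm] at h4
      have h5 := congrArg ((algebraMap K L c)⁻¹ • ·) h4
      simp only [smul_mul_assoc, smul_smul, inv_mul_cancel₀ hc0, one_smul] at h5
      rw [h5]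
    rw [map_mul σ.mapMatrix (h * σ.mapMatrix P), ← mul_assoc (Matrix.transpose _), h3, theta_apply,
      Algebra.algebraMap_eq_smul_one, ← algebraMap_smul L ((c⁻¹ : Kˣ) : K), smul_mul_assoc, one_mul,
      mul_smul_comm]
    simp only [Units.val_inv_eq_inv_val, map_inv₀, mul_assoc]
  rw [mem_skewSubmodule] at ha ⊢
  rw [h1, Matrix.transpose_smul, Matrix.transpose_mul, Matrix.transpose_mul,
    Matrix.transpose_transpose, transpose_mapMatrix (_ * a), ha, map_neg, neg_mul, mul_neg, smul_neg]
  simp only [mul_assoc]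

/-- Over `L` the matrix `M⁻¹ J`, with `J` alternating and invertible, is skew in this sense. Descent
writes it as `y + sz`, and `y + tz` stays invertible for some `t ∈ K`. -/
theorem exists_mem_skewSubmodule (hσ : IsConjugation σ) (hP : IsTwist σ P c)
    (hn : Fintype.card n = 2 * m) (hh : h.transpose = σ.mapMatrix h) (h0 : h.det ≠ 0)
    (hM : (h * σ.mapMatrix P).transpose = h * σ.mapMatrix P) :
    ∃ a ∈ twistedForm σ P, a ∈ skewSubmodule (h * σ.mapMatrix P) ∧ a.det ≠ 0 := by
  have := IsConjugation.charZero K L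
  obtain ⟨J, hJ, hJ0⟩ := exists_alternating_invertible L hn
  obtain ⟨s, hs0, hs⟩ := hσ.exists_skew
  set M := h * σ.mapMatrix P with hMdef
  have hMdet : IsUnit M.det := by
    rw [hMdef, Matrix.det_mul, det_mapMatrix]
    exact (mul_ne_zero h0 ((map_ne_zero σ).2 hP.det_ne_zero)).isUnit
  have ha : M⁻¹ * J ∈ skewSubmodule M := by
    rw [mem_skewSubmodule, ← mul_assoc, Matrix.mul_nonsing_inv _ hMdet, one_mul, hJ]
  obtain ⟨y, hyS, z, hzS, hy, hz, hyz⟩ := IsConjugation.exists_fixed_add hs0 hs (theta σ P P c)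
    theta_smul (theta_theta hσ hP hP) (skewSubmodule M)
    (fun x hx => hP.theta_mem_skewSubmodule hσ hh hM hx) ha
  obtain ⟨t, ht⟩ := exists_det_add_smul_ne_zero K y z s (by
    rw [← hyz, Matrix.det_mul, Matrix.det_nonsing_inv]
    exact mul_ne_zero (by simpa using hMdet.ne_zero) hJ0)
  refine ⟨_, ?_, ?_, ht⟩
  · rw [algebraMap_smul]
    exact add_mem ((theta_eq_iff hσ hP y).1 hy)
      (Subalgebra.smul_mem _ ((theta_eq_iff hσ hP z).1 hz) _)
  · exact (skewSubmodule M).add_mem hyS ((skewSubmodule M).smul_mem _ hzS)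

theorem finrank_twistedForm_inf_skewSubmodule {n : ℕ} {P h : Matrix (Fin n) (Fin n) L}
    (hσ : IsConjugation σ) (hP : IsTwist σ P c) (hh : h.transpose = σ.mapMatrix h) (h0 : h.det ≠ 0)
    (hM : (h * σ.mapMatrix P).transpose = h * σ.mapMatrix P) (F : Submodule K (Matrix (Fin n) (Fin n) L))
    (hF : ∀ a, a ∈ F ↔ a ∈ skewSubmodule (h * σ.mapMatrix P) ∧ a ∈ twistedForm σ P) :
    Module.finrank K F = n * (n - 1) / 2 := by
  have := IsConjugation.charZero K L
  obtain ⟨s, hs0, hs⟩ := hσ.exists_skew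
  rw [hσ.finrank_fixed hs0 hs (theta σ P P c) theta_smul (theta_theta hσ hP hP)
    (skewSubmodule (h * σ.mapMatrix P)) (fun x hx => hP.theta_mem_skewSubmodule hσ hh hM hx) F
    fun x => by rw [hF, theta_eq_iff hσ hP, mem_twistedForm], finrank_skewSubmodule]
  rw [Matrix.det_mul, det_mapMatrix]
  exact (mul_ne_zero h0 ((map_ne_zero σ).2 hP.det_ne_zero)).isUnit

end IsTwist

/-! ### The extension of a group by an automorphism of order two -/

section Extension

variable {G : Type u} [Group G] {α : MulAut G}

theorem eq_one_or_eq_of_mem_zpowers (hα : α ^ 2 = 1) (x : Subgroup.zpowers α) :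
    (x : MulAut G) = 1 ∨ (x : MulAut G) = α := by
  obtain ⟨k, hk⟩ := Subgroup.mem_zpowers_iff.1 x.2
  rw [← hk]
  rcases Int.even_or_odd' k with ⟨j, rfl | rfl⟩
  · left
    rw [zpow_mul, zpow_ofNat, hα, one_zpow]
  · right
    rw [zpow_add, zpow_mul, zpow_ofNat, hα, one_zpow, one_mul, zpow_one]

/-- The automorphism `α` as an element of the extension. -/
def AutExtension.gen (α : MulAut G) : AutExtension α :=
  SemidirectProduct.inr ⟨α, Subgroup.mem_zpowers α⟩

theorem AutExtension.eq_inl_or (hα : α ^ 2 = 1) (y : AutExtension α) :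
    (∃ g, y = SemidirectProduct.inl g) ∨
      ∃ g, y = SemidirectProduct.inl g * AutExtension.gen α := by
  rcases eq_one_or_eq_of_mem_zpowers hα y.right with h | h
  · left
    refine ⟨y.left, SemidirectProduct.ext (by simp) (Subtype.ext (by simpa using h))⟩
  · right
    refine ⟨y.left, SemidirectProduct.ext (by simp [AutExtension.gen]) (Subtype.ext ?_)⟩
    simpa [AutExtension.gen] using h

section Hom

variable {Mo : Type*} [Monoid Mo] (hα : α ^ 2 = 1) (hα1 : α ≠ 1) (f : G →* Mo) (w : Mo)
  (hw : w * w = 1) (hwf : ∀ g, w * f g = f (α g) * w)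

open Classical in
/-- The homomorphism on `⟨α⟩` sending `α` to an involution `w`. -/
def zpowersHomOfSq : Subgroup.zpowers α →* Mo where
  toFun x := if (x : MulAut G) = 1 then 1 else w
  map_one' := by simp
  map_mul' x y := by
    have hαα : α * α = 1 := by rw [← sq, hα]
    rcases eq_one_or_eq_of_mem_zpowers hα x with hx | hx <;>
    rcases eq_one_or_eq_of_mem_zpowers hα y with hy | hy <;>
    simp [hx, hy, hα1, hαα, hw]

/-- The homomorphism on the extension given by a homomorphism on `G` and the image of `α`. -/
def extensionHom : AutExtension α →* Mo where
  toFun y := f y.left * zpowersHomOfSq hα hα1 w hw y.right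
  map_one' := by simp
  map_mul' x y := by
    have h : ∀ (x : Subgroup.zpowers α) g, zpowersHomOfSq hα hα1 w hw x * f g =
        f ((x : MulAut G) g) * zpowersHomOfSq hα hα1 w hw x := by
      intro x g
      rcases eq_one_or_eq_of_mem_zpowers hα x with hx | hx
      · simp [zpowersHomOfSq, hx]
      · simp [zpowersHomOfSq, hx, hα1, hwf]
    rw [SemidirectProduct.mul_left, SemidirectProduct.mul_right, map_mul, map_mul,
      mul_assoc, mul_assoc, ← mul_assoc _ (f y.left), h]
    simp only [mul_assoc]
    rfl

theorem extensionHom_inl (g : G) :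
    extensionHom hα hα1 f w hw hwf (SemidirectProduct.inl g) = f g := by
  simp [extensionHom]

theorem extensionHom_gen : extensionHom hα hα1 f w hw hwf (AutExtension.gen α) = w := by
  simp [extensionHom, AutExtension.gen, zpowersHomOfSq, hα1]

end Hom

variable [Finite G] {χ : G → ℂ}

/-- Conjugating `g` by an element with second component `a` gives `a⁻¹ g` up to conjugacy in `G`,
and `a⁻¹ = a`. So the sum has `card G` equal terms for each of `1` and `α`. -/
theorem extensionCharacter_inl (hα : α ^ 2 = 1) (hα1 : α ≠ 1) (hχ : ∀ g h, χ (h⁻¹ * g * h) = χ g)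
    (g : G) : extensionCharacter α χ (SemidirectProduct.inl g) = χ g + χ (α g) := by
  classical
  have := Fintype.ofFinite G
  have : Finite (MulAut G) := Finite.of_injective (fun a : MulAut G => (a : G → G))
    DFunLike.coe_injective
  have := Fintype.ofFinite (Subgroup.zpowers α)
  have : Finite (AutExtension α) := Finite.of_equiv _ SemidirectProduct.equivProd.symm
  have := Fintype.ofFinite (AutExtension α)
  have hαα : α * α = 1 := by rw [← sq, hα]
  have hinner : extensionCharacter α χ (SemidirectProduct.inl g) =
      (Nat.card G : ℂ)⁻¹ * ∑ᶠ t : AutExtension α, χ ((t.right : MulAut G) g) := by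
    rw [extensionCharacter, inducedCharacter]
    congr 1
    refine finsum_congr fun t => ?_
    have h1 : t⁻¹ * SemidirectProduct.inl g * t =
        SemidirectProduct.inl ((t.right⁻¹ : MulAut G) (t.left⁻¹ * g * t.left)) := by
      refine SemidirectProduct.ext ?_ ?_
      · simp [mul_assoc]
      · simp
    rw [h1, finsum_eq_single _ ((t.right⁻¹ : MulAut G) (t.left⁻¹ * g * t.left))]
    · rw [if_pos rfl, map_mul, map_mul, map_inv, hχ]
      congr 1
      rcases eq_one_or_eq_of_mem_zpowers hα t.right with h | h
      · simp [h]
      · rw [h, inv_eq_of_mul_eq_one_left hαα]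
    · intro k hk
      rw [if_neg]
      intro h
      exact hk (SemidirectProduct.inl_injective h).symm
  have huniv : (Finset.univ : Finset (Subgroup.zpowers α)) =
      {1, ⟨α, Subgroup.mem_zpowers α⟩} := by
    ext x
    simp only [Finset.mem_univ, Finset.mem_insert, Finset.mem_singleton, true_iff]
    exact (eq_one_or_eq_of_mem_zpowers hα x).imp (fun h => Subtype.ext h) fun h => Subtype.ext h
  have hG : (Fintype.card G : ℂ) ≠ 0 := by exact_mod_cast Fintype.card_ne_zero
  rw [hinner, finsum_eq_sum_of_fintype,
    Fintype.sum_equiv SemidirectProduct.equivProd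
      (fun t : AutExtension α => χ ((t.right : MulAut G) g))
      (fun p : G × Subgroup.zpowers α => χ ((p.2 : MulAut G) g)) (fun _ => rfl),
    Fintype.sum_prod_type]
  change _ * ∑ _x : G, ∑ y : Subgroup.zpowers α, χ ((y : MulAut G) g) = _
  rw [Finset.sum_const, Finset.card_univ, huniv, Finset.sum_pair]
  · simp
    field_simp
  · intro h
    exact hα1 (congrArg Subtype.val h).symm

/-- Since `⟨α⟩` is abelian, every conjugate keeps the second component `α ≠ 1` and so lies outside
`G`. -/
theorem extensionCharacter_inl_mul_gen (hα1 : α ≠ 1) (g : G) :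
    extensionCharacter α χ (SemidirectProduct.inl g * AutExtension.gen α) = 0 := by
  rw [extensionCharacter, inducedCharacter]
  refine mul_eq_zero_of_right _ (finsum_eq_zero_of_forall_eq_zero fun t =>
    finsum_eq_zero_of_forall_eq_zero fun k => if_neg fun h => hα1 ?_)
  have h1 := congrArg (fun y : AutExtension α => (y.right : MulAut G)) h
  have h2 : ∀ a b : Subgroup.zpowers α, a * b = b * a := fun a b => mul_comm' a b
  simp only [SemidirectProduct.mul_right, SemidirectProduct.right_inl, AutExtension.gen,
    SemidirectProduct.right_inr, one_mul, SemidirectProduct.inv_right] at h1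
  rw [mul_assoc, h2 _ t.right, ← mul_assoc, inv_mul_cancel, one_mul] at h1
  exact h1

end Extension

/-! ### Invariant quadratic forms of matrix representations -/

section Forms

variable {Γ : Type u} [Group Γ] [Finite Γ] {ι : Type*} [Fintype ι] [DecidableEq ι] {χ : Γ → ℂ}

/-- The representation given by a matrix representation. -/
def matrixRep {F : Type*} [Field F] (D : Γ →* Matrix ι ι F) : Representation F Γ (ι → F) :=
  (Matrix.toLinAlgEquiv' : Matrix ι ι F ≃ₐ[F] _).toMonoidHom.comp D

theorem matrixRep_apply {F : Type*} [Field F] (D : Γ →* Matrix ι ι F) (g : Γ) :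
    matrixRep D g = Matrix.toLin' (D g) := rfl

theorem character_matrixRep {F : Type*} [Field F] (D : Γ →* Matrix ι ι F) (g : Γ) :
    (matrixRep D).character g = (D g).trace := by
  rw [Representation.character, matrixRep_apply, Matrix.trace_toLin'_eq]

theorem affordsQuadraticForm_of_matrix (D : Γ →* Matrix ι ι ℂ) (hD : ∀ g, (D g).trace = χ g)
    (B : Matrix ι ι ℂ) (hB : B.transpose = B) (hB0 : B.det ≠ 0)
    (hDB : ∀ g, (D g).transpose * B * D g = B) : AffordsQuadraticForm χ := by
  let e := Fintype.equivFin ι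
  let D' : Γ →* Matrix (Fin (Fintype.card ι)) (Fin (Fintype.card ι)) ℂ :=
    (Matrix.reindexAlgEquiv ℂ ℂ e).toMonoidHom.comp D
  have hD' : ∀ g, D' g = (D g).reindex e e := fun g => rfl
  refine ⟨Fintype.card ι, matrixRep D', ?_, Matrix.toBilin' (B.reindex e e), ?_, ?_, ?_⟩
  · funext g
    rw [character_matrixRep, hD', ← hD]
    exact Fintype.sum_equiv e.symm _ _ fun _ => rfl
  · exact Matrix.isSymm_toBilin'_iff_isSymm.2 (by
      rw [Matrix.IsSymm, Matrix.transpose_reindex, hB])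
  · rw [LinearMap.BilinForm.nondegenerate_toBilin'_iff_det_ne_zero, Matrix.det_reindex_self]
    exact hB0
  · intro g v w
    change ((B.reindex e e).toBilin'.comp (D' g).toLin' (D' g).toLin') v w = _
    rw [Matrix.toBilin'_comp, hD', Matrix.transpose_reindex]
    have h := congrArg (Matrix.reindexAlgEquiv ℂ ℂ e) (hDB g)
    rw [map_mul, map_mul] at h
    exact congrArg (fun B : Matrix _ _ ℂ => B.toBilin' v w) h

/-- Equal characters give an equivalence, along which the form is pulled back to the prescribed
matrix representation. -/
theorem exists_matrix_of_affordsQuadraticForm (h : AffordsQuadraticForm χ)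
    (D : Γ →* Matrix ι ι ℂ) (hD : ∀ g, (D g).trace = χ g) :
    ∃ B : Matrix ι ι ℂ, B.transpose = B ∧ B.det ≠ 0 ∧ ∀ g, (D g).transpose * B * D g = B := by
  obtain ⟨n, ρ, hρ, B, hB1, hB2, hB3⟩ := h
  obtain ⟨e⟩ := (matrixRep D).nonempty_equiv_of_character_eq ρ (by
    rw [hρ]
    funext g
    rw [character_matrixRep, hD])
  let B' : LinearMap.BilinForm ℂ (ι → ℂ) :=
    LinearMap.BilinForm.congr e.toLinearEquiv.symm B
  have hB' : ∀ v w, B' v w = B (e.toLinearEquiv v) (e.toLinearEquiv w) := fun v w => rfl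
  have he : ∀ g v, e.toLinearEquiv (matrixRep D g v) = ρ g (e.toLinearEquiv v) := fun g v =>
    LinearMap.congr_fun (e.toIntertwiningMap.isIntertwining' g) v
  refine ⟨LinearMap.BilinForm.toMatrix' B', ?_, ?_, fun g => ?_⟩
  · ext i j
    rw [Matrix.transpose_apply, LinearMap.BilinForm.toMatrix'_apply,
      LinearMap.BilinForm.toMatrix'_apply, hB', hB']
    exact hB1.eq _ _
  · rw [← LinearMap.BilinForm.nondegenerate_toBilin'_iff_det_ne_zero, Matrix.toBilin'_toMatrix']
    exact hB2.congr _
  · apply Matrix.toBilin'.injective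
    rw [← Matrix.toBilin'_comp, Matrix.toBilin'_toMatrix']
    refine LinearMap.ext fun v => LinearMap.ext fun w => ?_
    change B (e.toLinearEquiv (matrixRep D g v)) (e.toLinearEquiv (matrixRep D g w)) =
      B (e.toLinearEquiv v) (e.toLinearEquiv w)
    rw [he, he, hB3]

end Forms

/-! ### Pairings of `R` with `R ∘ α` and the indicator of the induced character -/

section InvariantForm

variable {F : Type*} [Field F] [CharZero F] {G : Type u} [Group G] {n : Type*} [Fintype n]
  [DecidableEq n] {R : G →* Matrix n n F} {α : MulAut G} {M N : Matrix n n F}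

/-- `M` is the matrix of an invariant pairing of `R` and `R ∘ α`. -/
def IsInvariantPairing (R : G →* Matrix n n F) (α : MulAut G) (M : Matrix n n F) : Prop :=
  ∀ g, (R g).transpose * M * R (α g) = M

namespace IsInvariantPairing

theorem mul_map (hM : IsInvariantPairing R α M) (g : G) :
    M * R (α g) = (R g⁻¹).transpose * M := by
  conv_rhs => rw [← hM g, mul_assoc, ← mul_assoc, ← Matrix.transpose_mul, ← map_mul,
    mul_inv_cancel, map_one, Matrix.transpose_one, one_mul]

/-- Schur's lemma for `M⁻¹ N`, which commutes with the representation. -/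
theorem exists_eq_smul (hR : HasScalarCommutant R) (hM : IsInvariantPairing R α M)
    (hM0 : M.det ≠ 0) (hN : IsInvariantPairing R α N) : ∃ l : F, N = l • M := by
  have h1 : M * M⁻¹ = 1 := Matrix.mul_nonsing_inv _ hM0.isUnit
  have h2 : M⁻¹ * M = 1 := Matrix.nonsing_inv_mul _ hM0.isUnit
  obtain ⟨l, hl⟩ := hR (M⁻¹ * N) (by
    intro g
    obtain ⟨g, rfl⟩ := α.surjective g
    have h3 : M⁻¹ * (R g⁻¹).transpose = R (α g) * M⁻¹ := by
      calc _ = M⁻¹ * ((R g⁻¹).transpose * M) * M⁻¹ := by simp only [mul_assoc, h1, mul_one]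
        _ = _ := by rw [← hM.mul_map, ← mul_assoc, h2, one_mul]
    rw [mul_assoc, hN.mul_map, ← mul_assoc, h3, mul_assoc])
  refine ⟨l, ?_⟩
  rw [← one_mul N, ← h1, mul_assoc, hl, mul_smul_comm, mul_one]

theorem transpose (hα : α ^ 2 = 1) (hM : IsInvariantPairing R α M) :
    IsInvariantPairing R α M.transpose := by
  intro g
  have hαα : α (α g) = g := by simpa [pow_two] using DFunLike.congr_fun hα g
  have h := congrArg Matrix.transpose (hM (α g))
  rwa [hαα, Matrix.transpose_mul, Matrix.transpose_mul, Matrix.transpose_transpose,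
    ← mul_assoc] at h

/-- Because `α² = 1`, the transpose is again an invariant pairing, so `Mᵀ = l M`, and transposing
once more gives `l² = 1`. -/
theorem transpose_eq_or (hα : α ^ 2 = 1) (hR : HasScalarCommutant R)
    (hM : IsInvariantPairing R α M) (hM0 : M.det ≠ 0) :
    M.transpose = M ∨ M.transpose = -M := by
  obtain ⟨l, hl⟩ := hM.exists_eq_smul hR hM0 (hM.transpose hα)
  by_cases hM00 : M = 0
  · left
    simp [hM00]
  have h2 := congrArg Matrix.transpose hl
  rw [Matrix.transpose_transpose, Matrix.transpose_smul, hl, smul_smul] at h2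
  have h3 : (1 - l * l) • M = 0 := by rw [sub_smul, one_smul, ← h2, sub_self]
  have h4 := (smul_eq_zero.1 h3).resolve_right hM00
  have h5 : l * l = 1 := (sub_eq_zero.1 h4).symm
  rcases mul_self_eq_one_iff.1 h5 with rfl | rfl
  · left
    rw [hl, one_smul]
  · right
    rw [hl, neg_smul, one_smul]

end IsInvariantPairing

/-- An intertwiner between `R` and `R ∘ α` vanishes if their characters differ. -/
theorem eq_zero_of_intertwines [Fintype G] [Nonempty n] (hR : HasScalarCommutant R)
    {Y : Matrix n n F} (hY : ∀ g, Y * R g = R (α g) * Y) {g₀ : G}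
    (hg₀ : (R (α g₀)).trace ≠ (R g₀).trace) : Y = 0 := by
  -- The sums of the conjugates of `R g₀` and of `R (α g₀)` are scalars proportional to the two
  -- traces, and `Y` intertwines these sums.
  have h1 := congrArg (Y * ·) (sum_conj_eq hR (R g₀))
  have h2 := congrArg (· * Y) (sum_conj_eq hR (R (α g₀)))
  simp only [Finset.mul_sum, Finset.sum_mul] at h1 h2
  rw [← Fintype.sum_equiv α.toEquiv (fun g => R (α g) * R (α g₀) * R (α g)⁻¹ * Y) _
    (fun g => rfl)] at h2
  have h3 : ∀ g, Y * (R g * R g₀ * R g⁻¹) = R (α g) * R (α g₀) * R (α g)⁻¹ * Y := by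
    intro g
    rw [← map_mul, ← map_mul, hY, ← map_mul, ← map_mul]
    simp only [map_mul, map_inv]
  simp only [h3] at h1
  rw [h2, mul_smul_comm, smul_mul_assoc, mul_one, one_mul] at h1
  have hG : (Fintype.card G : F) ≠ 0 := by exact_mod_cast Fintype.card_ne_zero
  have hn : (Fintype.card n : F) ≠ 0 := by exact_mod_cast Fintype.card_ne_zero
  by_contra hY0
  exact hg₀ (mul_left_cancel₀ (div_ne_zero hG hn) (smul_left_injective F hY0 h1))

/-- The exchange of the two summands. -/
def swapMatrix (n : Type*) (F : Type*) [Field F] [Fintype n] [DecidableEq n] :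
    Matrix (n ⊕ n) (n ⊕ n) F :=
  Matrix.fromBlocks 0 1 1 0

/-- The matrix representation `R ⊕ (R ∘ α)`. -/
def doubleHom (R : G →* Matrix n n F) (α : MulAut G) : G →* Matrix (n ⊕ n) (n ⊕ n) F where
  toFun g := Matrix.fromBlocks (R g) 0 0 (R (α g))
  map_one' := by simp
  map_mul' g h := by simp [Matrix.fromBlocks_multiply]

theorem doubleHom_apply (g : G) :
    doubleHom R α g = Matrix.fromBlocks (R g) 0 0 (R (α g)) := rfl

/-- The matrix representation of the extension induced by `R`. -/
def inducedHom (R : G →* Matrix n n F) (hα : α ^ 2 = 1) (hα1 : α ≠ 1) :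
    AutExtension α →* Matrix (n ⊕ n) (n ⊕ n) F :=
  extensionHom hα hα1 (doubleHom R α) (swapMatrix n F)
    (by simp [swapMatrix, Matrix.fromBlocks_multiply]) (by
      intro g
      have hαα : α (α g) = g := by simpa [pow_two] using DFunLike.congr_fun hα g
      simp [swapMatrix, Matrix.fromBlocks_multiply, doubleHom_apply, hαα])

theorem trace_fromBlocks_eq (A B C D : Matrix n n F) :
    (Matrix.fromBlocks A B C D).trace = A.trace + D.trace := by
  simp [Matrix.trace, Fintype.sum_sum_type]

theorem trace_inducedHom [Finite G] {R : G →* Matrix n n ℂ} {χ : G → ℂ} (hα : α ^ 2 = 1)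
    (hα1 : α ≠ 1) (hχ : ∀ g, (R g).trace = χ g) (y : AutExtension α) :
    (inducedHom R hα hα1 y).trace = extensionCharacter α χ y := by
  rcases AutExtension.eq_inl_or hα y with ⟨g, rfl⟩ | ⟨g, rfl⟩
  · rw [extensionCharacter_inl hα hα1, inducedHom, extensionHom_inl, doubleHom_apply,
      trace_fromBlocks_eq, hχ, hχ]
    intro g h
    have := Fintype.ofFinite G
    rw [← hχ, ← hχ, map_mul, map_mul, Matrix.trace_mul_cycle, map_mul_map_inv, one_mul]
  · rw [extensionCharacter_inl_mul_gen hα1, inducedHom, map_mul, extensionHom_inl,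
      extensionHom_gen, doubleHom_apply, swapMatrix, Matrix.fromBlocks_multiply,
      trace_fromBlocks_eq]
    simp

/-- The form with zero diagonal blocks and off-diagonal blocks `M` is preserved by `G` because `M`
is an invariant pairing, and by the swap because its two blocks coincide. -/
theorem affordsQuadraticForm_extensionCharacter [Finite G] {R : G →* Matrix n n ℂ} {χ : G → ℂ}
    {M : Matrix n n ℂ} (hα : α ^ 2 = 1) (hα1 : α ≠ 1) (hχ : ∀ g, (R g).trace = χ g)
    (hM : IsInvariantPairing R α M) (hM0 : M.det ≠ 0) (hMt : M.transpose = M) :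
    AffordsQuadraticForm (extensionCharacter α χ) := by
  have : Finite (AutExtension α) := by
    have : Finite (MulAut G) := Finite.of_injective (fun a : MulAut G => (a : G → G))
      DFunLike.coe_injective
    exact Finite.of_equiv _ SemidirectProduct.equivProd.symm
  let B : Matrix (n ⊕ n) (n ⊕ n) ℂ := Matrix.fromBlocks 0 M M 0
  have hM' : ∀ g, (R (α g)).transpose * M * R g = M := by
    intro g
    have h := hM (α g)
    rwa [show α (α g) = g by simpa [pow_two] using DFunLike.congr_fun hα g] at h
  have hinl : ∀ g, (doubleHom R α g).transpose * B * doubleHom R α g = B := by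
    intro g
    simp [B, doubleHom_apply, Matrix.fromBlocks_transpose, Matrix.fromBlocks_multiply, hM', hM g]
  have hgen : (swapMatrix n ℂ).transpose * B * swapMatrix n ℂ = B := by
    simp [B, swapMatrix, Matrix.fromBlocks_transpose, Matrix.fromBlocks_multiply]
  have hBB : B * Matrix.fromBlocks 0 M⁻¹ M⁻¹ 0 = 1 := by
    simp [B, Matrix.fromBlocks_multiply, Matrix.mul_nonsing_inv _ hM0.isUnit]
  refine affordsQuadraticForm_of_matrix (inducedHom R hα hα1) (trace_inducedHom hα hα1 hχ) B
    (by simp [B, Matrix.fromBlocks_transpose, hMt])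
    ((Matrix.isUnit_iff_isUnit_det B).1 (IsUnit.of_mul_eq_one _ hBB)).ne_zero fun y => ?_
  rcases AutExtension.eq_inl_or hα y with ⟨g, rfl⟩ | ⟨g, rfl⟩
  · rw [inducedHom, extensionHom_inl, hinl]
  · rw [inducedHom, map_mul, extensionHom_inl, extensionHom_gen, Matrix.transpose_mul]
    calc _ = (swapMatrix n ℂ).transpose * ((doubleHom R α g).transpose * B * doubleHom R α g) *
          swapMatrix n ℂ := by simp only [mul_assoc]
      _ = B := by rw [hinl, hgen]

/-- Invariance under the swap makes the two diagonal blocks of the form equal, and likewise the two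
off-diagonal ones. `M⁻¹` times a diagonal block intertwines `R` with `R ∘ α`, whose characters
differ, so that block vanishes. The off-diagonal block is a nonzero multiple of `M`, and the form is
symmetric. -/
theorem transpose_eq_of_affordsQuadraticForm [Fintype G] [Nonempty n] {R : G →* Matrix n n ℂ}
    {χ : G → ℂ} {M : Matrix n n ℂ} (hα : α ^ 2 = 1) (hα1 : α ≠ 1) (hχ : ∀ g, (R g).trace = χ g)
    (hR : HasScalarCommutant R) {g₀ : G} (hg₀ : (R (α g₀)).trace ≠ (R g₀).trace)
    (hM : IsInvariantPairing R α M) (hM0 : M.det ≠ 0)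
    (hX : AffordsQuadraticForm (extensionCharacter α χ)) : M.transpose = M := by
  have : Finite (AutExtension α) := by
    have : Finite (MulAut G) := Finite.of_injective (fun a : MulAut G => (a : G → G))
      DFunLike.coe_injective
    exact Finite.of_equiv _ SemidirectProduct.equivProd.symm
  obtain ⟨B, hBt, hB0, hB⟩ := exists_matrix_of_affordsQuadraticForm hX (inducedHom R hα hα1)
    (trace_inducedHom hα hα1 hχ)
  obtain ⟨E₁, N, N', E₂, rfl⟩ : ∃ E₁ N N' E₂ : Matrix n n ℂ, B = Matrix.fromBlocks E₁ N N' E₂ :=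
    ⟨_, _, _, _, (Matrix.fromBlocks_toBlocks B).symm⟩
  have h1 := hB (AutExtension.gen α)
  rw [inducedHom, extensionHom_gen] at h1
  simp only [swapMatrix, Matrix.fromBlocks_transpose, Matrix.fromBlocks_multiply,
    Matrix.transpose_zero, Matrix.transpose_one, zero_mul, one_mul, mul_zero, mul_one, zero_add,
    add_zero, Matrix.fromBlocks_inj] at h1
  obtain ⟨rfl, rfl, -, -⟩ := h1
  rw [Matrix.fromBlocks_transpose, Matrix.fromBlocks_inj] at hBt
  have h2 : ∀ g, (R g).transpose * E₂ * R g = E₂ ∧ (R g).transpose * N' * R (α g) = N' := by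
    intro g
    have h := hB (SemidirectProduct.inl g)
    rw [inducedHom, extensionHom_inl, doubleHom_apply] at h
    simp only [Matrix.fromBlocks_transpose, Matrix.fromBlocks_multiply,
      Matrix.transpose_zero, zero_mul, mul_zero, zero_add, add_zero, Matrix.fromBlocks_inj] at h
    exact ⟨h.1, h.2.1⟩
  have hE : E₂ = 0 := by
    have h3 : M⁻¹ * E₂ = 0 := by
      refine eq_zero_of_intertwines (α := α) hR (fun g => ?_) hg₀
      have h4 : E₂ * R g = (R g⁻¹).transpose * E₂ := by
        conv_rhs => rw [← (h2 g).1, mul_assoc, ← mul_assoc, ← Matrix.transpose_mul, ← map_mul,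
          mul_inv_cancel, map_one, Matrix.transpose_one, one_mul]
      have h5 : M⁻¹ * (R g⁻¹).transpose = R (α g) * M⁻¹ := by
        calc _ = M⁻¹ * ((R g⁻¹).transpose * M) * M⁻¹ := by
              simp only [mul_assoc, Matrix.mul_nonsing_inv _ hM0.isUnit, mul_one]
          _ = _ := by rw [← hM.mul_map, ← mul_assoc, Matrix.nonsing_inv_mul _ hM0.isUnit, one_mul]
      rw [mul_assoc, h4, ← mul_assoc, h5, mul_assoc]
    rw [← one_mul E₂, ← Matrix.mul_nonsing_inv _ hM0.isUnit, mul_assoc, h3, mul_zero]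
  obtain ⟨l, hl⟩ := hM.exists_eq_smul hR hM0 (N := N') fun g => (h2 g).2
  have hl0 : l ≠ 0 := by
    rintro rfl
    rw [zero_smul] at hl
    apply hB0
    rw [hl, hE, Matrix.fromBlocks_zero]
    exact Matrix.det_zero
  have h6 := hBt.2.1
  rw [hl, Matrix.transpose_smul] at h6
  exact smul_right_injective _ hl0 h6

end InvariantForm

/-! ### The endomorphism algebra of twice the induced representation -/

section Trace

variable {K L : Type*} [Field K] [Field L] [Algebra K L] [CharZero K] {σ : L ≃ₐ[K] L}

theorem IsConjugation.algebraMap_trace (hσ : IsConjugation σ) (x : L) :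
    algebraMap K L (Algebra.trace K L x) = x + σ x := by
  have := hσ.finiteDimensional
  obtain ⟨s, hs0, hs⟩ := hσ.exists_skew
  obtain ⟨a, b, rfl⟩ := hσ.exists_eq_add hs0 hs x
  have h1 : Algebra.trace K L s = 0 := by
    have h2 := Algebra.trace_eq_of_algEquiv σ s
    rw [hs, map_neg] at h2
    exact neg_eq_self.1 h2
  rw [map_add, ← Algebra.smul_def, map_smul, h1, Algebra.trace_algebraMap, hσ.finrank_eq_two,
    two_smul]
  simp only [Algebra.smul_def, map_add, map_mul, AlgEquiv.commutes, hs, map_zero]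
  ring

theorem trace_restrictScalars_eq {K L E : Type*} [Field K] [Field L] [Algebra K L]
    [FiniteDimensional K L] [AddCommGroup E] [Module L E] [Module K E] [IsScalarTower K L E]
    [FiniteDimensional L E] (f : Module.End L E) :
    LinearMap.trace K E (f.restrictScalars K) = Algebra.trace K L (LinearMap.trace L E f) := by
  let b := Module.finBasis K L
  let c := Module.finBasis L E
  rw [LinearMap.trace_eq_matrix_trace K (b.smulTower' c), LinearMap.restrictScalars_toMatrix,
    LinearMap.trace_eq_matrix_trace L c, Matrix.trace, Matrix.trace, map_sum, Fintype.sum_prod_type]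
  refine Finset.sum_congr rfl fun i _ => ?_
  rw [Algebra.trace_eq_matrix_trace b, Matrix.trace]
  rfl

end Trace

section Endomorphisms

variable {K L E : Type*} [Field K] [CharZero K] [Field L] [Algebra K L] [AddCommGroup E]
  [Module L E] [Module K E] [IsScalarTower K L E] {σ : L ≃ₐ[K] L} {c : Kˣ}
  {G : Type u} [Group G] (ρ : Representation L G E) (α : MulAut G)

/-- The `K`-linear representation `ρ ⊕ (ρ ∘ α)`. -/
def doubleRep (K : Type*) [Field K] [Algebra K L] [Module K E] [IsScalarTower K L E] :
    Representation K G (E × E) where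
  toFun g := ((ρ g).restrictScalars K).prodMap ((ρ (α g)).restrictScalars K)
  map_one' := by
    refine LinearMap.ext fun x => ?_
    simp
  map_mul' g h := by
    refine LinearMap.ext fun x => ?_
    simp

theorem doubleRep_apply (g : G) (x : E × E) : doubleRep ρ α K g x = (ρ g x.1, ρ (α g) x.2) := rfl

/-- The exchange of the two summands. -/
def swapEnd (K E : Type*) [Field K] [AddCommGroup E] [Module K E] : Module.End K (E × E) :=
  (LinearEquiv.prodComm K E E).toLinearMap

theorem swapEnd_apply (x : E × E) : swapEnd K E x = (x.2, x.1) := rfl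

theorem swapEnd_mul_self : swapEnd K E * swapEnd K E = 1 := rfl

variable {α}

variable (K) in
/-- The `K`-linear representation of the extension on `E × E`. -/
def inducedRep (hα : α ^ 2 = 1) (hα1 : α ≠ 1) : Representation K (AutExtension α) (E × E) :=
  extensionHom hα hα1 (doubleRep ρ α K) (swapEnd K E) swapEnd_mul_self (by
    intro g
    have hαα : α (α g) = g := by simpa [pow_two] using DFunLike.congr_fun hα g
    refine LinearMap.ext fun x => ?_
    change (ρ (α g) x.2, ρ g x.1) = (ρ (α g) x.2, ρ (α (α g)) x.1)
    rw [hαα])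

theorem inducedRep_inl (hα : α ^ 2 = 1) (hα1 : α ≠ 1) (g : G) :
    inducedRep K ρ hα hα1 (SemidirectProduct.inl g) = doubleRep ρ α K g :=
  extensionHom_inl _ _ _ _ _ _ g

theorem inducedRep_gen (hα : α ^ 2 = 1) (hα1 : α ≠ 1) :
    inducedRep K ρ hα hα1 (AutExtension.gen α) = swapEnd K E :=
  extensionHom_gen _ _ _ _ _ _

theorem mem_endomorphismAlgebra_inducedRep (hα : α ^ 2 = 1) (hα1 : α ≠ 1)
    (T : Module.End K (E × E)) : T ∈ endomorphismAlgebra K (inducedRep K ρ hα hα1) ↔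
      (∀ g, doubleRep ρ α K g * T = T * doubleRep ρ α K g) ∧ swapEnd K E * T = T * swapEnd K E := by
  rw [endomorphismAlgebra, Subalgebra.mem_centralizer_iff]
  constructor
  · intro h
    refine ⟨fun g => ?_, ?_⟩
    · simpa only [inducedRep_inl] using h _ ⟨SemidirectProduct.inl g, rfl⟩
    · simpa only [inducedRep_gen] using h _ ⟨AutExtension.gen α, rfl⟩
  · rintro ⟨h1, h2⟩ _ ⟨y, rfl⟩
    rcases AutExtension.eq_inl_or hα y with ⟨g, rfl⟩ | ⟨g, rfl⟩
    · rw [inducedRep_inl, h1]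
    · rw [map_mul, inducedRep_inl, inducedRep_gen, mul_assoc, h2, ← mul_assoc, h1, mul_assoc]

/-- Conjugation by the involution `(1, -1)` negates this operator, so its trace is zero. -/
theorem trace_mul_swapEnd [FiniteDimensional K E] (A B : Module.End K E) :
    LinearMap.trace K (E × E) (A.prodMap B * swapEnd K E) = 0 := by
  let d : Module.End K (E × E) := LinearMap.prodMap 1 (-1)
  have hd : d * d = 1 := LinearMap.ext fun x => by simp [d]
  have h1 : d * (A.prodMap B * swapEnd K E) * d = -(A.prodMap B * swapEnd K E) := by
    refine LinearMap.ext fun x => ?_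
    simp [d, swapEnd_apply]
  have h2 := LinearMap.trace_mul_cycle K d (A.prodMap B * swapEnd K E) d
  rw [hd, one_mul, h1, map_neg] at h2
  exact neg_eq_self.1 h2

/-- Restriction of scalars replaces a trace by its `L/K`-trace, so on `G` the value is `(χ + σχ) +
(χ∘α + σ(χ∘α)) = 2(χ + χ∘α)`; off `G` both sides vanish. This gives an explicit model of `2X` over
`K`. -/
theorem character_inducedRep (hσ : IsConjugation σ) [Finite G] [FiniteDimensional L E]
    (hα : α ^ 2 = 1) (hα1 : α ≠ 1)
    (hρα : ∀ g, ρ.character (α g) = σ (ρ.character g)) {χ : G → ℂ} (f : L →+* ℂ)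
    (hχ : ∀ g, f (ρ.character g) = χ g) (y : AutExtension α) :
    f (algebraMap K L
      (Representation.character (inducedRep K ρ hα hα1) y)) = 2 * extensionCharacter α χ y := by
  have := hσ.finiteDimensional
  have : FiniteDimensional K E := FiniteDimensional.trans K L E
  have hαα : ∀ g, α (α g) = g := fun g => by simpa [pow_two] using DFunLike.congr_fun hα g
  have hσσ : ∀ x, σ (σ x) = x := hσ.involutive
  rcases AutExtension.eq_inl_or hα y with ⟨g, rfl⟩ | ⟨g, rfl⟩
  · rw [extensionCharacter_inl hα hα1, Representation.character, inducedRep_inl]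
    · change f (algebraMap K L (LinearMap.trace K (E × E)
        (((ρ g).restrictScalars K).prodMap ((ρ (α g)).restrictScalars K)))) = _
      rw [LinearMap.trace_prodMap', trace_restrictScalars_eq, trace_restrictScalars_eq, map_add,
        hσ.algebraMap_trace, hσ.algebraMap_trace]
      change f (ρ.character g + σ (ρ.character g) +
        (ρ.character (α g) + σ (ρ.character (α g)))) = _
      rw [← hχ, ← hχ, hρα, hσσ]
      simp only [map_add]
      ring
    · intro g h
      rw [← hχ, ← hχ, ← Representation.char_conj ρ g h⁻¹, inv_inv]
  · rw [extensionCharacter_inl_mul_gen hα1, Representation.character, map_mul, inducedRep_inl,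
      inducedRep_gen]
    have := trace_mul_swapEnd ((ρ g).restrictScalars K) ((ρ (α g)).restrictScalars K)
    rw [mul_zero, ← map_zero f, ← map_zero (algebraMap K L), ← this]
    rfl

variable (S : E →ₗ[K] E)

/-- The quaternion generators acting on `E × E`. -/
def endQuaternionBasis {s : L} (hs : σ s = -s) {δ : Kˣ} (h : s ^ 2 = algebraMap K L δ)
    (hSσ : ∀ (l : L) v, S (l • v) = σ l • S v) (hSS : ∀ v, S (S v) = c • v) :
    QuaternionAlgebra.Basis (Module.End K (E × E)) (δ : K) 0 (c : K) where
  i := Algebra.lsmul K K (E × E) s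
  j := (S.prodMap S) * swapEnd K E
  k := Algebra.lsmul K K (E × E) s * ((S.prodMap S) * swapEnd K E)
  i_mul_i := by
    refine LinearMap.ext fun x => ?_
    change s • s • x = (δ : K) • x + (0 : K) • s • x
    rw [smul_smul, ← sq, h, algebraMap_smul, zero_smul, add_zero]
  j_mul_j := by
    refine LinearMap.ext fun x => ?_
    exact Prod.ext (hSS x.1) (hSS x.2)
  i_mul_j := rfl
  j_mul_i := by
    refine LinearMap.ext fun x => ?_
    change (S (s • x.2), S (s • x.1)) = (0 : K) • (S x.2, S x.1) - s • (S x.2, S x.1)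
    rw [hSσ, hSσ, hs, zero_smul, zero_sub]
    simp

variable {ρ S}

/-- Such a map commutes with the whole `K`-span, which is `End_L(E)`. This contains the scalars of
`L`, so the map is `L`-linear, and then it is central in `End_L(E)`. -/
theorem exists_smul_of_commute (hspan : Submodule.span K (Set.range ρ) = ⊤) {T : E →ₗ[K] E}
    (hT : ∀ g v, T (ρ g v) = ρ g (T v)) : ∃ l : L, ∀ v, T v = l • v := by
  have h1 : ∀ (f : Module.End L E) v, T (f v) = f (T v) := by
    intro f
    have hf : f ∈ Submodule.span K (Set.range ρ) := hspan ▸ Submodule.mem_top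
    induction hf using Submodule.span_induction with
    | mem f hf =>
      obtain ⟨g, rfl⟩ := hf
      exact hT g
    | zero => simp
    | add f g _ _ hf hg => intro v; simp [hf, hg]
    | smul a f _ hf => intro v; simp [hf]
  let T' : Module.End L E :=
    { toFun := T
      map_add' := map_add T
      map_smul' := fun l v => h1 (algebraMap L (Module.End L E) l) v }
  have h2 : T' ∈ Subalgebra.center L (Module.End L E) :=
    Subalgebra.mem_center_iff.2 fun f => LinearMap.ext fun v => (h1 f v).symm
  rw [Algebra.IsCentral.center_eq_bot] at h2
  obtain ⟨l, hl⟩ := h2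
  exact ⟨l, fun v => (LinearMap.congr_fun hl v).symm⟩

/-- An endomorphism commuting with the swap is determined by its first component. On the first
summand this commutes with `ρ`, on the second it does so after composition with `S`; both maps are
therefore scalars of `L`, giving four coordinates over `K`. -/
theorem nonempty_quaternion_equiv_endomorphismAlgebra [Nontrivial E] (hσ : IsConjugation σ) {s : L}
    (hs0 : s ≠ 0) (hs : σ s = -s) {δ : Kˣ} (h : s ^ 2 = algebraMap K L δ)
    (hSσ : ∀ (l : L) v, S (l • v) = σ l • S v) (hSS : ∀ v, S (S v) = c • v)
    (hα : α ^ 2 = 1) (hα1 : α ≠ 1)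
    (hSρ : ∀ g v, S (ρ g v) = ρ (α g) (S v)) (hspan : Submodule.span K (Set.range ρ) = ⊤) :
    Nonempty (QuaternionAlgebra K (δ : K) 0 (c : K) ≃ₐ[K]
      endomorphismAlgebra K (inducedRep K ρ hα hα1)) := by
  have hαα : ∀ g, α (α g) = g := fun g => by simpa [pow_two] using DFunLike.congr_fun hα g
  let Φ := (endQuaternionBasis S hs h hSσ hSS).liftHom
  have hΦ : ∀ q x, Φ q x =
      ((algebraMap K L q.re + algebraMap K L q.imI * s) • x.1 +
          (algebraMap K L q.imJ + algebraMap K L q.imK * s) • S x.2,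
        (algebraMap K L q.re + algebraMap K L q.imI * s) • x.2 +
          (algebraMap K L q.imJ + algebraMap K L q.imK * s) • S x.1) := by
    intro q x
    change q.re • x + q.imI • s • x + q.imJ • (S x.2, S x.1) + q.imK • s • (S x.2, S x.1) = _
    refine Prod.ext ?_ ?_ <;> simp only [Prod.fst_add, Prod.snd_add, Prod.smul_fst, Prod.smul_snd,
      add_smul, mul_smul, algebraMap_smul, add_assoc]
  obtain ⟨v₀, hv₀⟩ := exists_ne (0 : E)
  have hSv₀ : S v₀ ≠ 0 := by
    intro h0
    have h1 := hSS v₀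
    rw [h0, map_zero, eq_comm, Units.smul_def] at h1
    exact hv₀ ((smul_eq_zero.1 h1).resolve_left c.ne_zero)
  have hinj : Function.Injective Φ := by
    intro p q hpq
    have h1 := LinearMap.congr_fun hpq (v₀, 0)
    rw [hΦ, hΦ, Prod.ext_iff] at h1
    simp only [map_zero, smul_zero, add_zero, zero_add] at h1
    obtain ⟨h2, h3⟩ := IsConjugation.add_mul_inj hs0 hs (smul_left_injective L hv₀ h1.1)
    obtain ⟨h4, h5⟩ := IsConjugation.add_mul_inj hs0 hs (smul_left_injective L hSv₀ h1.2)
    exact QuaternionAlgebra.ext h2 h3 h4 h5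
  refine ⟨(AlgEquiv.ofInjective Φ hinj).trans (Subalgebra.equivOfEq _ _ ?_)⟩
  ext T
  rw [mem_endomorphismAlgebra_inducedRep]
  constructor
  · rintro ⟨q, rfl⟩
    refine ⟨fun g => LinearMap.ext fun x => ?_, LinearMap.ext fun x => ?_⟩
    · change doubleRep ρ α K g (Φ q x) = Φ q (doubleRep ρ α K g x)
      rw [hΦ, hΦ, doubleRep_apply, doubleRep_apply]
      simp only [map_add, map_smul, hSρ, hαα]
    · change swapEnd K E (Φ q x) = Φ q (swapEnd K E x)
      rw [hΦ, hΦ, swapEnd_apply, swapEnd_apply]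
  · rintro ⟨h1, h2⟩
    have h1' : ∀ g x, doubleRep ρ α K g (T x) = T (doubleRep ρ α K g x) := fun g x =>
      LinearMap.congr_fun (h1 g) x
    have h2' : ∀ x, swapEnd K E (T x) = T (swapEnd K E x) := LinearMap.congr_fun h2
    obtain ⟨l, hl⟩ := exists_smul_of_commute hspan
      (T := LinearMap.fst K E E ∘ₗ T ∘ₗ LinearMap.inl K E E) (fun g v => by
        have h3 := congrArg Prod.fst (h1' g (v, 0))
        simp only [doubleRep_apply, map_zero] at h3
        exact h3.symm)
    obtain ⟨l', hl'⟩ := exists_smul_of_commute hspan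
      (T := LinearMap.fst K E E ∘ₗ T ∘ₗ LinearMap.inr K E E ∘ₗ S) (fun g v => by
        have h3 := congrArg Prod.fst (h1' g (0, S v))
        simp only [doubleRep_apply, map_zero] at h3
        change (T (0, S (ρ g v))).1 = _
        rw [hSρ]
        exact h3.symm)
    have hc : (c : K) ≠ 0 := c.ne_zero
    have hT1 : ∀ x, (T x).1 = l • x.1 + (algebraMap K L (c : K)⁻¹ * l') • S x.2 := by
      intro x
      -- `S` is invertible with inverse `c⁻¹ S`, so any second component lies in the image of `S`.
      have h4 : x = (x.1, 0) + (c : K)⁻¹ • (0, S (S x.2)) := by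
        refine Prod.ext (by simp) ?_
        rw [hSS]
        simp [Units.smul_def, smul_smul, hc]
      conv_lhs => rw [h4, map_add, map_smul]
      have h5 : (T (x.1, 0)).1 = l • x.1 := hl x.1
      have h6 : (T (0, S (S x.2))).1 = l' • S x.2 := hl' (S x.2)
      rw [Prod.fst_add, Prod.smul_fst, h5, h6, mul_smul, algebraMap_smul]
    obtain ⟨a, b, hab⟩ := hσ.exists_eq_add hs0 hs l
    obtain ⟨a', b', hab'⟩ := hσ.exists_eq_add hs0 hs (algebraMap K L (c : K)⁻¹ * l')
    refine ⟨⟨a, b, a', b'⟩, LinearMap.ext fun x => ?_⟩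
    change Φ _ x = T x
    rw [hΦ, ← hab, ← hab']
    refine Prod.ext (hT1 x).symm ?_
    have h7 := congrArg Prod.fst (h2' x)
    rw [hT1] at h7
    exact h7.symm

variable (ρ)

/-- Equivalent representations have isomorphic endomorphism algebras. -/
theorem nonempty_endomorphismAlgebra_equiv {Γ U W : Type*} [Group Γ] [AddCommGroup U] [Module K U]
    [AddCommGroup W] [Module K W] {τ : Representation K Γ U} {τ' : Representation K Γ W}
    (e : τ.Equiv τ') : Nonempty (endomorphismAlgebra K τ ≃ₐ[K] endomorphismAlgebra K τ') := by
  have he : ∀ g, e.toLinearEquiv.conjAlgEquiv K (τ g) = τ' g := fun g => LinearMap.ext fun w => by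
    have := LinearMap.congr_fun (e.toIntertwiningMap.isIntertwining' g) (e.toLinearEquiv.symm w)
    exact this.trans (congrArg (τ' g) (e.toLinearEquiv.apply_symm_apply w))
  refine ⟨AlgEquiv.subalgebraCongr (e.toLinearEquiv.conjAlgEquiv K) _ _ fun x => ?_⟩
  simp only [endomorphismAlgebra, Subalgebra.mem_centralizer_iff, Set.forall_mem_range, ← he]
  refine forall_congr' fun g => ?_
  rw [← map_mul, ← map_mul, (AlgEquiv.injective _).eq_iff]

end Endomorphisms

/-! ### Matrix representations affording an irreducible character -/

section Concrete

variable {K L : Type*} [Field K] [CharZero K] [Field L] [Algebra K L] {σ : L ≃ₐ[K] L} {c : Kˣ}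
  {G : Type u} [Group G] {n : Type*} [Fintype n] [DecidableEq n] {R : G →* Matrix n n L}
  {α : MulAut G} {P : Matrix n n L}

/-- The entrywise image of a matrix representation under a homomorphism of fields. -/
def mapHom {F E : Type*} [Field F] [Field E] (f : F →+* E) (R : G →* Matrix n n F) :
    G →* Matrix n n E :=
  f.mapMatrix.toMonoidHom.comp R

theorem mapHom_apply {F E : Type*} [Field F] [Field E] (f : F →+* E) (R : G →* Matrix n n F)
    (g : G) : mapHom f R g = (R g).map f := rfl

theorem trace_mapHom {F E : Type*} [Field F] [Field E] (f : F →+* E) (R : G →* Matrix n n F)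
    (g : G) : (mapHom f R g).trace = f (R g).trace := by
  rw [mapHom_apply]
  simp [Matrix.trace, map_sum]

/-- Schur's lemma for a matrix representation affording an irreducible character. -/
theorem hasScalarCommutant_of_isIrreducibleCharacter [Finite G] {χ : G → ℂ}
    (hχ : IsIrreducibleCharacter χ) (f : L →+* ℂ) (hR : ∀ g, f (R g).trace = χ g) :
    HasScalarCommutant R := by
  obtain ⟨k, τ, hτ, hτχ⟩ := hχ
  obtain ⟨e⟩ := (matrixRep (mapHom f R)).nonempty_equiv_of_character_eq τ (by
    rw [hτχ]
    funext g
    rw [character_matrixRep, trace_mapHom, hR])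
  intro T hT
  have he : ∀ g v, e.toLinearEquiv (matrixRep (mapHom f R) g v) = τ g (e.toLinearEquiv v) :=
    fun g v => LinearMap.congr_fun (e.toIntertwiningMap.isIntertwining' g) v
  have he' : ∀ g w, e.toLinearEquiv.symm (τ g w) =
      matrixRep (mapHom f R) g (e.toLinearEquiv.symm w) := by
    intro g w
    rw [LinearEquiv.symm_apply_eq, he, LinearEquiv.apply_symm_apply]
  have hT' : ∀ g v, Matrix.toLin' (T.map f) (matrixRep (mapHom f R) g v) =
      matrixRep (mapHom f R) g (Matrix.toLin' (T.map f) v) := by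
    intro g v
    have h1 := congrArg f.mapMatrix (hT g)
    rw [map_mul, map_mul] at h1
    rw [matrixRep_apply, ← Matrix.toLin'_mul_apply, ← Matrix.toLin'_mul_apply]
    exact congrArg (fun A => Matrix.toLin' A v) h1
  let S : Representation.IntertwiningMap τ τ :=
    { toLinearMap := e.toLinearEquiv.toLinearMap ∘ₗ Matrix.toLin' (T.map f) ∘ₗ
        e.toLinearEquiv.symm.toLinearMap
      isIntertwining' := fun g => LinearMap.ext fun w => by
        change e.toLinearEquiv (Matrix.toLin' (T.map f) (e.toLinearEquiv.symm (τ g w))) =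
          τ g (e.toLinearEquiv (Matrix.toLin' (T.map f) (e.toLinearEquiv.symm w)))
        rw [he', hT', he] }
  obtain ⟨l, hl⟩ :=
    (Representation.IsIrreducible.algebraMap_intertwiningMap_bijective_of_isAlgClosed (ρ := τ)).2 S
  have hS : ∀ v, Matrix.toLin' (T.map f) v = l • v := by
    intro v
    have h1 : S.toLinearMap (e.toLinearEquiv v) = l • e.toLinearEquiv v := by
      rw [← hl]
      rfl
    apply e.toLinearEquiv.injective
    rw [map_smul, ← h1]
    change _ = e.toLinearEquiv (Matrix.toLin' (T.map f)
      (e.toLinearEquiv.symm (e.toLinearEquiv v)))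
    rw [LinearEquiv.symm_apply_apply]
  have hS' : ∀ i j, f (T i j) = if i = j then l else 0 := by
    intro i j
    have h1 := congrFun (hS (Pi.single j 1)) i
    simpa [Pi.single_apply] using h1
  cases isEmpty_or_nonempty n
  · exact ⟨0, Subsingleton.elim _ _⟩
  obtain ⟨i₀⟩ := ‹Nonempty n›
  -- The complex scalar is the image of a diagonal entry of `T`, so it already comes from `L`.
  refine ⟨T i₀ i₀, Matrix.ext fun i j => f.injective ?_⟩
  rw [hS', Matrix.smul_apply, smul_eq_mul, map_mul, hS', if_pos rfl, Matrix.one_apply]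
  split_ifs <;> simp

/-- Equivalent matrix representations are conjugate. -/
theorem exists_conj_of_trace_eq {F : Type*} [Field F] [CharZero F] [Finite G]
    (R₁ R₂ : G →* Matrix n n F) (h : ∀ g, (R₁ g).trace = (R₂ g).trace) :
    ∃ P : Matrix n n F, P.det ≠ 0 ∧ ∀ g, P * R₁ g = R₂ g * P := by
  obtain ⟨e⟩ := (matrixRep R₁).nonempty_equiv_of_character_eq (matrixRep R₂) (by
    funext g
    rw [character_matrixRep, character_matrixRep, h])
  refine ⟨LinearMap.toMatrix' e.toLinearEquiv.toLinearMap, ?_, fun g => ?_⟩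
  · have h1 : LinearMap.toMatrix' e.toLinearEquiv.toLinearMap *
        LinearMap.toMatrix' e.toLinearEquiv.symm.toLinearMap = 1 := by
      rw [← LinearMap.toMatrix'_comp, ← LinearMap.toMatrix'_id]
      exact congrArg _ (LinearMap.ext fun v => e.toLinearEquiv.apply_symm_apply v)
    exact ((Matrix.isUnit_iff_isUnit_det _).1 (IsUnit.of_mul_eq_one _ h1)).ne_zero
  · apply Matrix.toLin'.injective
    rw [Matrix.toLin'_mul, Matrix.toLin'_mul, Matrix.toLin'_toMatrix']
    exact LinearMap.ext fun v =>
      LinearMap.congr_fun (e.toIntertwiningMap.isIntertwining' g) v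

variable (R α P σ) in
/-- `P` intertwines the conjugate of `R` with `R ∘ α`. -/
def IsSemilinearIntertwiner : Prop :=
  ∀ g, P * σ.mapMatrix (R g) = R (α g) * P

/-- `σ(R)` and `R ∘ α` have the same character, hence are conjugate by some `P`. Since `α² = 1`, `P
σ(P)` commutes with `R` and is a scalar `l`; associativity of `P σ(P) P` forces `σ(l) = l`. -/
theorem exists_isTwist [Nonempty n] [Finite G] (hσ : IsConjugation σ) (hR : HasScalarCommutant R)
    (hα : α ^ 2 = 1) (hRα : ∀ g, (R (α g)).trace = σ (R g).trace) :
    ∃ (P : Matrix n n L) (c : Kˣ), IsTwist σ P c ∧ IsSemilinearIntertwiner σ R α P := by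
  have := IsConjugation.charZero K L
  have hαα : ∀ g, α (α g) = g := fun g => by simpa [pow_two] using DFunLike.congr_fun hα g
  obtain ⟨P, hP0, hP⟩ := exists_conj_of_trace_eq (mapHom (σ : L →+* L) R) (R.comp α.toMonoidHom)
    fun g => (trace_mapHom _ _ _).trans (hRα g).symm
  have hP' : IsSemilinearIntertwiner σ R α P := hP
  have hP2 : ∀ g, σ.mapMatrix P * R g = σ.mapMatrix (R (α g)) * σ.mapMatrix P := by
    intro g
    rw [← map_mul, ← hP' g, map_mul, IsTwist.mapMatrix_mapMatrix hσ]
  obtain ⟨l, hl⟩ := hR (P * σ.mapMatrix P) (by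
    intro g
    rw [mul_assoc, hP2, ← mul_assoc, hP' (α g), hαα, mul_assoc])
  have hl2 : σ.mapMatrix P * P = σ l • 1 := by
    have h := congrArg σ.mapMatrix hl
    rwa [map_mul, IsTwist.mapMatrix_mapMatrix hσ, mapMatrix_smul, map_one] at h
  have hPne : P ≠ 0 := by
    rintro rfl
    exact hP0 Matrix.det_zero
  obtain ⟨k, rfl⟩ := hσ.fixed l (by
    have h1 : P * σ.mapMatrix P * P = P * (σ.mapMatrix P * P) := mul_assoc _ _ _
    rw [hl, hl2, smul_mul_assoc, one_mul, mul_smul_comm, mul_one] at h1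
    exact (smul_left_injective L hPne h1).symm)
  have hk : k ≠ 0 := by
    rintro rfl
    have h1 := congrArg Matrix.det hl
    rw [map_zero, zero_smul, Matrix.det_zero, Matrix.det_mul, IsTwist.det_mapMatrix] at h1
    exact mul_ne_zero hP0 ((map_ne_zero σ).2 hP0) h1
  refine ⟨P, Units.mk0 k hk, ?_, hP'⟩
  rw [IsTwist, hl, Algebra.algebraMap_eq_smul_one (A := Matrix n n L), Units.val_mk0, algebraMap_smul]

/-- The fixed algebra of a matrix representation is a twisted form. -/
theorem span_range_add_eq_twistedForm (hσ : IsConjugation σ) (hα : α ^ 2 = 1)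
    (hP : IsTwist σ P c) (hPR : IsSemilinearIntertwiner σ R α P)
    (hspan : Submodule.span K (Set.range R) = ⊤) :
    Submodule.span K (Set.range fun g => R g + R (α g)) =
      Subalgebra.toSubmodule (twistedForm σ P) := by
  have hαα : ∀ g, α (α g) = g := fun g => by simpa [pow_two] using DFunLike.congr_fun hα g
  apply le_antisymm
  · rw [Submodule.span_le]
    rintro _ ⟨g, rfl⟩
    change _ * P = P * _
    rw [map_add, mul_add, hPR, hPR, hαα, add_mul, add_comm]
  · intro f hf
    have hf2 : IsTwist.theta σ P P c f = f := (IsTwist.theta_eq_iff hσ hP f).2 hf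
    -- `theta` exchanges `R g` and `R (α g)`, so `f + theta f` always lies in the left-hand span; a
    -- fixed `f` is half of this sum.
    have key : ∀ f ∈ Submodule.span K (Set.range R), f + IsTwist.theta σ P P c f ∈
        Submodule.span K (Set.range fun g => R g + R (α g)) := by
      intro f hf
      induction hf using Submodule.span_induction with
      | mem f hf =>
        obtain ⟨g, rfl⟩ := hf
        have : IsTwist.theta σ P P c (R g) = R (α g) := by
          rw [IsTwist.theta_apply, hPR, mul_assoc, hP.eq, ← Algebra.commutes (c : K), ← mul_assoc,
            IsTwist.inv_mul_self, one_mul]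
        rw [this]
        exact Submodule.subset_span ⟨g, rfl⟩
      | zero => simp
      | add x y _ _ hx hy =>
        rw [map_add, add_add_add_comm]
        exact Submodule.add_mem _ hx hy
      | smul a x _ hx =>
        rw [← algebraMap_smul L a x, IsTwist.theta_smul, AlgEquiv.commutes, ← smul_add,
          algebraMap_smul]
        exact Submodule.smul_mem _ _ hx
    have h1 := key f (hspan ▸ Submodule.mem_top)
    rw [hf2, ← two_smul K] at h1
    exact (Submodule.smul_mem_iff _ two_ne_zero).1 h1

/-- An invariant Hermitian form gives an invariant pairing. -/
theorem isInvariantPairing_mul (hσ : IsConjugation σ) (hα : α ^ 2 = 1)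
    (hPR : IsSemilinearIntertwiner σ R α P) {h : Matrix n n L}
    (hh : ∀ g, (R g).transpose * h * σ.mapMatrix (R g) = h) :
    IsInvariantPairing R α (h * σ.mapMatrix P) := by
  intro g
  have hαα : α (α g) = g := by simpa [pow_two] using DFunLike.congr_fun hα g
  have h1 : σ.mapMatrix P * R (α g) = σ.mapMatrix (R g) * σ.mapMatrix P := by
    have h2 := hPR (α g)
    rw [hαα] at h2
    rw [← map_mul, ← h2, map_mul, IsTwist.mapMatrix_mapMatrix hσ]
  rw [mul_assoc, mul_assoc, h1, ← mul_assoc, ← mul_assoc, hh]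

theorem IsInvariantPairing.map {F E : Type*} [Field F] [Field E] {R : G →* Matrix n n F}
    {M : Matrix n n F} (f : F →+* E) (hM : IsInvariantPairing R α M) :
    IsInvariantPairing (mapHom f R) α (M.map f) := by
  intro g
  have h := congrArg f.mapMatrix (hM g)
  rwa [map_mul, map_mul] at h

end Concrete

/-! ### Gram matrices of Hermitian forms -/

namespace HermitianForm

variable {K : Type*} [Field K] [CharZero K] {L : Type*} [Field L] [Algebra K L] {σ : L ≃ₐ[K] L}
  {V : Type*} [AddCommGroup V] [Module L V] {n : Type*} [Fintype n] [DecidableEq n]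
  (H : HermitianForm σ V) (b : Module.Basis n L V)

/-- The Gram matrix of a Hermitian form. -/
def gram : Matrix n n L := Matrix.of fun i j => H.form (b i) (b j)

theorem transpose_gram : (H.gram b).transpose = σ.mapMatrix (H.gram b) :=
  Matrix.ext fun _ _ => H.symm _ _

theorem form_sum_left (a : n → L) (u : n → V) (w : V) :
    H.form (∑ i, a i • u i) w = ∑ i, a i * H.form (u i) w := by
  change H.toDual w _ = _
  simp only [map_sum, map_smul, smul_eq_mul]
  rfl

theorem form_sum_right (a : n → L) (u : n → V) (w : V) :
    H.form w (∑ i, a i • u i) = ∑ i, H.form w (u i) * σ (a i) := by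
  rw [H.symm, form_sum_left, map_sum]
  refine Finset.sum_congr rfl fun i _ => ?_
  rw [map_mul, ← H.symm, mul_comm]

theorem det_gram_ne_zero : (H.gram b).det ≠ 0 := by
  intro h0
  obtain ⟨v, hv, hv0⟩ := Matrix.exists_vecMul_eq_zero_iff.2 h0
  have h1 : ∑ i, v i • b i = 0 := by
    refine H.nondegenerate _ fun w => ?_
    rw [← b.sum_repr w, form_sum_right]
    refine Finset.sum_eq_zero fun j _ => ?_
    rw [form_sum_left]
    exact mul_eq_zero_of_left (congrFun hv0 j) _
  exact hv (funext (Fintype.linearIndependent_iff.1 b.linearIndependent v h1))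

theorem gram_eq (b' : Module.Basis n L V) :
    H.gram b' = (b.toMatrix b').transpose * H.gram b * σ.mapMatrix (b.toMatrix b') := by
  ext i j
  rw [Matrix.mul_assoc, Matrix.mul_apply]
  change H.form (b' i) (b' j) = _
  conv_lhs => rw [← b.sum_toMatrix_smul_self b' i, form_sum_left]
  refine Finset.sum_congr rfl fun k _ => ?_
  rw [← b.sum_toMatrix_smul_self b' j, form_sum_right]
  rfl

theorem transpose_toMatrix_mul_gram {f g : Module.End L V}
    (h : ∀ v w, H.form (f v) w = H.form v (g w)) :
    (LinearMap.toMatrix b b f).transpose * H.gram b =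
      H.gram b * σ.mapMatrix (LinearMap.toMatrix b b g) := by
  have h1 : ∀ (f : Module.End L V) i, f (b i) = ∑ k, LinearMap.toMatrix b b f k i • b k := by
    intro f i
    conv_lhs => rw [← b.sum_repr (f (b i))]
    simp only [LinearMap.toMatrix_apply]
  ext i j
  have h2 := h (b i) (b j)
  rw [h1 f, h1 g, form_sum_left, form_sum_right] at h2
  exact h2

theorem neg_one_pow_choose (L : Type*) [Ring L] (m : ℕ) :
    (-1 : L) ^ (2 * m).choose 2 = (-1) ^ m := by
  have h : (2 * m).choose 2 = m * (2 * m - 1) := by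
    rw [Nat.choose_two_right, mul_assoc, Nat.mul_div_cancel_left _ two_pos]
  rcases Nat.eq_zero_or_pos m with rfl | hm
  · simp
  · rw [h, mul_comm, pow_mul, Odd.neg_one_pow ⟨m - 1, by omega⟩]

/-- A change of basis multiplies the Gram determinant by the norm of the transition determinant, so
one basis decides the class. -/
theorem hasDisc_of_basis (hσ : IsConjugation σ) {m : ℕ} (hm : Module.finrank L V = 2 * m)
    (b : Module.Basis (Fin (Module.finrank L V)) L V) {x : Kˣ}
    (hx : ∃ y : L, (-1) ^ m * (H.gram b).det = algebraMap K L x * (y * σ y)) :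
    H.HasDisc (QuotientGroup.mk x) := by
  intro b'
  change ∃ d : Kˣ, algebraMap K L d = _ * (H.gram b').det ∧ _
  have h0 := H.det_gram_ne_zero b'
  obtain ⟨d, hd⟩ := hσ.fixed ((-1) ^ m * (H.gram b').det) (by
    rw [map_mul, map_pow, map_neg, map_one, ← IsTwist.det_mapMatrix, ← transpose_gram,
      Matrix.det_transpose])
  have hd0 : d ≠ 0 := by
    rintro rfl
    rw [map_zero] at hd
    exact mul_ne_zero (pow_ne_zero m (neg_ne_zero.2 one_ne_zero)) h0 hd.symm
  refine ⟨Units.mk0 d hd0, ?_, ?_⟩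
  · rw [Units.val_mk0, hd]
    congr 1
    rw [hm, neg_one_pow_choose]
  · rw [eq_comm, hσ.mk_eq_mk_iff, Units.val_mk0, hd]
    obtain ⟨y, hy⟩ := hx
    refine ⟨y * (b.toMatrix b').det, ?_⟩
    rw [H.gram_eq b b', Matrix.det_mul, Matrix.det_mul, Matrix.det_transpose,
      IsTwist.det_mapMatrix, map_mul]
    linear_combination (b.toMatrix b').det * σ (b.toMatrix b').det * hy

section Adjoint

variable [FiniteDimensional L V] [Module K V] [IsScalarTower K L V]

theorem adjoint_eq_of {f g : Module.End L V} (h : ∀ v w, H.form (f v) w = H.form v (g w)) :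
    H.adjoint (K := K) f = g :=
  LinearMap.ext fun w => H.ext_right fun v => by rw [← form_adjoint, h]

theorem adjoint_mul (f g : Module.End L V) :
    H.adjoint (K := K) (f * g) = H.adjoint g * H.adjoint f :=
  H.adjoint_eq_of fun v w => by
    rw [Module.End.mul_apply, Module.End.mul_apply, H.form_adjoint (K := K) f,
      H.form_adjoint (K := K) g]

theorem adjoint_adjoint (f : Module.End L V) : H.adjoint (K := K) (H.adjoint f) = f :=
  H.adjoint_eq_of fun v w => by rw [H.symm, ← H.form_adjoint (K := K) f, ← H.symm]

variable {G : Type*} [Group G] {ρ : Representation L G V}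

theorem form_rep (hH : ∀ g x y, H.form (ρ g x) (ρ g y) = H.form x y) (g : G) (v w : V) :
    H.form (ρ g v) w = H.form v (ρ g⁻¹ w) := by
  rw [← hH g⁻¹, ← Module.End.mul_apply, ← map_mul, inv_mul_cancel, map_one, Module.End.one_apply]

/-- The adjoint of `ρ g` is `ρ g⁻¹`, so taking adjoints permutes the spanning set. -/
theorem map_adjoint_fixedAlgebra (hH : ∀ g x y, H.form (ρ g x) (ρ g y) = H.form x y)
    (α : MulAut G) (hα : α ^ 2 = 1) :
    (Subalgebra.toSubmodule (fixedAlgebra K ρ α hα)).map H.adjoint =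
      Subalgebra.toSubmodule (fixedAlgebra K ρ α hα) := by
  have h1 : Subalgebra.toSubmodule (fixedAlgebra K ρ α hα) =
      Submodule.span K (Set.range fun g : G => ρ g + ρ (α g)) := rfl
  rw [h1, Submodule.map_span, ← Set.range_comp]
  congr 1
  have h2 : (⇑(H.adjoint (K := K)) ∘ fun g => ρ g + ρ (α g)) =
      (fun g => ρ g + ρ (α g)) ∘ (Equiv.inv G) := by
    funext g
    simp only [Function.comp_apply, map_add, Equiv.inv_apply, map_inv α]
    rw [H.adjoint_eq_of (H.form_rep hH g), H.adjoint_eq_of (H.form_rep hH (α g))]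
  rw [h2, (Equiv.inv G).surjective.range_comp]

end Adjoint

end HermitianForm

/-! ### The fixed algebra as a twisted form -/

section FixedAlgebra

variable {K L : Type u} [Field K] [CharZero K] [Field L] [Algebra K L] {σ : L ≃ₐ[K] L} {c : Kˣ}
  {V : Type*} [AddCommGroup V] [Module L V] [Module K V] [IsScalarTower K L V]
  {G : Type*} [Group G] {n : ℕ} (b : Module.Basis (Fin n) L V) {ρ : Representation L G V}
  {α : MulAut G} (hα : α ^ 2 = 1) {P : Matrix (Fin n) (Fin n) L}

/-- The matrix representation of `ρ` with respect to a basis. -/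
def matrixHom (ρ : Representation L G V) : G →* Matrix (Fin n) (Fin n) L :=
  (LinearMap.toMatrixAlgEquiv b : Module.End L V ≃ₐ[L] _).toMonoidHom.comp ρ

theorem matrixHom_apply (g : G) : matrixHom b ρ g = LinearMap.toMatrix b b (ρ g) := rfl

theorem trace_matrixHom (g : G) : (matrixHom b ρ g).trace = ρ.character g :=
  (LinearMap.trace_eq_matrix_trace L b (ρ g)).symm

variable (K) in
/-- Matrices of endomorphisms with respect to a basis. -/
def toMatrixK : Module.End L V ≃ₐ[K] Matrix (Fin n) (Fin n) L :=
  (LinearMap.toMatrixAlgEquiv b : Module.End L V ≃ₐ[L] _).restrictScalars K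

theorem span_range_rep_eq_top
    (hspan : Submodule.span K (Set.range (matrixHom b ρ)) = ⊤) :
    Submodule.span K (Set.range ρ) = ⊤ := by
  have h1 : (Submodule.span K (Set.range ρ)).map (toMatrixK K b).toLinearMap = ⊤ := by
    rw [Submodule.map_span, ← Set.range_comp]
    exact hspan
  rw [eq_top_iff]
  intro f _
  have hf : toMatrixK K b f ∈ (⊤ : Submodule K (Matrix (Fin n) (Fin n) L)) := trivial
  rw [← h1] at hf
  obtain ⟨f', hf', hff⟩ := hf
  rwa [← (toMatrixK K b).injective hff]

theorem toMatrixK_mem_twistedForm_iff (hσ : IsConjugation σ) (hP : IsTwist σ P c)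
    (hPR : IsSemilinearIntertwiner σ (matrixHom b ρ) α P)
    (hspan : Submodule.span K (Set.range (matrixHom b ρ)) = ⊤) (f : Module.End L V) :
    toMatrixK K b f ∈ twistedForm σ P ↔ f ∈ fixedAlgebra K ρ α hα := by
  have h1 : (Subalgebra.toSubmodule (fixedAlgebra K ρ α hα)).map (toMatrixK K b).toLinearMap =
      Subalgebra.toSubmodule (twistedForm σ P) := by
    rw [← span_range_add_eq_twistedForm hσ hα hP hPR hspan]
    change (Submodule.span K (Set.range fun g : G => ρ g + ρ (α g))).map _ = _
    rw [Submodule.map_span, ← Set.range_comp]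
    congr 2
    funext g
    exact map_add (toMatrixK K b) _ _
  rw [← Subalgebra.mem_toSubmodule, ← h1, ← Subalgebra.mem_toSubmodule]
  constructor
  · rintro ⟨f', hf', hff⟩
    rwa [← (toMatrixK K b).injective hff]
  · intro hf
    exact ⟨f, hf, rfl⟩

/-- The fixed algebra is isomorphic to a twisted form. -/
def fixedAlgebraEquiv (hσ : IsConjugation σ) (hP : IsTwist σ P c)
    (hPR : IsSemilinearIntertwiner σ (matrixHom b ρ) α P)
    (hspan : Submodule.span K (Set.range (matrixHom b ρ)) = ⊤) :
    fixedAlgebra K ρ α hα ≃ₐ[K] twistedForm σ P :=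
  AlgEquiv.subalgebraCongr (toMatrixK K b) _ _
    (toMatrixK_mem_twistedForm_iff b hα hσ hP hPR hspan)

/-- `L` is a splitting field: descent identifies `L ⊗ A` with the full matrix algebra, `1 ⊗ a` going
to the matrix of `a`. -/
theorem isReducedNorm_det (hσ : IsConjugation σ) (hP : IsTwist σ P c)
    (hPR : IsSemilinearIntertwiner σ (matrixHom b ρ) α P)
    (hspan : Submodule.span K (Set.range (matrixHom b ρ)) = ⊤) (a : fixedAlgebra K ρ α hα) {r : K}
    (hr : algebraMap K L r = (LinearMap.toMatrix b b (a : Module.End L V)).det) :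
    IsReducedNorm K a r := by
  refine ⟨L, inferInstance, inferInstance, n,
    (Algebra.TensorProduct.congr AlgEquiv.refl (fixedAlgebraEquiv b hα hσ hP hPR hspan)).trans
      (hP.baseChangeEquiv hσ), ?_⟩
  rw [AlgEquiv.trans_apply, Algebra.TensorProduct.congr_apply, Algebra.TensorProduct.map_tmul]
  erw [hP.baseChangeEquiv_tmul hσ]
  rw [hr]
  simp only [map_one, one_smul]
  rfl

theorem span_fixedAlgebra_eq_top (hσ : IsConjugation σ) (hP : IsTwist σ P c)
    (hPR : IsSemilinearIntertwiner σ (matrixHom b ρ) α P)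
    (hspan : Submodule.span K (Set.range (matrixHom b ρ)) = ⊤) :
    Submodule.span L (fixedAlgebra K ρ α hα : Set (Module.End L V)) = ⊤ := by
  rw [eq_top_iff]
  intro f _
  obtain ⟨s, hs0, hs⟩ := hσ.exists_skew
  obtain ⟨y, hy, z, hz, hyz⟩ := hP.exists_add hσ hs0 hs (LinearMap.toMatrix b b f)
  obtain ⟨y', rfl⟩ := (toMatrixK K b).surjective y
  obtain ⟨z', rfl⟩ := (toMatrixK K b).surjective z
  rw [toMatrixK_mem_twistedForm_iff b hα hσ hP hPR hspan] at hy hz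
  have h1 : f = y' + s • z' := by
    apply (LinearMap.toMatrix b b).injective
    rw [hyz, map_add, map_smul]
    rfl
  rw [h1]
  exact Submodule.add_mem _ (Submodule.subset_span hy)
    (Submodule.smul_mem _ _ (Submodule.subset_span hz))

variable [FiniteDimensional L V] (H : HermitianForm σ V)

/-- For `M = h σ(P)` and `f*` the adjoint of `f`, the relation `fᵀ h = h σ(f*)` gives `(M f)ᵀ = h
σ(f*) σ(P)`, while `M f = h σ(f) σ(P)`; now `h` and `σ(P)` cancel. -/
theorem toMatrix_mem_skewSubmodule_iff (hσ : IsConjugation σ) (hP : IsTwist σ P c)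
    (hM : (H.gram b * σ.mapMatrix P).transpose = H.gram b * σ.mapMatrix P) (f : Module.End L V)
    (hf : LinearMap.toMatrix b b f ∈ twistedForm σ P) :
    LinearMap.toMatrix b b f ∈ skewSubmodule (H.gram b * σ.mapMatrix P) ↔
      H.adjoint (K := K) f = -f := by
  have h0 := H.det_gram_ne_zero b
  have hP0 : (σ.mapMatrix P).det ≠ 0 := by
    rw [IsTwist.det_mapMatrix]
    exact (map_ne_zero σ).2 hP.det_ne_zero
  have h1 : H.gram b * σ.mapMatrix P * LinearMap.toMatrix b b f =
      H.gram b * σ.mapMatrix (LinearMap.toMatrix b b f) * σ.mapMatrix P := by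
    rw [mul_assoc, mul_assoc, IsTwist.mapMatrix_mul_mapMatrix hσ hf]
  have h2 := H.transpose_toMatrix_mul_gram b (f := f) (H.form_adjoint (K := K) f)
  rw [mem_skewSubmodule, Matrix.transpose_mul, hM, h1, ← mul_assoc, h2]
  constructor
  · intro h
    rw [← neg_mul, ← mul_neg, ← map_neg σ.mapMatrix] at h
    have h3 := (Matrix.isUnit_iff_isUnit_det _).2 hP0.isUnit
    have h4 := (Matrix.isUnit_iff_isUnit_det _).2 h0.isUnit
    have h5 := σ.mapMatrix.injective (h4.mul_left_cancel (h3.mul_right_cancel h))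
    rw [← map_neg] at h5
    exact (LinearMap.toMatrix b b).injective h5
  · intro h
    rw [h, map_neg, map_neg, mul_neg, neg_mul]

section Orthogonal

variable (hA : (Subalgebra.toSubmodule (fixedAlgebra K ρ α hα)).map H.adjoint =
  Subalgebra.toSubmodule (fixedAlgebra K ρ α hα))

theorem restrictSubalgebra_adjoint_eq_neg_iff (hσ : IsConjugation σ) (hP : IsTwist σ P c)
    (hPR : IsSemilinearIntertwiner σ (matrixHom b ρ) α P)
    (hspan : Submodule.span K (Set.range (matrixHom b ρ)) = ⊤)
    (hM : (H.gram b * σ.mapMatrix P).transpose = H.gram b * σ.mapMatrix P)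
    (a : fixedAlgebra K ρ α hα) :
    restrictSubalgebra H.adjoint (fixedAlgebra K ρ α hα) hA a = -a ↔
      LinearMap.toMatrix b b (a : Module.End L V) ∈ skewSubmodule (H.gram b * σ.mapMatrix P) := by
  rw [toMatrix_mem_skewSubmodule_iff b H hσ hP hM a
    ((toMatrixK_mem_twistedForm_iff b hα hσ hP hPR hspan a).2 a.2), Subtype.ext_iff]
  rfl

theorem isOrthogonalSubalgebra_fixedAlgebra [NeZero n]
    (hA : (Subalgebra.toSubmodule (fixedAlgebra K ρ α hα)).map H.adjoint =
      Subalgebra.toSubmodule (fixedAlgebra K ρ α hα)) (hσ : IsConjugation σ)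
    (hP : IsTwist σ P c)
    (hPR : IsSemilinearIntertwiner σ (matrixHom b ρ) α P)
    (hspan : Submodule.span K (Set.range (matrixHom b ρ)) = ⊤)
    (hM : (H.gram b * σ.mapMatrix P).transpose = H.gram b * σ.mapMatrix P) :
    IsOrthogonalSubalgebra K L H.adjoint (fixedAlgebra K ρ α hα) := by
  let e := fixedAlgebraEquiv b hα hσ hP hPR hspan
  refine ⟨(hP.isCentralSimple hσ).of_algEquiv e.symm, span_fixedAlgebra_eq_top b hα hσ hP hPR hspan,
    hA, ⟨fun a a' => Subtype.ext (H.adjoint_mul _ _), fun a => Subtype.ext (H.adjoint_adjoint _)⟩,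
    n, ?_, ?_⟩
  · rw [e.toLinearEquiv.finrank_eq, hP.finrank_twistedForm hσ, Fintype.card_fin]
  · let S := skewSpace K (restrictSubalgebra H.adjoint (fixedAlgebra K ρ α hα) hA)
    let φ : fixedAlgebra K ρ α hα →ₗ[K] Matrix (Fin n) (Fin n) L :=
      (twistedForm σ P).val.toLinearMap ∘ₗ e.toLinearMap
    have hφ : Function.Injective φ := Subtype.val_injective.comp e.injective
    change Module.finrank K S = _
    rw [(Submodule.equivMapOfInjective φ hφ S).finrank_eq]
    refine hP.finrank_twistedForm_inf_skewSubmodule hσ (H.transpose_gram b)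
      (H.det_gram_ne_zero b) hM _ fun x => ?_
    constructor
    · rintro ⟨a, ha, rfl⟩
      exact ⟨(restrictSubalgebra_adjoint_eq_neg_iff b hα H hA hσ hP hPR hspan hM a).1 ha, (e a).2⟩
    · rintro ⟨hx1, hx2⟩
      obtain ⟨a, ha⟩ := e.surjective ⟨x, hx2⟩
      have hax : φ a = x := congrArg Subtype.val ha
      refine ⟨a, (restrictSubalgebra_adjoint_eq_neg_iff b hα H hA hσ hP hPR hspan hM a).2 ?_, hax⟩
      rw [← hax] at hx1
      exact hx1

/-- Take `d = (-1)^m det a` for one invertible skew `a`. Any other invertible skew element changes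
the determinant by a square of `K` (`IsTwist.exists_sq_mul_det_eq`). -/
theorem exists_hasInvolutionDisc {m : ℕ} (hn : n = 2 * m) (hσ : IsConjugation σ)
    (hP : IsTwist σ P c)
    (hPR : IsSemilinearIntertwiner σ (matrixHom b ρ) α P)
    (hspan : Submodule.span K (Set.range (matrixHom b ρ)) = ⊤)
    (hM : (H.gram b * σ.mapMatrix P).transpose = H.gram b * σ.mapMatrix P) :
    ∃ d : Kˣ, HasInvolutionDisc K (restrictSubalgebra H.adjoint (fixedAlgebra K ρ α hα) hA)
        (QuotientGroup.mk d) ∧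
      ∃ x : L, (-1) ^ m * (H.gram b).det = algebraMap K L (c ^ m * d : Kˣ) * (x * σ x) := by
  have hcard : Fintype.card (Fin n) = 2 * m := by rw [Fintype.card_fin, hn]
  let e := fixedAlgebraEquiv b hα hσ hP hPR hspan
  have hh := H.transpose_gram b
  have h0 := H.det_gram_ne_zero b
  obtain ⟨a, ha, haM, ha0⟩ := hP.exists_mem_skewSubmodule hσ hcard hh h0 hM
  have hunit : ∀ u : (fixedAlgebra K ρ α hα)ˣ,
      (LinearMap.toMatrix b b ((u : fixedAlgebra K ρ α hα) : Module.End L V)).det ≠ 0 := by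
    intro u
    have h1 : (e u : Matrix (Fin n) (Fin n) L) * (e (u⁻¹ : (fixedAlgebra K ρ α hα)ˣ)) = 1 := by
      rw [← Subalgebra.coe_mul, ← map_mul, Units.mul_inv, map_one]
      rfl
    exact ((Matrix.isUnit_iff_isUnit_det _).1 (IsUnit.of_mul_eq_one _ h1)).ne_zero
  obtain ⟨r, hr⟩ := hP.exists_algebraMap_eq_det hσ ha
  have hr0 : r ≠ 0 := by
    rintro rfl
    rw [map_zero] at hr
    exact ha0 hr.symm
  refine ⟨(-1) ^ m * Units.mk0 r hr0, ⟨m, ?_, ?_, fun u hu => ?_⟩, ?_⟩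
  · rw [e.toLinearEquiv.finrank_eq, hP.finrank_twistedForm hσ, hcard]
  · obtain ⟨a', ha'⟩ := e.surjective ⟨a, ha⟩
    -- The inverse must lie in the fixed algebra: left multiplication is injective on this
    -- finite-dimensional space, hence surjective.
    have hinj : Function.Injective (LinearMap.mulLeft K a') := by
      intro x y hxy
      have h1 : (e a' : Matrix (Fin n) (Fin n) L) * e x = e a' * e y := by
        rw [← Subalgebra.coe_mul, ← Subalgebra.coe_mul, ← map_mul, ← map_mul]
        exact congrArg (fun z => (e z : Matrix (Fin n) (Fin n) L)) hxy
      rw [ha'] at h1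
      have h2 := ((Matrix.isUnit_iff_isUnit_det _).2 ha0.isUnit).mul_left_cancel h1
      exact e.injective (Subtype.ext h2)
    have : FiniteDimensional K (fixedAlgebra K ρ α hα) := by
      have := IsTwist.finite_twistedForm (P := P) hσ
      exact Module.Finite.equiv e.symm.toLinearEquiv
    obtain ⟨a'', ha''⟩ := LinearMap.surjective_of_injective hinj 1
    have hu : IsUnit a' := by
      refine ⟨⟨a', a'', ha'', hinj ?_⟩, rfl⟩
      change a' * (a'' * a') = a' * 1
      rw [← mul_assoc, show a' * a'' = 1 from ha'', one_mul, mul_one]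
    refine ⟨hu.unit, (restrictSubalgebra_adjoint_eq_neg_iff b hα H hA hσ hP hPR hspan hM _).2 ?_⟩
    have h3 : LinearMap.toMatrix b b (a' : Module.End L V) = a := congrArg Subtype.val ha'
    rw [IsUnit.unit_spec, h3]
    exact haM
  · have hu1 := (restrictSubalgebra_adjoint_eq_neg_iff b hα H hA hσ hP hPR hspan hM _).1 hu
    have hu2 := (e u).2
    obtain ⟨t, ht⟩ := hP.exists_sq_mul_det_eq hσ hcard hh h0 hM ha ha0 haM hu2 (hunit u) hu1
    have ht0 : t ≠ 0 := by
      rintro rfl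
      rw [map_zero, zero_pow two_ne_zero, zero_mul] at ht
      exact hunit u ht.symm
    refine ⟨Units.mk0 t ht0 ^ 2 * Units.mk0 r hr0,
      isReducedNorm_det b hα hσ hP hPR hspan _ ?_, ?_⟩
    · rw [Units.val_mul, Units.val_pow_eq_pow_val, Units.val_mk0, Units.val_mk0, map_mul, map_pow,
        hr, ht]
      rfl
    · rw [QuotientGroup.eq]
      refine ⟨(Units.mk0 t ht0)⁻¹, ?_⟩
      rw [powMonoidHom_apply]
      ext
      simp
  · obtain ⟨x, hx⟩ := hP.exists_det_eq_of_transpose_eq hσ hcard hh h0 hM ha ha0 haM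
    refine ⟨x, ?_⟩
    rw [hx, ← hr]
    simp only [Units.val_mul, Units.val_pow_eq_pow_val, Units.val_neg, Units.val_one, Units.val_mk0,
      map_mul, map_pow, map_neg, map_one]
    ring

end Orthogonal

end FixedAlgebra

/-! ### The theorem for an abstract quadratic conjugation -/

section Main

variable {K L : Type u} [Field K] [CharZero K] [Field L] [Algebra K L] {σ : L ≃ₐ[K] L} {c : Kˣ}
  {V : Type*} [AddCommGroup V] [Module L V] [Module K V] [IsScalarTower K L V]
  {G : Type*} [Group G] {n : ℕ} (b : Module.Basis (Fin n) L V) {ρ : Representation L G V}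
  {α : MulAut G} {P : Matrix (Fin n) (Fin n) L}

theorem equivFun_rep (g : G) (v : V) :
    b.equivFun (ρ g v) = (matrixHom b ρ g).mulVec (b.equivFun v) := by
  rw [matrixHom_apply]
  exact (LinearMap.toMatrix_mulVec_repr b b (ρ g) v).symm

/-- The semilinear map with matrix `P`. -/
def semilinearMap (σ : L ≃ₐ[K] L) (P : Matrix (Fin n) (Fin n) L) : V →ₗ[K] V where
  toFun v := b.equivFun.symm (P.mulVec (σ ∘ b.equivFun v))
  map_add' v w := by
    rw [← map_add, ← Matrix.mulVec_add]
    congr 2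
    funext i
    simp
  map_smul' k v := by
    rw [RingHom.id_apply, ← algebraMap_smul L k v, ← algebraMap_smul L k (b.equivFun.symm _),
      ← map_smul, ← Matrix.mulVec_smul]
    congr 2
    funext i
    simp only [Function.comp_apply, Pi.smul_apply, map_smul b.equivFun, smul_eq_mul, map_mul,
      AlgEquiv.commutes]

theorem equivFun_semilinearMap (v : V) :
    b.equivFun (semilinearMap b σ P v) = P.mulVec (σ ∘ b.equivFun v) :=
  b.equivFun.apply_symm_apply _

theorem semilinearMap_smul (l : L) (v : V) :
    semilinearMap b σ P (l • v) = σ l • semilinearMap b σ P v := by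
  apply b.equivFun.injective
  rw [equivFun_semilinearMap, map_smul b.equivFun (σ l), equivFun_semilinearMap,
    ← Matrix.mulVec_smul]
  congr 1
  funext i
  simp

theorem comp_mulVec (A : Matrix (Fin n) (Fin n) L) (x : Fin n → L) :
    σ ∘ A.mulVec x = (σ.mapMatrix A).mulVec (σ ∘ x) := by
  funext i
  simp [Matrix.mulVec, dotProduct]

theorem semilinearMap_semilinearMap (hσ : IsConjugation σ) (hP : IsTwist σ P c) (v : V) :
    semilinearMap b σ P (semilinearMap b σ P v) = c • v := by
  apply b.equivFun.injective
  rw [equivFun_semilinearMap, equivFun_semilinearMap, comp_mulVec, Matrix.mulVec_mulVec,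
    hP.smul_one, Matrix.smul_mulVec, Matrix.one_mulVec, Units.smul_def,
    ← algebraMap_smul L (c : K) v, map_smul]
  congr 1
  funext i
  simp [hσ.involutive]

theorem semilinearMap_rep (hPR : IsSemilinearIntertwiner σ (matrixHom b ρ) α P) (g : G) (v : V) :
    semilinearMap b σ P (ρ g v) = ρ (α g) (semilinearMap b σ P v) := by
  apply b.equivFun.injective
  rw [equivFun_semilinearMap, equivFun_rep, equivFun_rep, equivFun_semilinearMap, comp_mulVec,
    Matrix.mulVec_mulVec, Matrix.mulVec_mulVec, hPR g]

variable [Finite G] [FiniteDimensional L V]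

/-- The endomorphism algebra depends only on the character, so it can be computed on the model `V ×
V`, with `S` the semilinear map of `P`; it is the quaternion algebra `(δ, c)`. -/
theorem nonempty_endomorphismAlgebra_equiv_twistedForm [Nontrivial V] (hσ : IsConjugation σ)
    (hP : IsTwist σ P c) (hPR : IsSemilinearIntertwiner σ (matrixHom b ρ) α P)
    (hspan : Submodule.span K (Set.range (matrixHom b ρ)) = ⊤) (hα : α ^ 2 = 1) (hα1 : α ≠ 1)
    (f : L →+* ℂ) {χ : G → ℂ} (hρ : ∀ g, f (ρ.character g) = χ g)
    (hρα : ∀ g, ρ.character (α g) = σ (ρ.character g)) {W : Type*} [AddCommGroup W] [Module K W]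
    [FiniteDimensional K W] (τ : Representation K (AutExtension α) W)
    (hτ : ∀ h, f (algebraMap K L (τ.character h)) = 2 * extensionCharacter α χ h) :
    Nonempty (endomorphismAlgebra K τ ≃ₐ[K] twistedForm σ (quaternionTwist L c)) := by
  have := hσ.finiteDimensional
  have : FiniteDimensional K V := FiniteDimensional.trans K L V
  have : Finite (AutExtension α) := by
    have : Finite (MulAut G) := Finite.of_injective (fun a : MulAut G => (a : G → G))
      DFunLike.coe_injective
    exact Finite.of_equiv _ SemidirectProduct.equivProd.symm
  obtain ⟨s, hs0, hs⟩ := hσ.exists_skew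
  obtain ⟨δ, hδ⟩ := hσ.exists_sq hs0 hs
  obtain ⟨e₁⟩ := nonempty_quaternion_equiv hσ hs0 hs hδ c
  obtain ⟨e₂⟩ := nonempty_quaternion_equiv_endomorphismAlgebra (S := semilinearMap b σ P) hσ hs0 hs
    hδ (semilinearMap_smul b) (semilinearMap_semilinearMap b hσ hP) hα hα1
    (semilinearMap_rep b hPR) (span_range_rep_eq_top b hspan)
  obtain ⟨e₃⟩ := Representation.nonempty_equiv_of_character_eq τ (inducedRep K ρ hα hα1) (by
    funext y
    apply (algebraMap K L).injective
    apply f.injective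
    rw [hτ, character_inducedRep ρ hσ hα hα1 hρα f hρ])
  obtain ⟨e₄⟩ := nonempty_endomorphismAlgebra_equiv e₃
  exact ⟨(e₄.trans e₂.symm).trans e₁⟩

theorem transpose_mul_gram_mul (H : HermitianForm σ V)
    (hH : ∀ g x y, H.form (ρ g x) (ρ g y) = H.form x y) (g : G) :
    (matrixHom b ρ g).transpose * H.gram b * σ.mapMatrix (matrixHom b ρ g) = H.gram b := by
  rw [matrixHom_apply, H.transpose_toMatrix_mul_gram b (H.form_rep hH g), mul_assoc, ← map_mul,
    ← matrixHom_apply, ← matrixHom_apply, ← map_mul, inv_mul_cancel, map_one, map_one, mul_one]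

/-- If the character field is real, an invariant Hermitian form is a quadratic form. -/
theorem indicatorPlus_of_forall_fixed (H : HermitianForm σ V)
    (hH : ∀ g x y, H.form (ρ g x) (ρ g y) = H.form x y) (f : L →+* ℂ) {χ : G → ℂ}
    (hfσ : ∀ x, f (σ x) = conj (f x))
    (hρ : ∀ g, f (ρ.character g) = χ g) (hfix : ∀ x, σ x = x) : IndicatorPlus χ := by
  let b := Module.finBasis L V
  have hmap : ∀ A : Matrix (Fin (Module.finrank L V)) (Fin (Module.finrank L V)) L,
      σ.mapMatrix A = A := fun A => Matrix.ext fun i j => hfix _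
  refine ⟨fun g => by rw [← hρ, ← hfσ, hfix], affordsQuadraticForm_of_matrix
    (mapHom f (matrixHom b ρ)) (fun g => ?_) (f.mapMatrix (H.gram b)) ?_ ?_ fun g => ?_⟩
  · rw [trace_mapHom, trace_matrixHom, hρ]
  · have h := H.transpose_gram b
    rw [hmap] at h
    exact congrArg f.mapMatrix h
  · rw [← RingHom.map_det]
    exact (map_ne_zero f).2 (H.det_gram_ne_zero b)
  · have h := transpose_mul_gram_mul b H hH g
    rw [hmap] at h
    have h2 := congrArg f.mapMatrix h
    rwa [map_mul, map_mul] at h2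

theorem mainTheorem_of_isConjugation (hσ : IsConjugation σ) {χ : G → ℂ}
    (hχ : IsIrreducibleCharacter χ) {m : ℕ} (hdeg : χ 1 = 2 * (m : ℂ)) (hα : α ^ 2 = 1)
    (f : L →+* ℂ) (hρ : ∀ g, f (ρ.character g) = χ g)
    (hρα : ∀ g, ρ.character (α g) = σ (ρ.character g)) {g₀ : G}
    (hg₀ : σ (ρ.character g₀) ≠ ρ.character g₀)
    (H : HermitianForm σ V) (hH : ∀ g x y, H.form (ρ g x) (ρ g y) = H.form x y)
    {W : Type*} [AddCommGroup W] [Module K W] [FiniteDimensional K W]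
    (τ : Representation K (AutExtension α) W)
    (hτ : ∀ h, f (algebraMap K L (τ.character h)) = 2 * extensionCharacter α χ h) :
    (IsInBrTwo K L (fixedAlgebra K ρ α hα) ∧ IsInBrTwo K L (endomorphismAlgebra K τ) ∧
      BrauerEquiv K (fixedAlgebra K ρ α hα) (endomorphismAlgebra K τ)) ∧
    (∃ hA : (Subalgebra.toSubmodule (fixedAlgebra K ρ α hα)).map H.adjoint =
        Subalgebra.toSubmodule (fixedAlgebra K ρ α hα),
      (IndicatorPlus (extensionCharacter α χ) →
        IsOrthogonalSubalgebra K L H.adjoint (fixedAlgebra K ρ α hα) ∧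
        ∃ (q : Kˣ ⧸ normSubgroup K L) (d : Kˣ), HasLDisc K L (endomorphismAlgebra K τ) q ∧
          HasInvolutionDisc K (restrictSubalgebra H.adjoint (fixedAlgebra K ρ α hα) hA)
            (QuotientGroup.mk d) ∧
          H.HasDisc (q ^ m * QuotientGroup.mk d))) ∧
    (IndicatorMinus (extensionCharacter α χ) →
      ∃ q : Kˣ ⧸ normSubgroup K L, HasLDisc K L (endomorphismAlgebra K τ) q ∧
        H.HasDisc (q ^ m)) := by
  have := Fintype.ofFinite G
  have := IsConjugation.charZero K L
  let b := Module.finBasis L V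
  have hm : Module.finrank L V = 2 * m := by
    have h1 := hρ 1
    rw [Representation.char_one, hdeg, map_natCast] at h1
    exact_mod_cast h1
  have hn0 : Module.finrank L V ≠ 0 := by
    intro h0
    have : Subsingleton V := Module.finrank_zero_iff.1 h0
    have h1 : ρ.character g₀ = 0 := by
      rw [Representation.character, Subsingleton.elim (ρ g₀) 0, map_zero]
    exact hg₀ (by rw [h1, map_zero])
  have : NeZero (Module.finrank L V) := ⟨hn0⟩
  have : Nontrivial V := Module.nontrivial_of_finrank_pos (Nat.pos_of_ne_zero hn0)
  have htr : ∀ g, (matrixHom b ρ g).trace = ρ.character g := trace_matrixHom b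
  have hα1 : α ≠ 1 := by
    rintro rfl
    exact hg₀ (hρα g₀).symm
  have hR : HasScalarCommutant (matrixHom b ρ) :=
    hasScalarCommutant_of_isIrreducibleCharacter hχ f fun g => by rw [htr, hρ]
  have hspan : Submodule.span K (Set.range (matrixHom b ρ)) = ⊤ :=
    span_range_eq_top_of_conj hR hσ (g₀ := g₀) (by rwa [htr])
  obtain ⟨P, c, hP, hPR⟩ := exists_isTwist hσ hR hα (fun g => by rw [htr, htr, hρα])
  obtain ⟨eQ⟩ := nonempty_endomorphismAlgebra_equiv_twistedForm b hσ hP hPR hspan hα hα1 f hρ hρα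
    τ hτ
  let eA := fixedAlgebraEquiv b hα hσ hP hPR hspan
  have hQ := isTwist_quaternionTwist σ c
  have hdisc : HasLDisc K L (endomorphismAlgebra K τ) (QuotientGroup.mk c) :=
    hasLDisc_of_brauerEquiv hσ hQ (BrauerEquiv.of_algEquiv eQ)
  have hA := H.map_adjoint_fixedAlgebra (K := K) hH α hα
  have hMinv := isInvariantPairing_mul hσ hα hPR (transpose_mul_gram_mul b H hH)
  set M := H.gram b * σ.mapMatrix P with hMdef
  have hM0 : M.det ≠ 0 := by
    rw [hMdef, Matrix.det_mul, IsTwist.det_mapMatrix]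
    exact mul_ne_zero (H.det_gram_ne_zero b) ((map_ne_zero σ).2 hP.det_ne_zero)
  have hM0' : (M.map f).det ≠ 0 := by
    have h := RingHom.map_det f M
    rw [RingHom.mapMatrix_apply] at h
    rw [← h]
    exact (map_ne_zero f).2 hM0
  have htrC : ∀ g, (mapHom f (matrixHom b ρ) g).trace = χ g := fun g => by
    rw [trace_mapHom, htr, hρ]
  refine ⟨⟨(hP.isInBrTwo hσ).of_algEquiv eA.symm, (hQ.isInBrTwo hσ).of_algEquiv eQ.symm,
    (BrauerEquiv.of_algEquiv eA).trans ((hP.brauerEquiv hσ hQ).trans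
      (BrauerEquiv.of_algEquiv eQ.symm))⟩, ⟨hA, fun hX => ?_⟩, fun hX => ?_⟩
  · have hMt : M.transpose = M := by
      -- The indicator concerns complex representations, so symmetry is proved for the complex image
      -- of `M` and pulled back along the injection `f`.
      have h := transpose_eq_of_affordsQuadraticForm hα hα1 htrC
        (hasScalarCommutant_of_isIrreducibleCharacter hχ (RingHom.id ℂ) htrC) (g₀ := g₀)
        (by
          rw [htrC, htrC, ← hρ, ← hρ, hρα]
          exact fun h => hg₀ (f.injective h))
        (hMinv.map f) hM0' hX.2
      exact Matrix.map_injective f.injective h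
    obtain ⟨d, hd, x, hx⟩ := exists_hasInvolutionDisc b hα H hA hm hσ hP hPR hspan hMt
    exact ⟨isOrthogonalSubalgebra_fixedAlgebra b hα H hA hσ hP hPR hspan hMt,
      QuotientGroup.mk c, d, hdisc, hd, H.hasDisc_of_basis hσ hm b ⟨x, hx⟩⟩
  · have hMt : M.transpose = -M := by
      -- A symmetric `M` would give the induced character an invariant quadratic form.
      refine (hMinv.transpose_eq_or hα hR hM0).resolve_left fun h => hX.2.2 ?_
      exact affordsQuadraticForm_extensionCharacter hα hα1 htrC (hMinv.map f) hM0'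
        (by rw [← Matrix.transpose_map, h])
    obtain ⟨x, hx⟩ := hP.exists_det_eq_of_transpose_eq_neg hσ
      (by rw [Fintype.card_fin, hm]) (H.transpose_gram b) (H.det_gram_ne_zero b) hMt
    refine ⟨QuotientGroup.mk c, hdisc, ?_⟩
    rw [← QuotientGroup.mk_pow]
    exact H.hasDisc_of_basis hσ hm b ⟨x, by rw [hx, Units.val_pow_eq_pow_val, map_pow]⟩

end Main

/-! ### The character field -/

section CharField

variable {G : Type*} [Group G] {χ : G → ℂ} {α : MulAut G} (hχα : ∀ g, χ (α g) = conj (χ g))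

theorem charFieldConj_charFieldConj (x : CharField χ) :
    charFieldConj hχα (charFieldConj hχα x) = x := by
  apply (algebraMap (CharField χ) ℂ).injective
  rw [algebraMap_charFieldConj, algebraMap_charFieldConj, Complex.conj_conj]

theorem exists_of_charFieldConj_eq (x : CharField χ) (hx : charFieldConj hχα x = x) :
    ∃ k : RealCharField χ, algebraMap (RealCharField χ) (CharField χ) k = x :=
  ⟨⟨x, congrArg (algebraMap (CharField χ) ℂ) hx⟩, rfl⟩

theorem charFieldConj_eq_of_forall (h : ∀ g, conj (χ g) = χ g) (x : CharField χ) :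
    charFieldConj hχα x = x := by
  apply (algebraMap (CharField χ) ℂ).injective
  rw [algebraMap_charFieldConj]
  have hx : ∀ y ∈ charSubfield χ, conj y = y := by
    intro y hy
    unfold charSubfield at hy
    induction hy using IntermediateField.adjoin_induction with
    | mem y hy =>
      obtain ⟨g, rfl⟩ := hy
      exact h g
    | algebraMap q => simp
    | add y z _ _ hy hz => rw [map_add, hy, hz]
    | inv y _ hy => rw [map_inv₀, hy]
    | mul y z _ _ hy hz => rw [map_mul, hy, hz]
  exact hx _ x.2

end CharField

end

theorem mainTheorem1 {G : Type*} [Group G] [Finite G]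
    -- an irreducible character of indicator `o` and even degree `2m`
    (χ : G → ℂ) (hχ : IsIrreducibleCharacter χ) (hind : IndicatorO χ)
    (m : ℕ) (hdeg : χ 1 = 2 * (m : ℂ))
    -- an automorphism with `α² = 1` such that `χ ∘ α` is the complex conjugate of `χ`
    (α : MulAut G) (hα : α ^ 2 = 1) (hχα : ∀ g, χ (α g) = conj (χ g))
    -- a representation over the character field `L = ℚ(χ)` affording `χ`
    {V : Type*} [AddCommGroup V] [Module (CharField χ) V] [FiniteDimensional (CharField χ) V]
    [Module (RealCharField χ) V] [IsScalarTower (RealCharField χ) (CharField χ) V]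
    (ρ : Representation (CharField χ) G V)
    (hρ : ∀ g, algebraMap (CharField χ) ℂ (ρ.character g) = χ g)
    -- an invariant `L/K`-Hermitian form, where `K = ℚ(χ)⁺`
    (H : HermitianForm (charFieldConj hχα) V)
    (hH : ∀ g x y, H.form (ρ g x) (ρ g y) = H.form x y)
    -- a module for `G : ⟨α⟩` over `K` affording twice the induced character
    {W : Type*} [AddCommGroup W] [Module (RealCharField χ) W]
    [FiniteDimensional (RealCharField χ) W]
    (τ : Representation (RealCharField χ) (AutExtension α) W)
    (hτ : ∀ h, algebraMap (RealCharField χ) ℂ (τ.character h) = 2 * extensionCharacter α χ h) :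
    -- (a) `[A] = [𝒬] ∈ Br₂(L, K)`
    (IsInBrTwo (RealCharField χ) (CharField χ) (fixedAlgebra (RealCharField χ) ρ α hα) ∧
      IsInBrTwo (RealCharField χ) (CharField χ) (endomorphismAlgebra (RealCharField χ) τ) ∧
      BrauerEquiv (RealCharField χ) (fixedAlgebra (RealCharField χ) ρ α hα)
        (endomorphismAlgebra (RealCharField χ) τ)) ∧
    -- (b) `ι_H(A) = A`
    (∃ hA : (Subalgebra.toSubmodule (fixedAlgebra (RealCharField χ) ρ α hα)).map H.adjoint =
        Subalgebra.toSubmodule (fixedAlgebra (RealCharField χ) ρ α hα),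
      -- (c) the induced character has indicator `+`
      (IndicatorPlus (extensionCharacter α χ) →
        IsOrthogonalSubalgebra (RealCharField χ) (CharField χ) H.adjoint
          (fixedAlgebra (RealCharField χ) ρ α hα) ∧
        ∃ (q : (RealCharField χ)ˣ ⧸ normSubgroup (RealCharField χ) (CharField χ))
          (d : (RealCharField χ)ˣ),
          HasLDisc (RealCharField χ) (CharField χ) (endomorphismAlgebra (RealCharField χ) τ) q ∧
          HasInvolutionDisc (RealCharField χ)
            (restrictSubalgebra H.adjoint (fixedAlgebra (RealCharField χ) ρ α hα) hA)
            (QuotientGroup.mk d) ∧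
          H.HasDisc (q ^ m * QuotientGroup.mk d))) ∧
    -- (d) the induced character has indicator `-`
    (IndicatorMinus (extensionCharacter α χ) →
      ∃ q : (RealCharField χ)ˣ ⧸ normSubgroup (RealCharField χ) (CharField χ),
        HasLDisc (RealCharField χ) (CharField χ) (endomorphismAlgebra (RealCharField χ) τ) q ∧
        H.HasDisc (q ^ m)) := by
  have hfσ := algebraMap_charFieldConj hχα
  -- If conjugation fixed `L`, then `H` would be symmetric bilinear and `χ` would have indicator
  -- `+`.
  have hσ : IsConjugation (charFieldConj hχα) :=
    ⟨charFieldConj_charFieldConj hχα, exists_of_charFieldConj_eq hχα, by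
      by_contra! h
      exact hind.1 (indicatorPlus_of_forall_fixed H hH (algebraMap (CharField χ) ℂ) hfσ hρ h)⟩
  have hρα : ∀ g, ρ.character (α g) = charFieldConj hχα (ρ.character g) := by
    intro g
    apply (algebraMap (CharField χ) ℂ).injective
    rw [hfσ, hρ, hρ, hχα]
  obtain ⟨g₀, hg₀⟩ : ∃ g, charFieldConj hχα (ρ.character g) ≠ ρ.character g := by
    by_contra! h
    obtain ⟨x, hx⟩ := hσ.nontrivial
    refine hx (charFieldConj_eq_of_forall hχα (fun g => ?_) x)
    rw [← hρ, ← hfσ, h]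
  exact mainTheorem_of_isConjugation hσ hχ hdeg hα (algebraMap (CharField χ) ℂ) hρ hρα hg₀ H hH τ hτ
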